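/- **Setting.** For $V=\mathbb R^k$ let $\bar{\mathscr D}([0,1],V)$ be the set of pairs $(\phi,\Pi)$ where $\phi$ maps each $t\in[0,1]$ to a càdlàg path $\phi(t):[0,1]\to V$, $t\mapsto\phi(t)(1)$ is càdlàg, $\Pi\subset[0,1]$ is at most countable, $\phi(t)$ is constant for $t\notin\Pi$, and for every $\varepsilon>0$ only finitely many $t\in\Pi$ satisfy $\sup_s|\phi(t)(s)-\phi(t)(0)|>\varepsilon$. For $\delta>0$ and $\Pi=\{t_j\}\neq\emptyset$ with $r=\sum_j2^{-j}$, the $\delta$-extension $\phi^\delta:[0,1+\delta]\to V$ is obtained by inserting into $[0,1]$, at each $t_j$, an interval of length $2^{-j}\delta/r$ on which $\phi^\delta$ runs through $\phi(t_j)$ at constant speed, and by $\phi^\delta=\phi(t)(1)$ at the point corresponding to $t$ that follows the inserted interval (if any); if $\Pi=\emptyset$, $\phi^\delta(u)=\phi(\min\{u,1\})(1)$. For $1\le q\le\infty$ let $|h|_{q\text{-var}}=\sup(\sum_j|h(u_{j})-h(u_{j-1})|^q)^{1/q}$ over all partitions (for $q=\infty$: $\sup_{u,v}|h(u)-h(v)|$).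 With $\rho$ ranging over the increasing bijections of $[0,1+\delta]$ put $$\alpha_\infty(\phi_1,\phi_2)=\lim_{\delta\to0}\inf_\rho\max\{|\rho-\mathrm{Id}|_\infty,|\phi_1^\delta\circ\rho-\phi_2^\delta|_\infty\},$$ $$\alpha_{q\text{-var}}(\phi_1,\phi_2)=\lim_{\delta\to0}\inf_\rho\max\{|\rho-\mathrm{Id}|_\infty,\ |(\phi_1^\delta\circ\rho-\phi_2^\delta)(0)|+|\phi_1^\delta\circ\rho-\phi_2^\delta|_{q\text{-var}}\}.$$ The space $\mathscr D([0,1],V)$ of decorated paths is $\bar{\mathscr D}([0,1],V)$ with pairs at $\alpha_\infty$-distance $0$ identified; $|\phi|_{p\text{-var}}=|\phi^\delta|_{p\text{-var}}$ (for any $\delta>0$), and $\mathscr D^{p\text{-var}}=\{\phi\in\mathscr D:|\phi|_{p\text{-var}}<\infty\}$. Let $m,d\ge1$, $1\le p<2$, $\xi\in\mathbb R^m$, $A\in C^\beta(\mathbb R^m,\mathbb R^m)$ with $\beta>1$ and $B\in C^\gamma(\mathbb R^m,\mathbb R^{m\times d})$ with $\gamma>p$, where $f\in C^\gamma$ means that,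 $N$ being the largest integer $<\gamma$, the derivatives of $f$ of order $\le N$ exist and are bounded and those of order $N$ are $(\gamma-N)$-Hölder continuous. For $\phi\in\mathscr D^{p\text{-var}}([0,1],\mathbb R^d)$, a solution of $$dX=A(X)\,dt+B(X)\,d\phi,\qquad X(0)=\xi,$$ is an $X\in\mathscr D^{p\text{-var}}([0,1],\mathbb R^m)$ such that $\phi$ and $X$ have representatives with the same $\Pi$ for which, for every $\delta>0$, $X^\delta$ is a càdlàg solution of finite $p$-variation on $[0,1+\delta]$ of the Young equation $dX^\delta=(A,B)(X^\delta)\,d\omega^\delta$, $X^\delta(0)=\xi$. Here $\omega(t)(s)=(t,\phi(t)(s))$, $\omega^\delta$ is its $\delta$-extension with respect to $\Pi$, and Young integrals are limits of left-point Riemann–Stieltjes sums as the mesh tends to $0$. **Theorem 2.5.** Every $\phi\in\mathscr D^{p\text{-var}}([0,1],\mathbb R^d)$ has a unique solution $X=\mathcal S(\phi)\in\mathscr D^{p\text{-var}}([0,1],\mathbb R^m)$. Let $\phi_n$ be random variables in $\mathscr D^{p\text{-var}}([0,1],\mathbb R^d)$ and $\phi$ a random variable in $\mathscr D([0,1],\mathbb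 R^d)$ (possibly on different probability spaces) such that $\phi_n\to\phi$ weakly in the $\alpha_\infty$ topology, and suppose that $(|\phi_n|_{p\text{-var}})_n$ is tight. Then $|\phi|_{p\text{-var}}<\infty$ almost surely, and $\mathcal S(\phi_n)\to\mathcal S(\phi)$ weakly in $\mathscr D^{p\text{-var}}([0,1],\mathbb R^m)$ with the $\alpha_{q\text{-var}}$ topology, for every $q\in(p,\infty]$. -/

import Mathlib

open Set Filter Topology MeasureTheory
open scoped unitInterval ENNReal NNReal

noncomputable section

/-! ### Càdlàg functions, `p`-variation and Skorokhod distances -/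

/-- `h` is càdlàg: right-continuous with left limits. At the left endpoint of an interval the
requirement on left limits is empty, at the right endpoint right-continuity is empty. -/
def IsCadlag {T V : Type*} [LinearOrder T] [TopologicalSpace T] [TopologicalSpace V]
    (h : T → V) : Prop :=
  ∀ t, ContinuousWithinAt h (Ici t) t ∧ ∃ l, Tendsto h (𝓝[<] t) (𝓝 l)

/-- The `p`-variation seminorm of `h`, for `p ∈ [1, ∞]`, with values in `[0, ∞]`. Repetitions in the
partitions contribute nothing, and adding the endpoints can only increase the sum. -/
def pVariation {T V : Type*} [LinearOrder T] [PseudoEMetricSpace V] (p : ℝ≥0∞) (h : T → V) :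
    ℝ≥0∞ :=
  if p = ∞ then ⨆ (s : T) (t : T), edist (h s) (h t)
  else (⨆ (k : ℕ) (t : ℕ → T) (_ : Monotone t),
    ∑ j ∈ Finset.range k, edist (h (t (j + 1))) (h (t j)) ^ p.toReal) ^ (1 / p.toReal)

/-- The extended time interval `[0, 1 + δ]`. -/
abbrev ExtInterval (δ : ℝ≥0) : Type := Icc (0 : ℝ) (1 + (δ : ℝ))

/-- The left endpoint of `[0, 1 + δ]`. -/
def ExtInterval.zero (δ : ℝ≥0) : ExtInterval δ :=
  ⟨0, le_refl 0, by positivity⟩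

/-- The Skorokhod `J₁` distance of two functions on `[0, 1 + δ]`. The order isomorphisms of the
interval are exactly its increasing continuous bijections. -/
def skorokhodDist {V : Type*} [PseudoEMetricSpace V] {δ : ℝ≥0} (h₁ h₂ : ExtInterval δ → V) :
    ℝ≥0∞ :=
  ⨅ ρ : ExtInterval δ ≃o ExtInterval δ,
    max (⨆ u, edist (ρ u) u) (⨆ u, edist (h₁ (ρ u)) (h₂ u))

/-- The Skorokhod distance in `p`-variation on `[0, 1 + δ]`: the uniform distance of
`h₁ ∘ ρ` and `h₂` is replaced by the norm `|h(0)| + |h|_{p-var}` of `h = h₁ ∘ ρ - h₂`. -/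
def skorokhodVarDist {V : Type*} [SeminormedAddCommGroup V] {δ : ℝ≥0} (p : ℝ≥0∞)
    (h₁ h₂ : ExtInterval δ → V) : ℝ≥0∞ :=
  ⨅ ρ : ExtInterval δ ≃o ExtInterval δ,
    max (⨆ u, edist (ρ u) u)
      (‖h₁ (ρ (ExtInterval.zero δ)) - h₂ (ExtInterval.zero δ)‖ₑ +
        pVariation p (fun u => h₁ (ρ u) - h₂ u))

/-! ### The `δ`-extension -/

/-- The weight `2^{-j}` of the point `t_j` of the countable set `Pi`, for an enumeration of `Pi` by
pairwise distinct indices `j ≥ 1`. -/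
def weight {Pi : Set I} (hPi : Pi.Countable) (t : Pi) : ℝ :=
  (1 / 2) ^ (hPi.toEncodable.encode t + 1)

/-- The length `2^{-j} δ / r` of the fictitious interval inserted at `t_j`, where `r` is the
sum of all the weights. -/
def gapLength {Pi : Set I} (hPi : Pi.Countable) (δ : ℝ≥0) (t : Pi) : ℝ :=
  δ * weight hPi t / ∑' s : Pi, weight hPi s

open Classical in
/-- The time change `τ_δ(t)`: `t` plus the lengths of all the intervals inserted at points `≤ t`. -/
def timeChange {Pi : Set I} (hPi : Pi.Countable) (δ : ℝ≥0) (t : I) : ℝ :=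
  t + ∑' s : Pi, if (s : I) ≤ t then gapLength hPi δ s else 0

open Classical in
/-- The left limit `τ_δ(t⁻)` (equal to `0` at `t = 0`). -/
def timeChangeLeft {Pi : Set I} (hPi : Pi.Countable) (δ : ℝ≥0) (t : I) : ℝ :=
  t + ∑' s : Pi, if (s : I) < t then gapLength hPi δ s else 0

/-- The left inverse `τ_δ⁻¹(u) = inf {s ∈ [0, 1] : u ≤ τ_δ(s)}`. -/
def timeChangeInv {Pi : Set I} (hPi : Pi.Countable) (δ : ℝ≥0) (u : ℝ) : I :=
  projIcc (0 : ℝ) 1 zero_le_one (sInf {x : ℝ | ∃ s : I, (s : ℝ) = x ∧ u ≤ timeChange hPi δ s})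

open Classical in
/-- The `δ`-extension on `[0, 1 + δ]` of the path-valued function `φ` with respect to `Pi`. It is
`φ(t)(1)` at `u = τ_δ(t)`, it runs through `φ(t)` with constant speed on
`[τ_δ(t⁻), τ_δ(t))` for `t ∈ Pi`, and if `Pi` is empty it is `φ(min(u, 1))`. -/
def deltaExtension {V : Type*} (φ : I → I → V) {Pi : Set I} (hPi : Pi.Countable) (δ : ℝ≥0)
    (u : ExtInterval δ) : V :=
  if Pi = ∅ then φ (projIcc (0 : ℝ) 1 zero_le_one (u : ℝ)) 1
  else
    let t := timeChangeInv hPi δ u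
    if (u : ℝ) = timeChange hPi δ t then φ t 1
    else φ t (projIcc (0 : ℝ) 1 zero_le_one
      (((u : ℝ) - timeChangeLeft hPi δ t) / (timeChange hPi δ t - timeChangeLeft hPi δ t)))

/-! ### Decorated paths -/

/-- Pairs `(φ, Π)`: `φ` maps times in `[0, 1]` to càdlàg paths on `[0, 1]`, and `Π` is an at most
countable set of times containing all the non-stationary points of `φ`. -/
structure PreDecoratedPath (E : Type*) [SeminormedAddCommGroup E] where
  /-- `path t s` is `φ(t)(s)`. -/
  path : I → I → E
  /-- The set `Π`. -/
  Pi : Set I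
  isCadlag_path : ∀ t, IsCadlag (path t)
  isCadlag_endpoint : IsCadlag (fun t => path t 1)
  countable_Pi : Pi.Countable
  stationary : ∀ t, t ∉ Pi → ∀ s, path t s = path t 0
  finite_oscillations : ∀ ε : ℝ, 0 < ε → {t ∈ Pi | ∃ s, ε < ‖path t s - path t 0‖}.Finite

/-- The `δ`-extension `φ^δ` of `(φ, Π)`. -/
def PreDecoratedPath.ext {E : Type*} [SeminormedAddCommGroup E] (φ : PreDecoratedPath E)
    (δ : ℝ≥0) : ExtInterval δ → E :=
  deltaExtension φ.path φ.countable_Pi δ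

/-- `α_∞(φ₁, φ₂) = lim_{δ → 0} σ_∞(φ₁^δ, φ₂^δ)`. -/
def PreDecoratedPath.alphaInf {E : Type*} [SeminormedAddCommGroup E]
    (φ₁ φ₂ : PreDecoratedPath E) : ℝ≥0∞ :=
  limUnder (𝓝[>] (0 : ℝ≥0)) fun δ => skorokhodDist (φ₁.ext δ) (φ₂.ext δ)

/-- `α_{p-var}(φ₁, φ₂) = lim_{δ → 0} σ_{p-var}(φ₁^δ, φ₂^δ)`. -/
def PreDecoratedPath.alphaVar {E : Type*} [SeminormedAddCommGroup E] (p : ℝ≥0∞)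
    (φ₁ φ₂ : PreDecoratedPath E) : ℝ≥0∞ :=
  limUnder (𝓝[>] (0 : ℝ≥0)) fun δ => skorokhodVarDist p (φ₁.ext δ) (φ₂.ext δ)

/-- The topology of a distance function: a set is open iff it contains a ball around each of its
points. -/
@[reducible]
def distTopology {T : Type*} (α : T → T → ℝ≥0∞) : TopologicalSpace T where
  IsOpen U := ∀ x ∈ U, ∃ ε : ℝ≥0∞, 0 < ε ∧ ∀ y, α x y < ε → y ∈ U
  isOpen_univ := fun _ _ => ⟨1, one_pos, fun _ _ => trivial⟩
  isOpen_inter := fun _ _ hU hV x hx => by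
    obtain ⟨ε₁, h₁, hU'⟩ := hU x hx.1
    obtain ⟨ε₂, h₂, hV'⟩ := hV x hx.2
    exact ⟨min ε₁ ε₂, lt_min h₁ h₂, fun y hy =>
      ⟨hU' y (hy.trans_le (min_le_left _ _)), hV' y (hy.trans_le (min_le_right _ _))⟩⟩
  isOpen_sUnion := fun _ hS x ⟨U, hU, hx⟩ => by
    obtain ⟨ε, h, hU'⟩ := hS U hU x hx
    exact ⟨ε, h, fun y hy => ⟨U, hU, hU' y hy⟩⟩

/-- Pairs `(φ, Π)` carry the topology of the pseudometric `α_∞`. -/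
instance {E : Type*} [SeminormedAddCommGroup E] : TopologicalSpace (PreDecoratedPath E) :=
  distTopology PreDecoratedPath.alphaInf

/-- The space of decorated paths over `[0, 1]`, with the `α_∞` topology: the metric space obtained
from the pseudometric `α_∞` by identifying pairs at distance zero (topologically indistinguishable
pairs), that is, pairs that differ by a reparametrisation. -/
abbrev DecoratedPath (E : Type*) [SeminormedAddCommGroup E] : Type _ :=
  SeparationQuotient (PreDecoratedPath E)

/-- The `α_∞` topology on the space of decorated paths. -/
abbrev alphaInfTopology (E : Type*) [SeminormedAddCommGroup E] :
    TopologicalSpace (DecoratedPath E) :=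
  inferInstance

/-- The `p`-variation of a decorated path, which is the `p`-variation of a `δ`-extension. It does not
depend on `δ > 0` or on the representative; the choice here is `δ = 1`. -/
def DecoratedPath.pVar {E : Type*} [SeminormedAddCommGroup E] (p : ℝ≥0∞) (φ : DecoratedPath E) :
    ℝ≥0∞ :=
  pVariation p ((Quotient.out φ : PreDecoratedPath E).ext 1)

/-- The decorated paths of finite `p`-variation. -/
def VarDecoratedPath (p : ℝ≥0∞) (E : Type*) [SeminormedAddCommGroup E] : Type _ :=
  {φ : DecoratedPath E // DecoratedPath.pVar p φ < ∞}

/-- The `α_{q-var}` topology on the decorated paths of finite `p`-variation (`p ≤ q`). -/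
@[reducible]
def alphaVarTopology (q p : ℝ≥0∞) (E : Type*) [SeminormedAddCommGroup E] :
    TopologicalSpace (VarDecoratedPath p E) :=
  distTopology fun φ₁ φ₂ =>
    PreDecoratedPath.alphaVar q (Quotient.out φ₁.1) (Quotient.out φ₂.1)

/-! ### Differential equations driven by decorated paths -/

/-- The space `C^γ` for `γ > 0`: with `N` the largest integer smaller than `γ`, all derivatives up to
order `N` exist and are bounded, and the `N`-th derivative is Hölder continuous of exponent
`γ - N ∈ (0, 1]`. -/
def IsHolderClass {V W : Type*} [NormedAddCommGroup V] [NormedSpace ℝ V] [NormedAddCommGroup W]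
    [NormedSpace ℝ W] (γ : ℝ) (f : V → W) : Prop :=
  ContDiff ℝ ((⌈γ⌉₊ - 1 : ℕ) : WithTop ℕ∞) f ∧
  ∃ C : ℝ, (∀ k ≤ ⌈γ⌉₊ - 1, ∀ x, ‖iteratedFDeriv ℝ k f x‖ ≤ C) ∧
    ∀ x y, ‖iteratedFDeriv ℝ (⌈γ⌉₊ - 1) f x - iteratedFDeriv ℝ (⌈γ⌉₊ - 1) f y‖ ≤
      C * ‖x - y‖ ^ (γ - ((⌈γ⌉₊ - 1 : ℕ) : ℝ))

/-- The Young integral `∫_0^u Y dω` of an operator-valued càdlàg function `Y` on `[0, 1 + δ]` against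
a càdlàg function `ω` equals `J`: the left-point Riemann-Stieltjes sums over partitions of `[0, u]`
converge to `J` as the mesh tends to zero. -/
def HasYoungIntegral {V W : Type*} [NormedAddCommGroup V] [NormedSpace ℝ V] [NormedAddCommGroup W]
    [NormedSpace ℝ W] {δ : ℝ≥0} (Y : ExtInterval δ → V →L[ℝ] W) (ω : ExtInterval δ → V)
    (u : ExtInterval δ) (J : W) : Prop :=
  ∀ ε : ℝ, 0 < ε → ∃ η : ℝ, 0 < η ∧ ∀ (k : ℕ) (t : ℕ → ExtInterval δ), Monotone t →
    t 0 = ExtInterval.zero δ → t k = u → (∀ j < k, (t (j + 1) : ℝ) - t j < η) →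
    ‖∑ j ∈ Finset.range k, Y (t j) (ω (t (j + 1)) - ω (t j)) - J‖ < ε

/-- `X` is a càdlàg solution of finite `p`-variation on `[0, 1 + δ]` of the Young differential
equation `dX = f(X) dω`, `X(0) = ξ`. -/
def IsYoungSolution {V W : Type*} [NormedAddCommGroup V] [NormedSpace ℝ V] [NormedAddCommGroup W]
    [NormedSpace ℝ W] {δ : ℝ≥0} (p : ℝ≥0∞) (f : W → V →L[ℝ] W) (ξ : W) (ω : ExtInterval δ → V)
    (X : ExtInterval δ → W) : Prop :=
  IsCadlag X ∧ pVariation p X < ∞ ∧ X (ExtInterval.zero δ) = ξ ∧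
    ∀ u, HasYoungIntegral (fun t => f (X t)) ω u (X u - ξ)

/-- The vector fields `(A, B)`: `(A, B)(x) (a, v) = a A(x) + B(x) v`. -/
def combinedField {E F : Type*} [NormedAddCommGroup E] [NormedSpace ℝ E] [NormedAddCommGroup F]
    [NormedSpace ℝ F] (A : F → F) (B : F → E →L[ℝ] F) (x : F) : (ℝ × E) →L[ℝ] F :=
  (ContinuousLinearMap.toSpanSingleton ℝ (A x)).coprod (B x)

/-- The `δ`-extension `ω^δ` of `ω = ((ι Id, φ), Π)`, where `ω(t)(s) = (t, φ(t)(s))`. -/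
def PreDecoratedPath.timeExt {E : Type*} [SeminormedAddCommGroup E] (φ : PreDecoratedPath E)
    (δ : ℝ≥0) : ExtInterval δ → ℝ × E :=
  deltaExtension (fun t s => ((t : ℝ), φ.path t s)) φ.countable_Pi δ

/-- `X` is a solution of `dX = A(X) dt + B(X) dφ`, `X(0) = ξ`: for suitable representatives with the
same set `Π`, the `δ`-extension of `X` solves the Young differential equation driven by the
`δ`-extension `ω^δ` of `(ι Id, φ)`. -/
def IsDecoratedSolution {E F : Type*} [NormedAddCommGroup E] [NormedSpace ℝ E]
    [NormedAddCommGroup F] [NormedSpace ℝ F] (p : ℝ≥0∞) (A : F → F) (B : F → E →L[ℝ] F) (ξ : F)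
    (φ : DecoratedPath E) (X : DecoratedPath F) : Prop :=
  ∃ (φ' : PreDecoratedPath E) (X' : PreDecoratedPath F),
    SeparationQuotient.mk φ' = φ ∧ SeparationQuotient.mk X' = X ∧ X'.Pi = φ'.Pi ∧
    ∀ δ : ℝ≥0, 0 < δ → IsYoungSolution p (combinedField A B) ξ (φ'.timeExt δ) (X'.ext δ)

/-! ### Weak convergence -/

/-- Weak convergence (convergence in distribution) of random variables with values in a topological
space with its Borel `σ`-algebra. -/
def ConvergesWeakly {T : Type*} (τ : TopologicalSpace T) {Ω : ℕ → Type*} {Ω' : Type*}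
    [∀ n, MeasurableSpace (Ω n)] [MeasurableSpace Ω'] (P : ∀ n, Measure (Ω n)) (P' : Measure Ω')
    [∀ n, IsProbabilityMeasure (P n)] [IsProbabilityMeasure P'] (X : ∀ n, Ω n → T) (Z : Ω' → T) :
    Prop :=
  letI : TopologicalSpace T := τ
  letI : MeasurableSpace T := borel T
  haveI : BorelSpace T := ⟨rfl⟩
  TendstoInDistribution X atTop Z P P'

end

/-!
# Differential equations driven by random decorated paths

*Decorated paths as parametrised graphs.* Extensions of one decorated path for different `δ > 0` are
reparametrisations of each other (`deltaExtension_rescale`), and as `δ → 0` the term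
`|ρ - Id|` only sees the times in `[0, 1]` to which the points of the extended interval belong.
Hence `α_∞` is the distance, modulo increasing bijections, of the graphs `u ↦ (t(u), φ(u))` at
`δ = 1` (`PreDecoratedPath.alphaInf_eq`), and `α_{q-var}` has a similar description
(`PreDecoratedPath.alphaVar_eq`). In particular `α_∞` is a pseudometric. Càdlàg functions are
handled through `FiniteOscillation`, a purely order-theoretic form of the notion which is visibly
invariant under reparametrisation.

*The Young equation.* All estimates are made for discrete sums along partitions, in terms of
controls without any continuity, so that jumps need no separate treatment. The discrete sewing lemma
`discrete_sewing` gives the Love--Young inequality `discrete_young`, from which follow an a priori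
bound for Euler schemes (`euler_apriori`) and their stability (`euler_stability`). For stability
the drift `A` needs to be Lipschitz only, as time has bounded variation, while `B` has to satisfy
the four-point estimate `FourPoint`, a consequence of the Hölder continuity of its derivative.
Young integrals are defined by convergence at each end point separately; for `p < 2` this
convergence is automatically uniform in the end point (`isUniformSolution_of_hasYoungIntegral`),
which makes a solution an approximate Euler scheme along every fine partition. Stability then
yields uniqueness, and uniform continuity of the solution in the driver with respect to the uniform
norm on sets of bounded variation (`exists_solution_sub_le`); existence follows by taking limits
of Euler schemes (`exists_uniformSolution`).

*Back to decorated paths.* A solution is constant where the driver is, so that it is itself the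
extension of a decorated path with the same time set (`PreDecoratedPath.ofExt`), and it is
transported by reparametrisations of the driver. The uniform continuity above therefore becomes
uniform continuity in `α_∞` on sets of bounded `p`-variation (`Solves.exists_alphaInf_lt`), which
shows at the same time that the solution map is well defined on classes. Interpolating between the
uniform distance and the `p`-variation upgrades the conclusion from `α_∞` to `α_{q-var}` for
every `q > p` (`PreDecoratedPath.exists_alphaVar_lt`, `exists_solutionMap`).

*Weak convergence.* The `p`-variation is lower semicontinuous for `α_∞`
(`DecoratedPath.isClosed_pVar_le`), so by the portmanteau theorem tightness of the variations
passes to the limit (`ae_lt_top_of_tight`). As the solution map is continuous on the closed sets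
of bounded `p`-variation only, the conclusion comes from a version of the continuous mapping
theorem for such maps, in which tightness bounds the mass outside these sets
(`tendstoInDistribution_comp_of_tight`).
-/


/-! ### Controls and discrete sewing -/

/-- A control: a nonnegative function that is superadditive on ordered triples `i ≤ j ≤ k`. It is
used to bound powers of increments; no continuity is asked for, so that jumps are allowed. -/
structure IsControl {T : Type*} [Preorder T] (w : T → T → ℝ) : Prop where
  nonneg : ∀ i j, 0 ≤ w i j
  superadd : ∀ i j k, i ≤ j → j ≤ k → w i j + w j k ≤ w i k

namespace IsControl

variable {T : Type*} [Preorder T] {w w' : T → T → ℝ}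

lemma self (hw : IsControl w) (i : T) : w i i = 0 := by
  have h1 := hw.superadd i i i le_rfl le_rfl
  have h2 := hw.nonneg i i
  linarith

lemma mono (hw : IsControl w) {i i' j' j : T} (h1 : i ≤ i') (h2 : i' ≤ j') (h3 : j' ≤ j) :
    w i' j' ≤ w i j := by
  have h4 := hw.superadd i i' j h1 (h2.trans h3)
  have h5 := hw.superadd i' j' j h2 h3
  have h6 := hw.nonneg i i'
  have h7 := hw.nonneg j' j
  linarith

lemma add (hw : IsControl w) (hw' : IsControl w') : IsControl (fun i j => w i j + w' i j) where
  nonneg _ _ := add_nonneg (hw.nonneg _ _) (hw'.nonneg _ _)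
  superadd i j k h1 h2 := by
    have h3 := hw.superadd i j k h1 h2
    have h4 := hw'.superadd i j k h1 h2
    linarith

lemma const_mul (hw : IsControl w) {c : ℝ} (hc : 0 ≤ c) : IsControl (fun i j => c * w i j) where
  nonneg i j := mul_nonneg hc (hw.nonneg i j)
  superadd i j k h1 h2 := by
    have h3 := mul_le_mul_of_nonneg_left (hw.superadd i j k h1 h2) hc
    linarith

lemma comp (hw : IsControl w) {S : Type*} [Preorder S] {t : S → T} (ht : Monotone t) :
    IsControl (fun i j => w (t i) (t j)) where
  nonneg _ _ := hw.nonneg _ _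
  superadd _ _ _ h1 h2 := hw.superadd _ _ _ (ht h1) (ht h2)

lemma sum_le {w : ℕ → ℕ → ℝ} (hw : IsControl w) {i j : ℕ} (hij : i ≤ j) :
    ∑ l ∈ Finset.Ico i j, w l (l + 1) ≤ w i j := by
  induction j, hij using Nat.le_induction with
  | base => simpa using hw.nonneg i i
  | succ j hij ih =>
    rw [Finset.sum_Ico_succ_top hij]
    have := hw.superadd i j (j + 1) hij (Nat.le_succ j)
    linarith

end IsControl

/-- The last index before a function exceeds a threshold. -/
lemma exists_last_le (g : ℕ → ℝ) (c : ℝ) {i j : ℕ} (hij : i < j) :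
    ∃ m, i ≤ m ∧ m < j ∧ (m = i ∨ g m ≤ c) ∧ (m + 1 = j ∨ c < g (m + 1)) := by
  induction j, hij using Nat.le_induction with
  | base => exact ⟨i, le_rfl, Nat.lt_succ_self i, Or.inl rfl, Or.inl rfl⟩
  | succ j hij ih =>
    obtain ⟨m, h1, h2, h3, h4⟩ := ih
    by_cases h5 : c < g (m + 1)
    · exact ⟨m, h1, by omega, h3, Or.inr h5⟩
    · have h6 : m + 1 = j := h4.resolve_right h5
      exact ⟨j, by omega, by omega, Or.inr (h6 ▸ not_lt.1 h5), Or.inl rfl⟩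

/-- The constant of the discrete sewing lemma. -/
noncomputable def sewingConst (θ : ℝ) : ℝ := 2 / (1 - 2 ^ (1 - θ))

lemma sewingConst_denom_pos {θ : ℝ} (hθ : 1 < θ) : 0 < 1 - (2 : ℝ) ^ (1 - θ) := by
  have := Real.rpow_lt_one_of_one_lt_of_neg (x := (2 : ℝ)) (z := 1 - θ) (by norm_num) (by linarith)
  linarith

lemma sewingConst_pos {θ : ℝ} (hθ : 1 < θ) : 0 < sewingConst θ :=
  div_pos two_pos (sewingConst_denom_pos hθ)

/-- The discrete sewing lemma. The proof splits `[i, j]` at the step across which the control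
exceeds half of its total, so that both remaining parts carry at most half of it. -/
theorem discrete_sewing {W : Type*} [SeminormedAddCommGroup W] {w : ℕ → ℕ → ℝ} (hw : IsControl w)
    {θ C : ℝ} (hθ : 1 < θ) (hC : 0 ≤ C) (Ξ : ℕ → ℕ → W) (hΞ : ∀ i, Ξ i i = 0) {a b : ℕ}
    (hδ : ∀ i j k, a ≤ i → i ≤ j → j ≤ k → k ≤ b →
      ‖Ξ i j + Ξ j k - Ξ i k‖ ≤ C * w i k ^ θ) {i j : ℕ} (hi : a ≤ i) (hij : i ≤ j) (hj : j ≤ b) :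
    ‖∑ l ∈ Finset.Ico i j, Ξ l (l + 1) - Ξ i j‖ ≤ sewingConst θ * C * w i j ^ θ := by
  obtain ⟨n, hn⟩ : ∃ n, j - i ≤ n := ⟨_, le_rfl⟩
  induction n generalizing i j with
  | zero =>
    obtain rfl : i = j := by omega
    have h1 := (sewingConst_pos hθ).le
    have h2 := Real.rpow_nonneg (hw.nonneg i i) θ
    simpa [hΞ] using by positivity
  | succ n ih =>
    rcases hij.eq_or_lt with rfl | hlt
    · have h1 := (sewingConst_pos hθ).le
      have h2 := Real.rpow_nonneg (hw.nonneg i i) θ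
      simpa [hΞ] using by positivity
    obtain ⟨m, h1, h2, h3, h4⟩ := exists_last_le (w i) (w i j / 2) hlt
    have hwij := hw.nonneg i j
    have h3' : w i m ≤ w i j / 2 := by
      rcases h3 with rfl | h3
      · rw [hw.self]; linarith
      · exact h3
    have h4' : w (m + 1) j ≤ w i j / 2 := by
      rcases h4 with rfl | h4
      · rw [hw.self]; linarith
      · have := hw.superadd i (m + 1) j (by omega) (by omega)
        linarith
    have hK := sewingConst_pos hθ
    have e1 := ih hi h1 (by omega) (by omega)
    have e2 := ih (i := m + 1) (j := j) (by omega) (by omega) hj (by omega)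
    have e3 := hδ i m (m + 1) hi h1 (by omega) (by omega)
    have e4 := hδ i (m + 1) j hi (by omega) (by omega) hj
    have hm : w i (m + 1) ^ θ ≤ w i j ^ θ :=
      Real.rpow_le_rpow (hw.nonneg _ _) (hw.mono le_rfl (by omega) (by omega)) (by linarith)
    have r1 : w i m ^ θ ≤ (w i j / 2) ^ θ :=
      Real.rpow_le_rpow (hw.nonneg _ _) h3' (by linarith)
    have r2 : w (m + 1) j ^ θ ≤ (w i j / 2) ^ θ :=
      Real.rpow_le_rpow (hw.nonneg _ _) h4' (by linarith)
    have r3 : (w i j / 2) ^ θ = w i j ^ θ * 2 ^ (1 - θ) / 2 := by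
      rw [Real.div_rpow hwij two_pos.le, Real.rpow_sub two_pos, Real.rpow_one]
      field_simp
    have hsum : ∑ l ∈ Finset.Ico i j, Ξ l (l + 1) =
        ∑ l ∈ Finset.Ico i m, Ξ l (l + 1) + Ξ m (m + 1) +
          ∑ l ∈ Finset.Ico (m + 1) j, Ξ l (l + 1) := by
      rw [← Finset.sum_Ico_succ_top h1, Finset.sum_Ico_consecutive _ (by omega) (by omega)]
    have hdec : ∑ l ∈ Finset.Ico i j, Ξ l (l + 1) - Ξ i j =
        ((∑ l ∈ Finset.Ico i m, Ξ l (l + 1) - Ξ i m) +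
          (∑ l ∈ Finset.Ico (m + 1) j, Ξ l (l + 1) - Ξ (m + 1) j)) +
        ((Ξ i m + Ξ m (m + 1) - Ξ i (m + 1)) + (Ξ i (m + 1) + Ξ (m + 1) j - Ξ i j)) := by
      rw [hsum]; abel
    have hKC : 0 ≤ sewingConst θ * C := by positivity
    have f1 : ‖∑ l ∈ Finset.Ico i m, Ξ l (l + 1) - Ξ i m‖ ≤
        sewingConst θ * C * (w i j / 2) ^ θ := e1.trans (mul_le_mul_of_nonneg_left r1 hKC)
    have f2 : ‖∑ l ∈ Finset.Ico (m + 1) j, Ξ l (l + 1) - Ξ (m + 1) j‖ ≤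
        sewingConst θ * C * (w i j / 2) ^ θ := e2.trans (mul_le_mul_of_nonneg_left r2 hKC)
    have f3 := e3.trans (mul_le_mul_of_nonneg_left hm hC)
    have hfix : sewingConst θ * C * (w i j / 2) ^ θ + sewingConst θ * C * (w i j / 2) ^ θ +
        (C * w i j ^ θ + C * w i j ^ θ) = sewingConst θ * C * w i j ^ θ := by
      have hd := sewingConst_denom_pos hθ
      have : sewingConst θ * (1 - 2 ^ (1 - θ)) = 2 := by
        unfold sewingConst; field_simp
      rw [r3]
      linear_combination (-C * w i j ^ θ) * this
    rw [hdec, ← hfix]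
    exact (norm_add_le _ _).trans (add_le_add ((norm_add_le _ _).trans (add_le_add f1 f2))
      ((norm_add_le _ _).trans (add_le_add f3 e4)))

/-- The discrete Love--Young inequality. -/
theorem discrete_young {V W : Type*} [NormedAddCommGroup V] [NormedSpace ℝ V]
    [NormedAddCommGroup W] [NormedSpace ℝ W] {w : ℕ → ℕ → ℝ} (hw : IsControl w)
    {α β C D : ℝ} (hα : 0 ≤ α) (hβ : 0 ≤ β) (hθ : 1 < α + β) (hC : 0 ≤ C) (hD : 0 ≤ D)
    (y : ℕ → V →L[ℝ] W) (v : ℕ → V) {a b : ℕ}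
    (hy : ∀ i j, a ≤ i → i ≤ j → j ≤ b → ‖y j - y i‖ ≤ C * w i j ^ α)
    (hv : ∀ i j, a ≤ i → i ≤ j → j ≤ b → ‖v j - v i‖ ≤ D * w i j ^ β)
    {i j : ℕ} (hi : a ≤ i) (hij : i ≤ j) (hj : j ≤ b) :
    ‖∑ l ∈ Finset.Ico i j, y l (v (l + 1) - v l) - y i (v j - v i)‖ ≤
      sewingConst (α + β) * (C * D) * w i j ^ (α + β) := by
  refine discrete_sewing hw hθ (by positivity) (fun i j => y i (v j - v i)) (by simp)
    (a := a) (b := b) ?_ hi hij hj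
  intro i j k hi hij hjk hk
  have e : y i (v j - v i) + y j (v k - v j) - y i (v k - v i) = (y j - y i) (v k - v j) := by
    simp only [map_sub, _root_.sub_apply]; abel
  have w1 : w i j ^ α ≤ w i k ^ α :=
    Real.rpow_le_rpow (hw.nonneg _ _) (hw.mono le_rfl hij hjk) hα
  have w2 : w j k ^ β ≤ w i k ^ β :=
    Real.rpow_le_rpow (hw.nonneg _ _) (hw.mono hij hjk le_rfl) hβ
  have p1 := Real.rpow_nonneg (hw.nonneg i k) α
  have p2 := Real.rpow_nonneg (hw.nonneg i k) β
  rw [e]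
  calc ‖(y j - y i) (v k - v j)‖ ≤ ‖y j - y i‖ * ‖v k - v j‖ := ContinuousLinearMap.le_opNorm _ _
    _ ≤ (C * w i k ^ α) * (D * w i k ^ β) :=
      mul_le_mul ((hy i j hi hij (hjk.trans hk)).trans (by gcongr))
        ((hv j k (hi.trans hij) hjk hk).trans (by gcongr)) (norm_nonneg _) (by positivity)
    _ = C * D * w i k ^ (α + β) := by
      rw [Real.rpow_add_of_nonneg (hw.nonneg _ _) hα hβ]; ring

/-- A relation that holds on blocks of small control and across single steps, and that composes,
holds between any two indices, with a count of the pieces. -/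
theorem IsControl.block_induction {w : ℕ → ℕ → ℝ} (hw : IsControl w) {c : ℝ} (hc : 0 < c)
    (R : ℕ → ℕ → ℕ → Prop) (hloc : ∀ a b, a ≤ b → w a b ≤ c → R 1 a b)
    (hstep : ∀ m, R 1 m (m + 1))
    (htrans : ∀ r s a m b, R r a m → R s m b → R (r + s) a b) (q : ℕ) :
    ∀ a b, a ≤ b → w a b ≤ q * c → ∃ r ≤ 2 * q + 1, R r a b := by
  induction q with
  | zero => exact fun a b hab h => ⟨1, le_rfl, hloc a b hab (by simp at h; linarith)⟩
  | succ q ih =>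
    intro a b hab h
    by_cases h1 : w a b ≤ c
    · exact ⟨1, by omega, hloc a b hab h1⟩
    have hlt : a < b := by
      refine lt_of_le_of_ne hab ?_
      rintro rfl
      rw [hw.self] at h1
      exact h1 hc.le
    obtain ⟨m, h2, h3, h4, h5⟩ := exists_last_le (w a) c hlt
    have h4' : w a m ≤ c := by
      rcases h4 with rfl | h4
      · rw [hw.self]; exact hc.le
      · exact h4
    have hR := htrans _ _ _ _ _ (hloc a m h2 h4') (hstep m)
    rcases h5 with rfl | h5
    · exact ⟨_, by omega, hR⟩
    · have h6 : w (m + 1) b ≤ q * c := by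
        have := hw.superadd a (m + 1) b (by omega) (by omega)
        push_cast at h
        linarith
      obtain ⟨r, hr, hR'⟩ := ih (m + 1) b (by omega) h6
      exact ⟨_, by omega, htrans _ _ _ _ _ hR hR'⟩

/-- A bound that improves itself to half of its size plus `A` can be replaced by `2 A`. -/
lemma le_of_bootstrap {ι : Type*} (u v : ι → ℝ) {A N₀ : ℝ} (hA : 0 ≤ A) (hN₀ : 0 ≤ N₀)
    (hv : ∀ i, 0 ≤ v i) (h₀ : ∀ i, u i ≤ N₀ * v i)
    (hstep : ∀ N, 0 ≤ N → (∀ i, u i ≤ N * v i) → ∀ i, u i ≤ (N / 2 + A) * v i) (i : ι) :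
    u i ≤ 2 * A * v i := by
  have key : ∀ n : ℕ, ∀ i, u i ≤ (N₀ * (1 / 2) ^ n + 2 * A) * v i := by
    intro n
    induction n with
    | zero =>
      intro i
      refine (h₀ i).trans (mul_le_mul_of_nonneg_right ?_ (hv i))
      simp; linarith
    | succ n ih =>
      intro i
      have := hstep _ (by positivity) ih i
      calc u i ≤ _ := this
        _ = _ := by ring
  have hlim : Tendsto (fun n : ℕ => (N₀ * (1 / 2) ^ n + 2 * A) * v i) atTop
      (𝓝 ((N₀ * 0 + 2 * A) * v i)) :=
    ((((tendsto_pow_atTop_nhds_zero_of_lt_one (by norm_num) (by norm_num)).const_mul N₀).add_const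
      _).mul_const _)
  have := ge_of_tendsto' hlim (fun n => key n i)
  simpa using this

lemma exists_pos_mul_rpow_le (B : ℝ) {a : ℝ} (ha : 0 < a) :
    ∃ c : ℝ, 0 < c ∧ c ≤ 1 ∧ B * c ^ a ≤ 1 / 2 := by
  have h : Tendsto (fun c : ℝ => B * c ^ a) (𝓝[>] 0) (𝓝 (B * 0)) := by
    refine Tendsto.const_mul _ ?_
    have := (Real.continuousAt_rpow_const 0 a (Or.inr ha.le)).tendsto
    rw [Real.zero_rpow ha.ne'] at this
    exact this.mono_left nhdsWithin_le_nhds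
  have h1 : ∀ᶠ c : ℝ in 𝓝[>] 0, B * c ^ a < 1 / 2 :=
    h.eventually (gt_mem_nhds (by norm_num))
  have h2 : ∀ᶠ c : ℝ in 𝓝[>] 0, c ∈ Ioc (0 : ℝ) 1 := Ioc_mem_nhdsGT one_pos
  obtain ⟨c, hc1, hc2⟩ := (h1.and h2).exists
  exact ⟨c, hc2.1, hc2.2, hc1.le⟩

/-! ### A priori bound and stability of discrete Young equations -/

section Discrete

variable {V W : Type*} [NormedAddCommGroup V] [NormedSpace ℝ V] [NormedAddCommGroup W]
  [NormedSpace ℝ W]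

lemma rpow_mul_self_le {x c a : ℝ} (hx : 0 ≤ x) (hxc : x ≤ c) {b : ℝ} (hb : 0 ≤ b) (ha : 0 ≤ a) :
    x ^ (b + a) ≤ c ^ b * x ^ a := by
  rw [Real.rpow_add_of_nonneg hx hb ha]
  exact mul_le_mul_of_nonneg_right (Real.rpow_le_rpow hx hxc hb) (Real.rpow_nonneg hx a)

/-- A priori bound for Euler schemes: the solution is controlled by the control of the driver,
uniformly in the number of steps. -/
theorem euler_apriori (f : V → W →L[ℝ] V) {M L a : ℝ} (hM0 : 0 ≤ M) (hL0 : 0 ≤ L)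
    (hM : ∀ x, ‖f x‖ ≤ M) (hL : ∀ x y, ‖f x - f y‖ ≤ L * ‖x - y‖) (ha : 1 / 2 < a) (K : ℝ)
    (hK : 0 ≤ K) :
    ∃ C : ℝ, 0 ≤ C ∧ ∀ (w : ℕ → ℕ → ℝ) (v : ℕ → W) (x : ℕ → V), IsControl w →
      (∀ i j, w i j ≤ K) → (∀ i j, i ≤ j → ‖v j - v i‖ ≤ w i j ^ a) →
      (∀ k, x (k + 1) = x k + f (x k) (v (k + 1) - v k)) →
      ∀ i j, i ≤ j → ‖x j - x i‖ ≤ C * w i j ^ a := by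
  have ha0 : 0 < a := by linarith
  have hθ : 1 < a + a := by linarith
  have hY := (sewingConst_pos hθ).le
  obtain ⟨c, hc0, hc1, hc⟩ := exists_pos_mul_rpow_le (sewingConst (a + a) * L) ha0
  have hca : c ^ a ≤ 1 := Real.rpow_le_one hc0.le hc1 ha0.le
  set S : ℝ := 2 * M + M * K ^ a with hS
  have hKa : 0 ≤ K ^ a := Real.rpow_nonneg hK a
  obtain ⟨q, hq⟩ := exists_nat_ge (K / c)
  have hqK : K ≤ q * c := by rwa [div_le_iff₀ hc0] at hq
  have hca0 : 0 < c ^ a := Real.rpow_pos_of_pos hc0 a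
  refine ⟨max (2 * M) ((2 * q + 1) * S / c ^ a), le_max_of_le_left (by positivity), ?_⟩
  intro w v x hw hwK hv hx
  have hsum : ∀ i j, i ≤ j →
      x j - x i = ∑ l ∈ Finset.Ico i j, f (x l) (v (l + 1) - v l) := by
    intro i j hij
    induction j, hij using Nat.le_induction with
    | base => simp
    | succ j hij ih =>
      rw [Finset.sum_Ico_succ_top hij, ← ih, hx j]; abel
  have hloc : ∀ i₀ j₀, w i₀ j₀ ≤ c → ∀ i j, i₀ ≤ i → i ≤ j → j ≤ j₀ →
      ‖x j - x i‖ ≤ 2 * M * w i j ^ a := by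
    intro i₀ j₀ hwc i j hi hij hj
    let ι := {z : ℕ × ℕ // i₀ ≤ z.1 ∧ z.1 ≤ z.2 ∧ z.2 ≤ j₀}
    refine le_of_bootstrap (ι := ι) (fun z => ‖x z.1.2 - x z.1.1‖) (fun z => w z.1.1 z.1.2 ^ a)
      (A := M) (N₀ := M * j₀) hM0 (by positivity) (fun z => Real.rpow_nonneg (hw.nonneg _ _) _)
      ?_ ?_ ⟨(i, j), hi, hij, hj⟩
    · rintro ⟨⟨i, j⟩, hi, hij, hj⟩
      dsimp only at hi hij hj ⊢
      rw [hsum i j hij]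
      have : ∀ l ∈ Finset.Ico i j, ‖f (x l) (v (l + 1) - v l)‖ ≤ M * w i j ^ a := by
        intro l hl
        rw [Finset.mem_Ico] at hl
        refine (ContinuousLinearMap.le_opNorm _ _).trans ?_
        refine mul_le_mul (hM _) ((hv l (l + 1) (Nat.le_succ l)).trans ?_) (norm_nonneg _) hM0
        exact Real.rpow_le_rpow (hw.nonneg _ _) (hw.mono hl.1 (Nat.le_succ l) hl.2) ha0.le
      refine (norm_sum_le_of_le _ this).trans ?_
      have hw0 := Real.rpow_nonneg (hw.nonneg i j) a
      rw [Finset.sum_const, Nat.card_Ico, nsmul_eq_mul]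
      have h1 : ((j - i : ℕ) : ℝ) ≤ j₀ := by exact_mod_cast (by omega)
      calc ((j - i : ℕ) : ℝ) * (M * w i j ^ a) ≤ j₀ * (M * w i j ^ a) := by gcongr
        _ = _ := by ring
    · rintro N hN hbd ⟨⟨i, j⟩, hi, hij, hj⟩
      dsimp only at hi hij hj ⊢
      have hbd' : ∀ i j, i₀ ≤ i → i ≤ j → j ≤ j₀ → ‖x j - x i‖ ≤ N * w i j ^ a :=
        fun i j h1 h2 h3 => hbd ⟨(i, j), h1, h2, h3⟩
      have hy := discrete_young hw ha0.le ha0.le hθ (mul_nonneg hL0 hN) zero_le_one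
        (fun l => f (x l)) v (a := i₀) (b := j₀)
        (fun i j h1 h2 h3 => (hL _ _).trans (by
          rw [mul_assoc]; exact mul_le_mul_of_nonneg_left (hbd' i j h1 h2 h3) hL0))
        (fun i j _ h2 _ => by rw [one_mul]; exact hv i j h2) hi hij hj
      rw [← hsum i j hij] at hy
      have hw0 := Real.rpow_nonneg (hw.nonneg i j) a
      have h1 : ‖f (x i) (v j - v i)‖ ≤ M * w i j ^ a :=
        (ContinuousLinearMap.le_opNorm _ _).trans
          (mul_le_mul (hM _) (hv i j hij) (norm_nonneg _) hM0)
      have h2 : w i j ^ (a + a) ≤ c ^ a * w i j ^ a :=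
        rpow_mul_self_le (hw.nonneg _ _) ((hw.mono hi hij hj).trans hwc) ha0.le ha0.le
      have h3 : sewingConst (a + a) * (L * N * 1) * w i j ^ (a + a) ≤ N / 2 * w i j ^ a :=
        calc sewingConst (a + a) * (L * N * 1) * w i j ^ (a + a)
            ≤ sewingConst (a + a) * (L * N * 1) * (c ^ a * w i j ^ a) := by gcongr
          _ = (sewingConst (a + a) * L * c ^ a) * (N * w i j ^ a) := by ring
          _ ≤ 1 / 2 * (N * w i j ^ a) := by gcongr
          _ = _ := by ring
      calc ‖x j - x i‖ = ‖(x j - x i - f (x i) (v j - v i)) + f (x i) (v j - v i)‖ := by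
            rw [sub_add_cancel]
        _ ≤ _ := norm_add_le _ _
        _ ≤ N / 2 * w i j ^ a + M * w i j ^ a := add_le_add (hy.trans h3) h1
        _ = _ := by ring
  have hS0 : 0 ≤ S := by positivity
  intro i j hij
  have hw0 := Real.rpow_nonneg (hw.nonneg i j) a
  by_cases hwc : w i j ≤ c
  · exact (hloc i j hwc i j le_rfl hij le_rfl).trans (by gcongr; exact le_max_left _ _)
  · obtain ⟨r, hr, hR⟩ := hw.block_induction hc0 (fun r i j => ‖x j - x i‖ ≤ r * S)
      (fun i j hij h => (hloc i j h i j le_rfl hij le_rfl).trans (by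
        have : w i j ^ a ≤ 1 := (Real.rpow_le_rpow (hw.nonneg _ _) h ha0.le).trans hca
        have h2 : 2 * M * w i j ^ a ≤ 2 * M * 1 := by gcongr
        have : 0 ≤ M * K ^ a := by positivity
        simp only [Nat.cast_one, one_mul, hS]; linarith))
      (fun m => by
        rw [hx m, add_sub_cancel_left]
        refine (ContinuousLinearMap.le_opNorm _ _).trans ?_
        have : ‖v (m + 1) - v m‖ ≤ K ^ a :=
          (hv _ _ (Nat.le_succ m)).trans (Real.rpow_le_rpow (hw.nonneg _ _) (hwK _ _) ha0.le)
        have h3 : ‖f (x m)‖ * ‖v (m + 1) - v m‖ ≤ M * K ^ a :=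
          mul_le_mul (hM _) this (norm_nonneg _) hM0
        simp only [Nat.cast_one, one_mul, hS]; linarith)
      (fun r s i m j h1 h2 => by
        have : x j - x i = (x j - x m) + (x m - x i) := by abel
        rw [this]
        refine (norm_add_le _ _).trans ?_
        push_cast; linarith) q i j hij ((hwK i j).trans hqK)
    have hr' : (r : ℝ) ≤ 2 * q + 1 := by exact_mod_cast hr
    calc ‖x j - x i‖ ≤ r * S := hR
      _ ≤ (2 * q + 1) * S := by gcongr
      _ = (2 * q + 1) * S / c ^ a * c ^ a := by field_simp
      _ ≤ max (2 * M) ((2 * q + 1) * S / c ^ a) * w i j ^ a := by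
        gcongr
        · exact le_max_right _ _
        · exact (not_le.1 hwc).le

/-- The regularity of a vector field used for uniqueness: a four-point estimate which follows from
boundedness and Hölder continuity (with exponent `κ`) of the derivative. -/
def FourPoint {U : Type*} [NormedAddCommGroup U] (L H κ : ℝ) (B : V → U) : Prop :=
  ∀ x y x' y', ‖(B x - B y) - (B x' - B y')‖ ≤
    L * ‖(x - y) - (x' - y')‖ + H * max ‖x - x'‖ ‖y - y'‖ ^ κ * ‖x - y‖

set_option maxHeartbeats 1000000 in
/-- Stability of discrete Young equations `dx = A(x) dT + B(x) dφ + dr`. The drift `A` only has to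
be Lipschitz since `T` has bounded variation. -/
theorem euler_stability (A : V → V) (B : V → W →L[ℝ] V) {L H κ a : ℝ} (hL0 : 0 ≤ L) (hH0 : 0 ≤ H)
    (hκ0 : 0 < κ) (hκ1 : κ ≤ 1) (hA : ∀ x y, ‖A x - A y‖ ≤ L * ‖x - y‖)
    (hB : ∀ x y, ‖B x - B y‖ ≤ L * ‖x - y‖) (hB4 : FourPoint L H κ B) (ha0 : 0 < a) (ha1 : a ≤ 1)
    (hθ : 1 < κ * a + a) (K : ℝ) (hK : 0 ≤ K) :
    ∃ C : ℝ, 0 ≤ C ∧ ∀ (w : ℕ → ℕ → ℝ) (T : ℕ → ℝ) (φ : ℕ → W) (x x' r : ℕ → V) (ε : ℝ),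
      0 ≤ ε → IsControl w → (∀ i j, w i j ≤ K) →
      (∀ i j, i ≤ j → |T j - T i| ≤ w i j) → (∀ i j, i ≤ j → ‖φ j - φ i‖ ≤ w i j ^ a) →
      (∀ i j, i ≤ j → ‖x j - x i‖ ≤ w i j ^ a) → (∀ i j, i ≤ j → ‖x' j - x' i‖ ≤ w i j ^ a) →
      (∀ i j, i ≤ j → ‖r j - r i‖ ≤ ε * w i j ^ a) →
      (∀ k, x (k + 1) - x' (k + 1) = x k - x' k + ((T (k + 1) - T k) • (A (x k) - A (x' k)) +
        (B (x k) - B (x' k)) (φ (k + 1) - φ k)) + (r (k + 1) - r k)) →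
      ∀ i j, i ≤ j → ‖x j - x' j‖ ≤ C * (‖x i - x' i‖ + ε) := by
  set Y := sewingConst (κ * a + a) with hYdef
  have hY : 0 ≤ Y := (sewingConst_pos hθ).le
  have hκa : 0 < κ * a := by positivity
  have hκa' : κ * a ≤ a := by nlinarith
  -- on blocks with `w ≤ c` the difference is controlled by at most half of its own bound
  obtain ⟨c, hc0, hc1, hc⟩ := exists_pos_mul_rpow_le (2 * L + Y * L + Y * H) hκa
  set s := c ^ (κ * a) with hs
  have hs0 : 0 ≤ s := Real.rpow_nonneg hc0.le _
  have hs1 : s ≤ 1 := Real.rpow_le_one hc0.le hc1 hκa.le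
  have hKa : 0 ≤ K ^ a := Real.rpow_nonneg hK a
  -- the growth factor over a block with `w ≤ c`, plus that over a single, possibly large, jump
  set Λ : ℝ := (3 + 2 * (2 * L + Y * H)) + (1 + L * K + L * K ^ a + K ^ a) with hΛ
  have hΛ1 : 1 ≤ Λ := by
    have : 0 ≤ 2 + 2 * (2 * L + Y * H) + (1 + L * K + L * K ^ a + K ^ a) := by positivity
    linarith
  obtain ⟨q, hq⟩ := exists_nat_ge (K / c)
  have hqK : K ≤ q * c := by rwa [div_le_iff₀ hc0] at hq
  refine ⟨Λ ^ (2 * q + 1), by positivity, ?_⟩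
  intro w T φ x x' r ε hε hw hwK hT hφ hx hx' hr hd
  have hsum : ∀ i j, i ≤ j → (x j - x' j) - (x i - x' i) =
      ∑ l ∈ Finset.Ico i j, (T (l + 1) - T l) • (A (x l) - A (x' l)) +
      ∑ l ∈ Finset.Ico i j, (B (x l) - B (x' l)) (φ (l + 1) - φ l) + (r j - r i) := by
    intro i j hij
    induction j, hij using Nat.le_induction with
    | base => simp
    | succ j hij ih =>
      rw [Finset.sum_Ico_succ_top hij, Finset.sum_Ico_succ_top hij, hd j]
      have : x j - x' j = (x i - x' i) +
        (∑ l ∈ Finset.Ico i j, (T (l + 1) - T l) • (A (x l) - A (x' l)) +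
          ∑ l ∈ Finset.Ico i j, (B (x l) - B (x' l)) (φ (l + 1) - φ l) + (r j - r i)) := by
        rw [← ih]; abel
      rw [this]; abel
  have hloc : ∀ i₀ j₀, i₀ ≤ j₀ → w i₀ j₀ ≤ c → ∀ i j, i₀ ≤ i → i ≤ j → j ≤ j₀ →
      ‖(x j - x' j) - (x i - x' i)‖ ≤
        2 * ((2 * L + Y * H) * ‖x i₀ - x' i₀‖ + ε) * w i j ^ a := by
    intro i₀ j₀ hij₀ hwc i j hi hij hj
    set d₀ := ‖x i₀ - x' i₀‖ with hd₀
    have hd₀0 : 0 ≤ d₀ := norm_nonneg _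
    let ι := {z : ℕ × ℕ // i₀ ≤ z.1 ∧ z.1 ≤ z.2 ∧ z.2 ≤ j₀}
    refine le_of_bootstrap (ι := ι) (fun z => ‖(x z.1.2 - x' z.1.2) - (x z.1.1 - x' z.1.1)‖)
      (fun z => w z.1.1 z.1.2 ^ a)
      (A := (2 * L + Y * H) * d₀ + ε) (N₀ := 2) (by positivity) (by positivity)
      (fun z => Real.rpow_nonneg (hw.nonneg _ _) _)
      ?_ ?_ ⟨(i, j), hi, hij, hj⟩
    · rintro ⟨⟨i, j⟩, hi, hij, hj⟩
      dsimp only at hi hij hj ⊢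
      have : (x j - x' j) - (x i - x' i) = (x j - x i) - (x' j - x' i) := by abel
      rw [this]
      have h1 := norm_sub_le (x j - x i) (x' j - x' i)
      have h2 := hx i j hij
      have h3 := hx' i j hij
      linarith
    · rintro N hN hbd ⟨⟨i, j⟩, hi, hij, hj⟩
      dsimp only at hi hij hj ⊢
      have hbd' : ∀ i j, i₀ ≤ i → i ≤ j → j ≤ j₀ →
          ‖(x j - x' j) - (x i - x' i)‖ ≤ N * w i j ^ a :=
        fun i j h1 h2 h3 => hbd ⟨(i, j), h1, h2, h3⟩
      have hwle : ∀ i j, i₀ ≤ i → i ≤ j → j ≤ j₀ → w i j ≤ c :=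
        fun i j h1 h2 h3 => (hw.mono h1 h2 h3).trans hwc
      set D := d₀ + N * s with hD
      have hD0 : 0 ≤ D := by positivity
      have hdD : ∀ l, i₀ ≤ l → l ≤ j₀ → ‖x l - x' l‖ ≤ D := by
        intro l h1 h2
        have h3 := hbd' i₀ l le_rfl h1 h2
        have h4 : w i₀ l ^ a ≤ s :=
          (Real.rpow_le_rpow (hw.nonneg _ _) (hwle i₀ l le_rfl h1 h2) ha0.le).trans
            (Real.rpow_le_rpow_of_exponent_ge hc0 hc1 hκa')
        calc ‖x l - x' l‖ = ‖((x l - x' l) - (x i₀ - x' i₀)) + (x i₀ - x' i₀)‖ := by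
              rw [sub_add_cancel]
          _ ≤ _ := norm_add_le _ _
          _ ≤ N * s + d₀ := add_le_add (h3.trans (by gcongr)) le_rfl
          _ = D := by rw [hD]; ring
      have hw0 := Real.rpow_nonneg (hw.nonneg i j) a
      have hwij1 : w i j ≤ w i j ^ a :=
        Real.self_le_rpow_of_le_one (hw.nonneg _ _) ((hwle i j hi hij hj).trans hc1) ha1
      -- `T` has bounded variation, so the drift sum is of order `w`, and `w ≤ w ^ a` as `w ≤ 1`
      have t1 : ‖∑ l ∈ Finset.Ico i j, (T (l + 1) - T l) • (A (x l) - A (x' l))‖ ≤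
          L * D * w i j ^ a := by
        have : ∀ l ∈ Finset.Ico i j, ‖(T (l + 1) - T l) • (A (x l) - A (x' l))‖ ≤
            w l (l + 1) * (L * D) := by
          intro l hl
          rw [Finset.mem_Ico] at hl
          rw [norm_smul, Real.norm_eq_abs]
          refine mul_le_mul (hT _ _ (Nat.le_succ l)) ((hA _ _).trans ?_) (norm_nonneg _)
            (hw.nonneg _ _)
          exact mul_le_mul_of_nonneg_left (hdD l (by omega) (by omega)) hL0
        refine (norm_sum_le_of_le _ this).trans ?_
        rw [← Finset.sum_mul, mul_comm]
        have := hw.sum_le hij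
        gcongr
        exact this.trans hwij1
      -- the four-point estimate gives `B (x ·) - B (x' ·)` increments of order `κ a`, which pair
      -- with the increments of `φ` of order `a` since `1 < κ a + a`
      have hy := discrete_young hw hκa.le ha0.le hθ (C := L * N + H * D) (D := 1) (by positivity)
        zero_le_one (fun l => B (x l) - B (x' l)) φ (a := i₀) (b := j₀)
        (fun i j h1 h2 h3 => by
          have hw1 : w i j ≤ 1 := (hwle i j h1 h2 h3).trans hc1
          have e1 : w i j ^ a ≤ w i j ^ (κ * a) := by
            rcases (hw.nonneg i j).eq_or_lt with h0 | h0
            · rw [← h0, Real.zero_rpow ha0.ne', Real.zero_rpow hκa.ne']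
            · exact Real.rpow_le_rpow_of_exponent_ge h0 hw1 hκa'
          have e2 : max ‖x j - x i‖ ‖x' j - x' i‖ ^ κ ≤ w i j ^ (κ * a) := by
            rw [mul_comm, Real.rpow_mul (hw.nonneg _ _)]
            exact Real.rpow_le_rpow (le_max_of_le_left (norm_nonneg _))
              (max_le (hx i j h2) (hx' i j h2)) hκ0.le
          have p0 := Real.rpow_nonneg (hw.nonneg i j) (κ * a)
          calc ‖(B (x j) - B (x' j)) - (B (x i) - B (x' i))‖
              ≤ L * ‖(x j - x' j) - (x i - x' i)‖ +
                H * max ‖x j - x i‖ ‖x' j - x' i‖ ^ κ * ‖x j - x' j‖ := hB4 _ _ _ _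
            _ ≤ L * (N * w i j ^ (κ * a)) + H * w i j ^ (κ * a) * D := by
              gcongr
              · exact (hbd' i j h1 h2 h3).trans (by gcongr)
              · exact hdD j (h1.trans h2) h3
            _ = (L * N + H * D) * w i j ^ (κ * a) := by ring)
        (fun i j _ h2 _ => by rw [one_mul]; exact hφ i j h2) hi hij hj
      have t2 : ‖(B (x i) - B (x' i)) (φ j - φ i)‖ ≤ L * D * w i j ^ a :=
        (ContinuousLinearMap.le_opNorm _ _).trans (mul_le_mul ((hB _ _).trans
          (mul_le_mul_of_nonneg_left (hdD i hi (by omega)) hL0)) (hφ i j hij) (norm_nonneg _)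
          (by positivity))
      have t3 : Y * ((L * N + H * D) * 1) * w i j ^ (κ * a + a) ≤
          Y * (L * N + H * D) * s * w i j ^ a := by
        have : w i j ^ (κ * a + a) ≤ s * w i j ^ a :=
          rpow_mul_self_le (hw.nonneg _ _) (hwle i j hi hij hj) hκa.le ha0.le
        calc _ ≤ Y * ((L * N + H * D) * 1) * (s * w i j ^ a) := by gcongr
          _ = _ := by ring
      have t4 := hr i j hij
      have hfin : L * D + (Y * (L * N + H * D) * s + L * D) + ε ≤
          N / 2 + ((2 * L + Y * H) * d₀ + ε) := by
        have e1 : Y * H * N * s * s ≤ Y * H * N * s := by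
          have : 0 ≤ Y * H * N * s := by positivity
          nlinarith
        have e2 : Y * H * d₀ * s ≤ Y * H * d₀ := by
          have : 0 ≤ Y * H * d₀ := by positivity
          nlinarith
        have e3 : N * ((2 * L + Y * L + Y * H) * s) ≤ N * (1 / 2) := by gcongr
        rw [hD]
        nlinarith
      rw [hsum i j hij]
      have hsplit : ‖∑ l ∈ Finset.Ico i j, (B (x l) - B (x' l)) (φ (l + 1) - φ l)‖ ≤
          (Y * (L * N + H * D) * s + L * D) * w i j ^ a := by
        have := norm_add_le (∑ l ∈ Finset.Ico i j, (B (x l) - B (x' l)) (φ (l + 1) - φ l) -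
          (B (x i) - B (x' i)) (φ j - φ i)) ((B (x i) - B (x' i)) (φ j - φ i))
        rw [sub_add_cancel] at this
        have h5 := hy.trans t3
        rw [add_mul]
        linarith
      calc _ ≤ _ := norm_add₃_le
        _ ≤ L * D * w i j ^ a + (Y * (L * N + H * D) * s + L * D) * w i j ^ a +
          ε * w i j ^ a := by gcongr
        _ = (L * D + (Y * (L * N + H * D) * s + L * D) + ε) * w i j ^ a := by ring
        _ ≤ _ := by gcongr
  intro i j hij
  obtain ⟨m, hm, hR⟩ := hw.block_induction hc0
    (fun m i j => ‖x j - x' j‖ + ε ≤ Λ ^ m * (‖x i - x' i‖ + ε))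
    (fun i j hij h => by
      have h1 := hloc i j hij h i j le_rfl hij le_rfl
      have h2 : w i j ^ a ≤ 1 := Real.rpow_le_one (hw.nonneg _ _) (h.trans hc1) ha0.le
      have h3 : ‖x j - x' j‖ ≤ ‖(x j - x' j) - (x i - x' i)‖ + ‖x i - x' i‖ := by
        have := norm_add_le ((x j - x' j) - (x i - x' i)) (x i - x' i)
        rwa [sub_add_cancel] at this
      set d := ‖x i - x' i‖
      have hd0 : 0 ≤ d := norm_nonneg _
      have h4 : 2 * ((2 * L + Y * H) * d + ε) * w i j ^ a ≤ 2 * ((2 * L + Y * H) * d + ε) :=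
        mul_le_of_le_one_right (by positivity) h2
      have h5 : 0 ≤ (2 * (2 * L + Y * H)) * ε := by positivity
      have h6 : 0 ≤ (1 + L * K + L * K ^ a + K ^ a) * (d + ε) := by positivity
      rw [pow_one, hΛ]
      nlinarith)
    (fun m => by
      have h1 : ‖(T (m + 1) - T m) • (A (x m) - A (x' m))‖ ≤ K * (L * ‖x m - x' m‖) := by
        rw [norm_smul, Real.norm_eq_abs]
        exact mul_le_mul ((hT _ _ (Nat.le_succ m)).trans (hwK _ _)) (hA _ _) (norm_nonneg _) hK
      have hwa : w m (m + 1) ^ a ≤ K ^ a := Real.rpow_le_rpow (hw.nonneg _ _) (hwK _ _) ha0.le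
      have h2 : ‖(B (x m) - B (x' m)) (φ (m + 1) - φ m)‖ ≤ L * ‖x m - x' m‖ * K ^ a :=
        (ContinuousLinearMap.le_opNorm _ _).trans (mul_le_mul (hB _ _)
          ((hφ _ _ (Nat.le_succ m)).trans hwa) (norm_nonneg _) (by positivity))
      have h3 : ‖r (m + 1) - r m‖ ≤ ε * K ^ a :=
        (hr _ _ (Nat.le_succ m)).trans (by gcongr)
      have h4 := norm_add₃_le (a := x m - x' m)
        (b := (T (m + 1) - T m) • (A (x m) - A (x' m)) + (B (x m) - B (x' m)) (φ (m + 1) - φ m))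
        (c := r (m + 1) - r m)
      have h5 := norm_add_le ((T (m + 1) - T m) • (A (x m) - A (x' m)))
        ((B (x m) - B (x' m)) (φ (m + 1) - φ m))
      rw [← hd m] at h4
      set d := ‖x m - x' m‖
      have hd0 : 0 ≤ d := norm_nonneg _
      have p1 : 0 ≤ (3 + 2 * (2 * L + Y * H)) * (d + ε) := by positivity
      have p2 : 0 ≤ (L * K + L * K ^ a) * ε := by positivity
      have p3 : 0 ≤ K ^ a * d := by positivity
      rw [pow_one, hΛ]
      nlinarith)
    (fun m n i l j h1 h2 => by
      calc _ ≤ _ := h2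
        _ ≤ Λ ^ n * (Λ ^ m * (‖x i - x' i‖ + ε)) := by gcongr
        _ = _ := by rw [pow_add]; ring) q i j hij ((hwK i j).trans hqK)
  calc ‖x j - x' j‖ ≤ ‖x j - x' j‖ + ε := by linarith
    _ ≤ _ := hR
    _ ≤ _ := by gcongr

end Discrete

/-! ### Variation sums and controls on a linear order -/

section Variation

variable {T V : Type*} [LinearOrder T]

/-- The supremum of the `r`-variation sums, that is, the `r`-th power of the `r`-variation. -/
noncomputable def varSum [PseudoEMetricSpace V] (r : ℝ) (h : T → V) : ℝ≥0∞ :=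
  ⨆ (k : ℕ) (t : ℕ → T) (_ : Monotone t),
    ∑ j ∈ Finset.range k, edist (h (t (j + 1))) (h (t j)) ^ r

lemma pVariation_eq_varSum [PseudoEMetricSpace V] {p : ℝ≥0∞} (hp : p ≠ ∞) (h : T → V) :
    pVariation p h = varSum p.toReal h ^ (1 / p.toReal) := by
  rw [pVariation, if_neg hp, varSum]

lemma sum_le_varSum [PseudoEMetricSpace V] (r : ℝ) (h : T → V) (k : ℕ) {t : ℕ → T}
    (ht : Monotone t) :
    ∑ j ∈ Finset.range k, edist (h (t (j + 1))) (h (t j)) ^ r ≤ varSum r h :=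
  le_iSup_of_le k (le_iSup₂_of_le t ht le_rfl)

lemma varSum_le [PseudoEMetricSpace V] {r : ℝ} {h : T → V} {c : ℝ≥0∞}
    (H : ∀ (k : ℕ) (t : ℕ → T), Monotone t →
      ∑ j ∈ Finset.range k, edist (h (t (j + 1))) (h (t j)) ^ r ≤ c) : varSum r h ≤ c :=
  iSup_le fun k => iSup₂_le fun t ht => H k t ht

lemma varSum_comp_le [PseudoEMetricSpace V] {S : Type*} [LinearOrder S] (r : ℝ) (h : T → V)
    {m : S → T} (hm : Monotone m) : varSum r (fun s => h (m s)) ≤ varSum r h :=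
  varSum_le fun k _ ht => sum_le_varSum r h k (hm.comp ht)

/-- The values of `∑ c (t_j) (t_{j+1})` along the chains from `s` to `t`. -/
inductive IsChainSum (c : T → T → ℝ≥0∞) (s : T) : T → ℝ≥0∞ → Prop
  | nil : IsChainSum c s s 0
  | snoc {t u : T} {a : ℝ≥0∞} : IsChainSum c s t a → t ≤ u → IsChainSum c s u (a + c t u)

lemma IsChainSum.append {c : T → T → ℝ≥0∞} {s t u : T} {a b : ℝ≥0∞} (h₁ : IsChainSum c s t a)
    (h₂ : IsChainSum c t u b) : IsChainSum c s u (a + b) := by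
  induction h₂ with
  | nil => simpa using h₁
  | snoc _ hle ih => rw [← add_assoc]; exact ih.snoc hle

lemma IsChainSum.exists_eq_sum {c : T → T → ℝ≥0∞} {s t : T} {a : ℝ≥0∞}
    (h : IsChainSum c s t a) :
    ∃ (k : ℕ) (u : ℕ → T), Monotone u ∧ (∀ j, k ≤ j → u j = t) ∧
      a = ∑ j ∈ Finset.range k, c (u j) (u (j + 1)) := by
  induction h with
  | nil => exact ⟨0, fun _ => s, monotone_const, fun _ _ => rfl, by simp⟩
  | @snoc t u a _ hle ih =>
    obtain ⟨k, v, hv, hvt, ha⟩ := ih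
    refine ⟨k + 1, fun j => if j ≤ k then v j else u, ?_, ?_, ?_⟩
    · intro i j hij
      dsimp only
      split_ifs with h1 h2 h2
      · exact hv hij
      · exact (hv h1).trans ((hvt k le_rfl).le.trans hle)
      · omega
      · exact le_rfl
    · intro j hj
      dsimp only
      rw [if_neg (by omega)]
    · rw [Finset.sum_range_succ, ha]
      dsimp only
      rw [if_pos le_rfl, if_neg (by omega), hvt k le_rfl]
      congr 1
      refine Finset.sum_congr rfl fun j hj => ?_
      rw [Finset.mem_range] at hj
      rw [if_pos (by omega), if_pos (by omega)]

/-- A function of finite `r`-variation is governed by a control. -/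
lemma exists_control [PseudoMetricSpace V] {r K : ℝ} (hK : 0 ≤ K) {h : T → V}
    (hv : varSum r h ≤ ENNReal.ofReal K) :
    ∃ w : T → T → ℝ, IsControl w ∧ (∀ s t, w s t ≤ K) ∧
      ∀ s t, s ≤ t → dist (h t) (h s) ^ r ≤ w s t := by
  set c : T → T → ℝ≥0∞ := fun s t => edist (h t) (h s) ^ r with hc
  set W : T → T → ℝ≥0∞ := fun s t => ⨆ (a : ℝ≥0∞) (_ : IsChainSum c s t a), a with hW
  have hle : ∀ s t, W s t ≤ ENNReal.ofReal K := by
    intro s t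
    refine iSup₂_le fun a ha => ?_
    obtain ⟨k, u, hu, -, rfl⟩ := ha.exists_eq_sum
    exact (sum_le_varSum r h k hu).trans hv
  have hfin : ∀ s t, W s t ≠ ∞ := fun s t => ((hle s t).trans_lt ENNReal.ofReal_lt_top).ne
  have hedge : ∀ s t, s ≤ t → c s t ≤ W s t := fun s t hst =>
    le_iSup₂_of_le (0 + c s t) (IsChainSum.nil.snoc hst) (by simp)
  have hadd : ∀ s t u, s ≤ t → t ≤ u → W s t + W t u ≤ W s u := fun s t u hst htu =>
    ENNReal.biSup_add_biSup_le' ⟨_, IsChainSum.nil.snoc hst⟩ ⟨_, IsChainSum.nil.snoc htu⟩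
      fun a ha b hb => le_iSup₂_of_le (a + b) (ha.append hb) le_rfl
  refine ⟨fun s t => (W s t).toReal, ⟨fun _ _ => ENNReal.toReal_nonneg, ?_⟩, ?_, ?_⟩
  · intro s t u hst htu
    rw [← ENNReal.toReal_add (hfin _ _) (hfin _ _)]
    exact ENNReal.toReal_mono (hfin _ _) (hadd s t u hst htu)
  · intro s t
    exact ENNReal.toReal_le_of_le_ofReal hK (hle s t)
  · intro s t hst
    have := ENNReal.toReal_mono (hfin _ _) (hedge s t hst)
    rwa [hc, ← ENNReal.toReal_rpow, edist_dist, ENNReal.toReal_ofReal dist_nonneg] at this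

/-- A function whose increments are bounded by a power of a control has finite variation. -/
lemma varSum_le_of_control [PseudoMetricSpace V] {r C K : ℝ} (hr : 0 < r) (hC : 0 ≤ C) {h : T → V}
    {w : T → T → ℝ} (hw : IsControl w) (hK : ∀ s t, w s t ≤ K)
    (hh : ∀ s t, s ≤ t → dist (h t) (h s) ≤ C * w s t ^ (1 / r)) :
    varSum r h ≤ ENNReal.ofReal (C ^ r * K) := by
  refine varSum_le fun k t ht => ?_
  have h1 : ∀ j ∈ Finset.range k, edist (h (t (j + 1))) (h (t j)) ^ r ≤
      ENNReal.ofReal (C ^ r * w (t j) (t (j + 1))) := by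
    intro j _
    rw [edist_dist, ENNReal.ofReal_rpow_of_nonneg dist_nonneg hr.le]
    refine ENNReal.ofReal_le_ofReal ?_
    have h2 := Real.rpow_le_rpow dist_nonneg (hh _ _ (ht (Nat.le_succ j))) hr.le
    rwa [Real.mul_rpow hC (Real.rpow_nonneg (hw.nonneg _ _) _), ← Real.rpow_mul (hw.nonneg _ _),
      one_div_mul_cancel hr.ne', Real.rpow_one] at h2
  refine (Finset.sum_le_sum h1).trans ?_
  have hCr := Real.rpow_nonneg hC r
  rw [← ENNReal.ofReal_sum_of_nonneg fun j _ => mul_nonneg hCr (hw.nonneg _ _), ← Finset.mul_sum]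
  refine ENNReal.ofReal_le_ofReal (mul_le_mul_of_nonneg_left ?_ hCr)
  rw [Finset.range_eq_Ico]
  exact ((hw.comp ht).sum_le (Nat.zero_le k)).trans (hK _ _)

/-- Lower semicontinuity of the variation under pointwise limits along a filter. -/
lemma varSum_le_of_tendsto [PseudoEMetricSpace V] {ι : Type*} {l : Filter ι} [l.NeBot] {r : ℝ}
    {h : ι → T → V} {h' : T → V} {c : ℝ≥0∞}
    (hc : ∀ᶠ n in l, varSum r (h n) ≤ c) (hh : ∀ s, Tendsto (fun n => h n s) l (𝓝 (h' s))) :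
    varSum r h' ≤ c := by
  refine varSum_le fun k t ht => ?_
  refine le_of_tendsto (tendsto_finsetSum _ fun j _ =>
    ((ENNReal.continuous_rpow_const.tendsto _).comp ((hh (t (j + 1))).edist (hh (t j))))) ?_
  filter_upwards [hc] with n hn
  exact (sum_le_varSum r (h n) k ht).trans hn

end Variation

/-! ### Càdlàg functions as functions with finitely many oscillation points -/

section Oscillation

/-- For every `ε > 0`, outside finitely many points `F` the oscillation of `h` is at most `ε`, in
the sense that `h s` and `h s'` are `ε`-close if no point of `F` lies in `(s, s']`. On a compact
interval this means that `h` is càdlàg, and it is a purely order-theoretic form of that notion. -/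
def FiniteOscillation {T V : Type*} [LinearOrder T] [PseudoMetricSpace V] (h : T → V) : Prop :=
  ∀ ε : ℝ, 0 < ε → ∃ F : Finset T, ∀ s s', s ≤ s' → (∀ g ∈ F, s < g → s' < g) →
    dist (h s) (h s') ≤ ε

lemma IsCadlag.finiteOscillation {V : Type*} [PseudoMetricSpace V] {b : ℝ}
    {h : Icc (0 : ℝ) b → V} (hh : IsCadlag h) : FiniteOscillation h := by
  intro ε hε
  have key : ∀ t, ∃ η > 0, ∀ s s', s ≤ s' → s ∈ Metric.ball t η → s' ∈ Metric.ball t η →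
      (s < t → s' < t) → dist (h s) (h s') ≤ ε := by
    intro t
    obtain ⟨h1, l, h2⟩ := hh t
    obtain ⟨η₁, hη₁, H1⟩ := Metric.continuousWithinAt_iff.1 h1 (ε / 2) (by positivity)
    obtain ⟨η₂, hη₂, H2⟩ := Metric.tendsto_nhdsWithin_nhds.1 h2 (ε / 2) (by positivity)
    refine ⟨min η₁ η₂, lt_min hη₁ hη₂, fun s s' hss' hs hs' hst => ?_⟩
    rw [Metric.mem_ball, lt_min_iff] at hs hs'
    by_cases hlt : s < t
    · have e1 := H2 hlt hs.2
      have e2 := H2 (hst hlt) hs'.2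
      have := dist_triangle_right (h s) (h s') l
      linarith
    · have e1 := H1 (not_lt.1 hlt) hs.1
      have e2 := H1 ((not_lt.1 hlt).trans hss') hs'.1
      have := dist_triangle_right (h s) (h s') (h t)
      linarith
  choose η hη H using key
  by_cases hb : 0 ≤ b
  swap
  · exact ⟨∅, fun s => absurd (s.2.1.trans s.2.2) hb⟩
  obtain ⟨F, -, hF⟩ := isCompact_univ.elim_nhds_subcover (fun t => Metric.ball t (η t))
    (fun t _ => Metric.ball_mem_nhds t (hη t))
  classical
  refine ⟨F ∪ F.image (fun t => projIcc 0 b hb (t + η t)), fun s s' hss' hg => ?_⟩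
  obtain ⟨t, htF, hst⟩ := mem_iUnion₂.1 (hF (mem_univ s))
  refine H t s s' hss' hst ?_ (fun hlt => hg t (Finset.mem_union_left _ htF) hlt)
  have h3 := hg (projIcc 0 b hb (t + η t))
    (Finset.mem_union_right _ (Finset.mem_image_of_mem _ htF))
  rw [Metric.mem_ball, Subtype.dist_eq, Real.dist_eq, abs_lt] at hst ⊢
  have hss'' : (s : ℝ) ≤ s' := hss'
  refine ⟨by linarith, ?_⟩
  have ht0 := t.2.1
  have hη' := hη t
  by_cases hle : (t : ℝ) + η t ≤ b
  · have e : projIcc 0 b hb (t + η t) = ⟨t + η t, by linarith, hle⟩ :=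
      projIcc_of_mem hb ⟨by linarith, hle⟩
    rw [e] at h3
    have : (s' : ℝ) < t + η t := Subtype.coe_lt_coe.2
      (h3 (Subtype.coe_lt_coe.1 (show (s : ℝ) < t + η t by linarith)))
    linarith
  · linarith [s'.2.2]

lemma FiniteOscillation.isCadlag {T V : Type*} [LinearOrder T] [TopologicalSpace T]
    [OrderTopology T] [PseudoMetricSpace V] [CompleteSpace V] {h : T → V}
    (hh : FiniteOscillation h) : IsCadlag h := by
  intro t
  constructor
  · rw [ContinuousWithinAt, Metric.tendsto_nhds]
    intro ε hε
    obtain ⟨F, hF⟩ := hh (ε / 2) (by positivity)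
    have : ∀ᶠ s in 𝓝[Ici t] t, ∀ g ∈ F, t < g → s < g := by
      refine (Filter.eventually_all_finset F).2 fun g _ => ?_
      by_cases hg : t < g
      · filter_upwards [nhdsWithin_le_nhds (eventually_lt_nhds hg)] with s hs _ using hs
      · exact Eventually.of_forall fun s h => absurd h hg
    filter_upwards [this, self_mem_nhdsWithin] with s hs hst
    have := hF t s hst hs
    rw [dist_comm]
    linarith
  · rcases (𝓝[<] t).eq_or_neBot with hb | hb
    · exact ⟨h t, by rw [hb]; exact tendsto_bot⟩
    · refine cauchy_map_iff_exists_tendsto.1 (Metric.cauchy_iff.2 ⟨inferInstance, ?_⟩)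
      intro ε hε
      obtain ⟨F, hF⟩ := hh (ε / 2) (by positivity)
      have hev : ∀ᶠ s in 𝓝[<] t, s < t ∧ ∀ g ∈ F, g < t → g < s := by
        refine (eventually_mem_nhdsWithin).and ((Filter.eventually_all_finset F).2 fun g _ => ?_)
        by_cases hg : g < t
        · filter_upwards [nhdsWithin_le_nhds (eventually_gt_nhds hg)] with s hs _ using hs
        · exact Eventually.of_forall fun s h => absurd h hg
      have main : ∀ s s', s ≤ s' → (∀ g ∈ F, g < t → g < s) → s' < t →
          dist (h s) (h s') ≤ ε / 2 := fun s s' hss' h1 h2 =>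
        hF s s' hss' fun g hg hsg => by
          by_contra hle
          exact lt_asymm hsg (h1 g hg ((not_lt.1 hle).trans_lt h2))
      refine ⟨h '' {s | s < t ∧ ∀ g ∈ F, g < t → g < s}, image_mem_map hev, ?_⟩
      rintro _ ⟨s, hs, rfl⟩ _ ⟨s', hs', rfl⟩
      rcases le_total s s' with hle | hle
      · linarith [main s s' hle hs.2 hs'.1]
      · rw [dist_comm]
        linarith [main s' s hle hs'.2 hs.1]

/-- Finite oscillation is preserved by monotone changes of time with a (partial) left adjoint. -/
lemma FiniteOscillation.comp {T S V : Type*} [LinearOrder T] [LinearOrder S] [PseudoMetricSpace V]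
    {h : T → V} (hh : FiniteOscillation h) {m : S → T} (hm : Monotone m)
    (hadj : ∀ g : T, ∃ u : S, ∀ s s', s ≤ s' → m s < g → g ≤ m s' → s < u ∧ u ≤ s') :
    FiniteOscillation (fun s => h (m s)) := by
  classical
  intro ε hε
  obtain ⟨F, hF⟩ := hh ε hε
  choose u hu using hadj
  refine ⟨F.image u, fun s s' hss' hg => hF _ _ (hm hss') fun g hgF hlt => ?_⟩
  by_contra hle
  obtain ⟨h1, h2⟩ := hu g s s' hss' hlt (not_lt.1 hle)
  exact absurd (hg (u g) (Finset.mem_image_of_mem _ hgF) h1) (not_lt.2 h2)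

lemma FiniteOscillation.comp_orderIso {T S V : Type*} [LinearOrder T] [LinearOrder S]
    [PseudoMetricSpace V] {h : T → V} (hh : FiniteOscillation h) (e : S ≃o T) :
    FiniteOscillation (fun s => h (e s)) :=
  hh.comp e.monotone fun g => ⟨e.symm g, fun s s' _ h1 h2 =>
    ⟨by rwa [e.lt_symm_apply], by rwa [e.symm_apply_le]⟩⟩

/-- A function whose increments are bounded by those of a function with finite oscillation. -/
lemma FiniteOscillation.of_lipschitz {T V W : Type*} [LinearOrder T] [PseudoMetricSpace V]
    [PseudoMetricSpace W] {h : T → V} (hh : FiniteOscillation h) {k : T → W} {L : ℝ} (hL : 0 ≤ L)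
    (hk : ∀ s s', dist (k s) (k s') ≤ L * dist (h s) (h s')) : FiniteOscillation k := by
  intro ε hε
  obtain ⟨F, hF⟩ := hh (ε / (L + 1)) (by positivity)
  refine ⟨F, fun s s' hss' hg => (hk s s').trans ?_⟩
  calc L * dist (h s) (h s') ≤ (L + 1) * (ε / (L + 1)) := by
        gcongr
        · linarith
        · exact hF s s' hss' hg
    _ = ε := by field_simp

/-- Uniform limits of functions with finite oscillation. -/
lemma FiniteOscillation.of_forall_close {T V : Type*} [LinearOrder T] [PseudoMetricSpace V]
    {h : T → V} (H : ∀ ε : ℝ, 0 < ε → ∃ h' : T → V, FiniteOscillation h' ∧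
      ∀ s, dist (h s) (h' s) ≤ ε) : FiniteOscillation h := by
  intro ε hε
  obtain ⟨h', h1, h2⟩ := H (ε / 3) (by positivity)
  obtain ⟨F, hF⟩ := h1 (ε / 3) (by positivity)
  refine ⟨F, fun s s' hss' hg => ?_⟩
  have e1 := h2 s
  have e2 := h2 s'
  have e3 := hF s s' hss' hg
  have := dist_triangle4_right (h s) (h s') (h' s) (h' s')
  linarith

end Oscillation

/-! ### Step functions -/

section Step

variable {T : Type*} [LinearOrder T]

/-- The largest point of `F ∪ {o}` not exceeding `s`. -/
noncomputable def floorPoint (o : T) (F : Finset T) (s : T) : T :=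
  (insert o (F.filter (· ≤ s))).max' (Finset.insert_nonempty _ _)

lemma floorPoint_le {o s : T} (hs : o ≤ s) (F : Finset T) : floorPoint o F s ≤ s := by
  refine Finset.max'_le _ _ _ fun g hg => ?_
  rcases Finset.mem_insert.1 hg with rfl | hg
  · exact hs
  · exact (Finset.mem_filter.1 hg).2

lemma le_floorPoint {o s g : T} {F : Finset T} (hg : g ∈ F) (hgs : g ≤ s) :
    g ≤ floorPoint o F s :=
  Finset.le_max' _ _ (Finset.mem_insert_of_mem (Finset.mem_filter.2 ⟨hg, hgs⟩))

lemma floorPoint_mono (o : T) (F : Finset T) : Monotone (floorPoint o F) := fun _ _ hst =>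
  Finset.max'_subset _ (Finset.insert_subset_insert _ fun _ hg =>
    Finset.mem_filter.2 ⟨(Finset.mem_filter.1 hg).1, (Finset.mem_filter.1 hg).2.trans hst⟩)

lemma floorPoint_congr (o : T) {F G : Finset T} {s s' : T}
    (h : ∀ g, g ∈ F ∧ g ≤ s ↔ g ∈ G ∧ g ≤ s') : floorPoint o F s = floorPoint o G s' := by
  have : F.filter (· ≤ s) = G.filter (· ≤ s') := by ext g; simpa using h g
  simp only [floorPoint, this]

lemma dist_floorPoint_le {V : Type*} [PseudoMetricSpace V] {h : T → V} {F : Finset T} {ε : ℝ}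
    (hF : ∀ s s', s ≤ s' → (∀ g ∈ F, s < g → s' < g) → dist (h s) (h s') ≤ ε) {o s : T}
    (hs : o ≤ s) : dist (h (floorPoint o F s)) (h s) ≤ ε :=
  hF _ _ (floorPoint_le hs F) fun g hg hlt => by
    by_contra hle
    exact not_lt.2 (le_floorPoint hg (not_lt.1 hle)) hlt

/-- Recursive construction of a step function with jumps at the points of `F` only: the increment
of `x` across a single point of `F` is a function `Φ` of the two neighbouring points of `F ∪ {o}`
and of the previous value of `x`. Both Euler schemes and integrals of step functions are of this
form. -/
lemma exists_stepFunction {W : Type*} [AddCommGroup W] {o : T} (ho : ∀ s, o ≤ s)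
    (Φ : T → T → W → W) (hΦ : ∀ s x, Φ s s x = 0) (ξ : W) (F : Finset T) :
    ∃ x : T → W, x o = ξ ∧ ∀ s s', s ≤ s' → (F.filter (fun g => s < g ∧ g ≤ s')).card ≤ 1 →
      x s' = x s + Φ (floorPoint o F s) (floorPoint o F s') (x s) := by
  induction F using Finset.induction_on_max with
  | empty =>
    refine ⟨fun _ => ξ, rfl, fun s s' _ _ => ?_⟩
    rw [floorPoint_congr o (F := ∅) (G := ∅) (s := s) (s' := s') (by simp), hΦ, add_zero]
  | insert a F ha ih =>
    obtain ⟨x, hxo, hx⟩ := ih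
    have e1 : ∀ s, s < a → floorPoint o (insert a F) s = floorPoint o F s := fun s hs =>
      floorPoint_congr o fun g => by
        constructor
        · rintro ⟨h1, h2⟩
          rcases Finset.mem_insert.1 h1 with rfl | h1
          · exact absurd h2 (not_le.2 hs)
          · exact ⟨h1, h2⟩
        · rintro ⟨h1, h2⟩
          exact ⟨Finset.mem_insert_of_mem h1, h2⟩
    have e2 : ∀ s, a ≤ s → floorPoint o (insert a F) s = a := fun s hs => by
      refine le_antisymm (Finset.max'_le _ _ _ fun g hg => ?_)
        (le_floorPoint (Finset.mem_insert_self _ _) hs)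
      rcases Finset.mem_insert.1 hg with rfl | hg
      · exact ho a
      · rcases Finset.mem_insert.1 (Finset.mem_filter.1 hg).1 with rfl | hg
        · exact le_rfl
        · exact (ha g hg).le
    refine ⟨fun s => if s < a then x s else x a + Φ (floorPoint o F a) a (x a), ?_, ?_⟩
    · dsimp only
      split_ifs with h1
      · exact hxo
      · obtain rfl : a = o := le_antisymm (not_lt.1 h1) (ho a)
        have : floorPoint a F a = a := le_antisymm (floorPoint_le le_rfl F)
          (Finset.le_max' _ _ (Finset.mem_insert_self _ _))
        rw [this, hΦ, add_zero, hxo]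
    · intro s s' hss' hcard
      dsimp only
      rcases lt_or_ge s' a with h1 | h1
      · rw [if_pos h1, if_pos (hss'.trans_lt h1), e1 s' h1, e1 s (hss'.trans_lt h1)]
        exact hx s s' hss' ((Finset.card_le_card (Finset.filter_subset_filter _
          (Finset.subset_insert a F))).trans hcard)
      rcases lt_or_ge s a with h2 | h2
      · rw [if_neg (not_lt.2 h1), if_pos h2, e2 s' h1, e1 s h2]
        have h3 : ∀ g ∈ F, ¬ (s < g ∧ g ≤ s') := by
          intro g hg h
          have := Finset.card_le_one.1 hcard g
            (Finset.mem_filter.2 ⟨Finset.mem_insert_of_mem hg, h⟩) a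
            (Finset.mem_filter.2 ⟨Finset.mem_insert_self _ _, h2, h1⟩)
          exact (ha g hg).ne this
        have h4 : floorPoint o F s = floorPoint o F a := floorPoint_congr o fun g =>
          ⟨fun h => ⟨h.1, (ha g h.1).le⟩, fun h => ⟨h.1, not_lt.1 fun hlt =>
            h3 g h.1 ⟨hlt, h.2.trans h1⟩⟩⟩
        have h5 : x a = x s := by
          have := hx s a h2.le (by
            rw [Finset.filter_eq_empty_iff.2 fun g hg h => h3 g hg ⟨h.1, h.2.trans h1⟩]
            simp)
          rwa [h4, hΦ, add_zero] at this
        rw [h4, h5]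
      · rw [if_neg (not_lt.2 h1), if_neg (not_lt.2 h2), e2 s' h1, e2 s h2, hΦ, add_zero]

variable {b : ℝ}

/-- Intervals shorter than the gaps of `F` contain at most one point of `F`. -/
lemma exists_gap (F : Finset (Icc (0 : ℝ) b)) :
    ∃ η : ℝ, 0 < η ∧ ∀ s s' : Icc (0 : ℝ) b, (s' : ℝ) - s < η →
      (F.filter (fun g => s < g ∧ g ≤ s')).card ≤ 1 := by
  have h : ∀ᶠ η : ℝ in 𝓝[>] 0, ∀ g ∈ F, ∀ g' ∈ F, g < g' → η ≤ (g' : ℝ) - g := by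
    refine (Filter.eventually_all_finset F).2 fun g _ =>
      (Filter.eventually_all_finset F).2 fun g' _ => ?_
    by_cases hg : g < g'
    · have : (0 : ℝ) < g' - g := sub_pos.2 hg
      filter_upwards [nhdsWithin_le_nhds (eventually_lt_nhds this)] with η hη _ using hη.le
    · exact Eventually.of_forall fun _ h => absurd h hg
  obtain ⟨η, hη, h0⟩ := (h.and self_mem_nhdsWithin).exists
  refine ⟨η, h0, fun s s' hlt => Finset.card_le_one.2 ?_⟩
  have main : ∀ g ∈ F, ∀ g' ∈ F, s < g → g' ≤ s' → ¬ g < g' := by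
    intro g hg g' hg' h1 h2 h3
    have h4 := hη g hg g' hg' h3
    have h1' : (s : ℝ) < g := h1
    have h2' : (g' : ℝ) ≤ s' := h2
    linarith
  intro g hg g' hg'
  rw [Finset.mem_filter] at hg hg'
  exact le_antisymm (not_lt.1 (main g' hg'.1 g hg.1 hg'.2.1 hg.2.2))
    (not_lt.1 (main g hg.1 g' hg'.1 hg.2.1 hg'.2.2))

lemma exists_fine_partition {η : ℝ} (hη : 0 < η) {s s' : Icc (0 : ℝ) b} (hss' : s ≤ s') :
    ∃ (t : ℕ → Icc (0 : ℝ) b) (n : ℕ), Monotone t ∧ t 0 = s ∧ t n = s' ∧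
      ∀ j, (t (j + 1) : ℝ) - t j < η := by
  have hss : (s : ℝ) ≤ s' := hss'
  obtain ⟨n, hn⟩ := exists_nat_ge ((s' - s : ℝ) / (η / 2))
  rw [div_le_iff₀ (by positivity)] at hn
  refine ⟨fun j => ⟨min (s + j * (η / 2)) s', le_min (by
    have := s.2.1; positivity) s'.2.1, (min_le_right _ _).trans s'.2.2⟩, n, ?_, ?_, ?_, ?_⟩
  · intro i j hij
    have : (i : ℝ) ≤ j := by exact_mod_cast hij
    exact Subtype.mk_le_mk.2 (min_le_min_right _ (by gcongr))
  · exact Subtype.ext (by simpa using hss)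
  · exact Subtype.ext (min_eq_right (by linarith))
  · intro j
    dsimp only
    push_cast
    rcases min_cases ((s : ℝ) + j * (η / 2)) s' with ⟨h1, h2⟩ | ⟨h1, h2⟩
    · have := min_le_left ((s : ℝ) + (j + 1) * (η / 2)) s'
      linarith
    · have := min_le_right ((s : ℝ) + (j + 1) * (η / 2)) s'
      linarith

end Step

/-! ### Young equations driven by càdlàg paths of finite variation -/

section Young

variable {E F V W : Type*} [NormedAddCommGroup E] [NormedSpace ℝ E] [NormedAddCommGroup F]
  [NormedSpace ℝ F] [NormedAddCommGroup V] [NormedSpace ℝ V] [NormedAddCommGroup W]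
  [NormedSpace ℝ W]

/-- Interpolation between a uniform bound and a variation bound. -/
lemma interpolation_le {a b ε z w C : ℝ} (ha : 0 < a) (hab : a < b) (hε : 0 < ε) (hz : 0 ≤ z)
    (hw : 0 ≤ w) (hC : 1 ≤ C) (h1 : z ≤ 2 * ε) (h2 : z ≤ C * w ^ b) :
    z ≤ 2 * C * ε ^ (1 - a / b) * w ^ a := by
  have hb : 0 < b := ha.trans hab
  have hθ0 : 0 < a / b := div_pos ha hb
  have hθ1 : a / b < 1 := (div_lt_one hb).2 hab
  have hwb := Real.rpow_nonneg hw b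
  calc z = z ^ (1 - a / b) * z ^ (a / b) := by
        rw [← Real.rpow_add_of_nonneg hz (by linarith) hθ0.le]; simp
    _ ≤ (2 * ε) ^ (1 - a / b) * (C * w ^ b) ^ (a / b) := by
        refine mul_le_mul (Real.rpow_le_rpow hz h1 (by linarith))
          (Real.rpow_le_rpow hz h2 hθ0.le) (Real.rpow_nonneg hz _) (by positivity)
    _ = 2 ^ (1 - a / b) * C ^ (a / b) * (ε ^ (1 - a / b) * w ^ a) := by
        rw [Real.mul_rpow two_pos.le hε.le, Real.mul_rpow (by linarith) hwb, ← Real.rpow_mul hw,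
          mul_div_cancel₀ _ hb.ne']
        ring
    _ ≤ 2 ^ (1 : ℝ) * C ^ (1 : ℝ) * (ε ^ (1 - a / b) * w ^ a) := by
        have h3 : 0 ≤ ε ^ (1 - a / b) * w ^ a := by positivity
        have h4 : (2 : ℝ) ^ (1 - a / b) ≤ 2 ^ (1 : ℝ) :=
          Real.rpow_le_rpow_of_exponent_le (by norm_num) (by linarith)
        have h5 : C ^ (a / b) ≤ C ^ (1 : ℝ) := Real.rpow_le_rpow_of_exponent_le hC hθ1.le
        gcongr
    _ = _ := by rw [Real.rpow_one, Real.rpow_one]; ring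

lemma norm_young_sum_le {w : ℕ → ℕ → ℝ} (hw : IsControl w)
    {α β C D M K : ℝ} (hα : 0 ≤ α) (hβ : 0 ≤ β) (hθ : 1 < α + β) (hC : 0 ≤ C) (hD : 0 ≤ D)
    (hM : 0 ≤ M) (y : ℕ → V →L[ℝ] W) (v : ℕ → V) (hK : ∀ i j, w i j ≤ K) (hyM : ∀ i, ‖y i‖ ≤ M)
    (hy : ∀ i j, i ≤ j → ‖y j - y i‖ ≤ C * w i j ^ α)
    (hv : ∀ i j, i ≤ j → ‖v j - v i‖ ≤ D * w i j ^ β) {i j : ℕ} (hij : i ≤ j) :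
    ‖∑ l ∈ Finset.Ico i j, y l (v (l + 1) - v l)‖ ≤
      (M * D + sewingConst (α + β) * (C * D) * K ^ α) * w i j ^ β := by
  have h1 := discrete_young hw hα hβ hθ hC hD y v (a := i) (b := j) (fun i j _ h _ => hy i j h)
    (fun i j _ h _ => hv i j h) le_rfl hij le_rfl
  have h2 : ‖y i (v j - v i)‖ ≤ M * (D * w i j ^ β) :=
    (ContinuousLinearMap.le_opNorm _ _).trans (mul_le_mul (hyM _) (hv i j hij) (norm_nonneg _) hM)
  have h3 := norm_add_le (∑ l ∈ Finset.Ico i j, y l (v (l + 1) - v l) - y i (v j - v i))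
    (y i (v j - v i))
  rw [sub_add_cancel] at h3
  have hS := (sewingConst_pos hθ).le
  have h4 : sewingConst (α + β) * (C * D) * w i j ^ (α + β) ≤
      sewingConst (α + β) * (C * D) * (K ^ α * w i j ^ β) := by
    gcongr
    exact rpow_mul_self_le (hw.nonneg _ _) (hK _ _) hα hβ
  linarith

section Control

variable {T : Type*} [LinearOrder T]

lemma exists_control_rpow {U : Type*} [PseudoMetricSpace U] {r K : ℝ} (hr : 0 < r) (hK : 0 ≤ K)
    {h : T → U}
    (hv : varSum r h ≤ ENNReal.ofReal K) :
    ∃ w : T → T → ℝ, IsControl w ∧ (∀ s t, w s t ≤ K) ∧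
      ∀ s t, s ≤ t → dist (h t) (h s) ≤ w s t ^ (1 / r) := by
  obtain ⟨w, h1, h2, h3⟩ := exists_control hK hv
  refine ⟨w, h1, h2, fun s t hst => ?_⟩
  have := Real.rpow_le_rpow (Real.rpow_nonneg dist_nonneg r) (h3 s t hst)
    (z := 1 / r) (by positivity)
  rwa [← Real.rpow_mul dist_nonneg, mul_one_div_cancel hr.ne', Real.rpow_one] at this

/-- Two functions of finite variation are governed by a common control. -/
lemma exists_common_control₂ {V W : Type*} [NormedAddCommGroup V] [NormedAddCommGroup W]
    {r K K' : ℝ} (hr : 0 < r) (hK : 0 ≤ K) (hK' : 0 ≤ K')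
    {h : T → V} {h' : T → W}
    (hv : varSum r h ≤ ENNReal.ofReal K) (hv' : varSum r h' ≤ ENNReal.ofReal K') :
    ∃ w : T → T → ℝ, IsControl w ∧ (∀ s t, w s t ≤ K + K') ∧
      (∀ s t, s ≤ t → ‖h t - h s‖ ≤ w s t ^ (1 / r)) ∧
      ∀ s t, s ≤ t → ‖h' t - h' s‖ ≤ w s t ^ (1 / r) := by
  obtain ⟨w, h1, h2, h3⟩ := exists_control_rpow hr hK hv
  obtain ⟨w', h1', h2', h3'⟩ := exists_control_rpow hr hK' hv'
  refine ⟨_, h1.add h1', fun s t => add_le_add (h2 s t) (h2' s t), fun s t hst => ?_,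
    fun s t hst => ?_⟩
  · rw [← dist_eq_norm]
    exact (h3 s t hst).trans (Real.rpow_le_rpow (h1.nonneg _ _)
      (le_add_of_nonneg_right (h1'.nonneg _ _)) (by positivity))
  · rw [← dist_eq_norm]
    exact (h3' s t hst).trans (Real.rpow_le_rpow (h1'.nonneg _ _)
      (le_add_of_nonneg_left (h1.nonneg _ _)) (by positivity))

/-- Four functions of finite variation are governed by a common control. -/
lemma exists_common_control₄ {V W V' W' : Type*} [NormedAddCommGroup V] [NormedAddCommGroup W]
    [NormedAddCommGroup V'] [NormedAddCommGroup W'] {r K : ℝ} (hr : 0 < r) (hK : 0 ≤ K)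
    {h : T → V} {h' : T → W} {g : T → V'} {g' : T → W'}
    (hv : varSum r h ≤ ENNReal.ofReal K) (hv' : varSum r h' ≤ ENNReal.ofReal K)
    (gv : varSum r g ≤ ENNReal.ofReal K) (gv' : varSum r g' ≤ ENNReal.ofReal K) :
    ∃ w : T → T → ℝ, IsControl w ∧ (∀ s t, w s t ≤ 4 * K) ∧
      (∀ s t, s ≤ t → ‖h t - h s‖ ≤ w s t ^ (1 / r)) ∧
      (∀ s t, s ≤ t → ‖h' t - h' s‖ ≤ w s t ^ (1 / r)) ∧
      (∀ s t, s ≤ t → ‖g t - g s‖ ≤ w s t ^ (1 / r)) ∧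
      ∀ s t, s ≤ t → ‖g' t - g' s‖ ≤ w s t ^ (1 / r) := by
  obtain ⟨w, h1, h2, h3, h4⟩ := exists_common_control₂ hr hK hK hv hv'
  obtain ⟨w', h1', h2', h3', h4'⟩ := exists_common_control₂ hr hK hK gv gv'
  have e1 : ∀ s t, w s t ^ (1 / r) ≤ (w s t + w' s t) ^ (1 / r) := fun s t =>
    Real.rpow_le_rpow (h1.nonneg _ _) (le_add_of_nonneg_right (h1'.nonneg _ _)) (by positivity)
  have e2 : ∀ s t, w' s t ^ (1 / r) ≤ (w s t + w' s t) ^ (1 / r) := fun s t =>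
    Real.rpow_le_rpow (h1'.nonneg _ _) (le_add_of_nonneg_left (h1.nonneg _ _)) (by positivity)
  exact ⟨_, h1.add h1', fun s t => by linarith [h2 s t, h2' s t],
    fun s t h => (h3 s t h).trans (e1 s t), fun s t h => (h4 s t h).trans (e1 s t),
    fun s t h => (h3' s t h).trans (e2 s t), fun s t h => (h4' s t h).trans (e2 s t)⟩

/-- The difference of two uniformly close functions of finite variation has small variation for
a larger exponent. -/
lemma norm_sub_increment_le {U : Type*} [NormedAddCommGroup U] {a b ε : ℝ} (ha : 0 < a)
    (hab : a < b) (hε : 0 < ε) {w : T → T → ℝ} (hw : IsControl w) {y y' : T → U}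
    (h1 : ∀ s, ‖y s - y' s‖ ≤ ε) (h2 : ∀ s t, s ≤ t → ‖y t - y s‖ ≤ w s t ^ b)
    (h3 : ∀ s t, s ≤ t → ‖y' t - y' s‖ ≤ w s t ^ b) (s t : T) (hst : s ≤ t) :
    ‖(y t - y' t) - (y s - y' s)‖ ≤ 4 * ε ^ (1 - a / b) * w s t ^ a := by
  have := interpolation_le ha hab hε (norm_nonneg ((y t - y' t) - (y s - y' s)))
    (hw.nonneg s t) one_le_two ((norm_sub_le _ _).trans (by linarith [h1 s, h1 t])) (by
      have e : (y t - y' t) - (y s - y' s) = (y t - y s) - (y' t - y' s) := by abel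
      rw [e]
      exact (norm_sub_le _ _).trans (by linarith [h2 s t hst, h3 s t hst]))
  calc _ ≤ _ := this
    _ = _ := by ring

/-- Left-point Riemann sums depend continuously on integrand and integrator with respect to the
uniform norm, uniformly over partitions and on sets of bounded variation. -/
theorem exists_riemannSum_sub_le {r a : ℝ} (hr : 1 ≤ r) (ha : 1 / 2 < a) (har : a < 1 / r)
    {K M : ℝ} (hK : 0 ≤ K) (hM : 0 ≤ M) :
    ∃ C : ℝ, 0 ≤ C ∧ ∀ (Y Y' : T → V →L[ℝ] W) (ω ω' : T → V) (ε : ℝ), 0 < ε → ε ≤ 1 →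
      varSum r Y ≤ ENNReal.ofReal K → varSum r Y' ≤ ENNReal.ofReal K →
      varSum r ω ≤ ENNReal.ofReal K → varSum r ω' ≤ ENNReal.ofReal K →
      (∀ s, ‖Y' s‖ ≤ M) → (∀ s, ‖Y s - Y' s‖ ≤ ε) → (∀ s, ‖ω s - ω' s‖ ≤ ε) →
      ∀ t : ℕ → T, Monotone t → ∀ k,
        ‖∑ j ∈ Finset.range k, Y (t j) (ω (t (j + 1)) - ω (t j)) -
          ∑ j ∈ Finset.range k, Y' (t j) (ω' (t (j + 1)) - ω' (t j))‖ ≤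
        C * ε ^ (1 - a / (1 / r)) := by
  set b := 1 / r with hb
  have ha0 : 0 < a := by linarith
  have hb0 : 0 < b := ha0.trans har
  have hθ1 : 1 < a + b := by linarith
  have hθ2 : 1 < b + a := by linarith
  have hS1 := (sewingConst_pos hθ1).le
  have hS2 := (sewingConst_pos hθ2).le
  have h4K : 0 ≤ 4 * K := by positivity
  refine ⟨(1 + sewingConst (a + b) * 4 * (4 * K) ^ a) * (4 * K) ^ b +
    (M * 4 + sewingConst (b + a) * (1 * 4) * (4 * K) ^ b) * (4 * K) ^ a, by positivity, ?_⟩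
  intro Y Y' ω ω' ε hε hε1 hY hY' hω hω' hM' hYε hωε t ht k
  obtain ⟨w, hw, hwK, w1, w2, w3, w4⟩ :=
    exists_common_control₄ (by linarith) hK hY hY' hω hω'
  set D := ε ^ (1 - a / b) with hD
  have hexp : 0 < 1 - a / b := by
    have := (div_lt_one hb0).2 har; linarith
  have hD0 : 0 ≤ D := Real.rpow_nonneg hε.le _
  have hεD : ε ≤ D := Real.self_le_rpow_of_le_one hε.le hε1 (by
    have : 0 < a / b := div_pos ha0 hb0
    linarith)
  have hwd := hw.comp ht
  have hwa : w (t 0) (t k) ^ a ≤ (4 * K) ^ a := Real.rpow_le_rpow (hw.nonneg _ _) (hwK _ _) ha0.le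
  have hwb : w (t 0) (t k) ^ b ≤ (4 * K) ^ b := Real.rpow_le_rpow (hw.nonneg _ _) (hwK _ _) hb0.le
  have s1 := norm_young_sum_le (M := D) (C := 4 * D) (D := 1) hwd ha0.le hb0.le hθ1
    (by positivity) zero_le_one hD0 (fun j => Y (t j) - Y' (t j)) (fun j => ω (t j))
    (fun i j => hwK _ _) (fun i => (hYε _).trans hεD)
    (fun i j hij => norm_sub_increment_le ha0 har hε hw hYε w1 w2 _ _ (ht hij))
    (fun i j hij => by rw [one_mul]; exact w3 _ _ (ht hij)) (Nat.zero_le k)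
  have s2 := norm_young_sum_le (M := M) (C := 1) (D := 4 * D) hwd hb0.le ha0.le hθ2
    zero_le_one (by positivity) hM (fun j => Y' (t j)) (fun j => ω (t j) - ω' (t j))
    (fun i j => hwK _ _) (fun i => hM' _)
    (fun i j hij => by rw [one_mul]; exact w2 _ _ (ht hij))
    (fun i j hij => norm_sub_increment_le ha0 har hε hw hωε w3 w4 _ _ (ht hij)) (Nat.zero_le k)
  have e : ∑ j ∈ Finset.range k, Y (t j) (ω (t (j + 1)) - ω (t j)) -
      ∑ j ∈ Finset.range k, Y' (t j) (ω' (t (j + 1)) - ω' (t j)) =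
      ∑ j ∈ Finset.Ico 0 k, (Y (t j) - Y' (t j)) (ω (t (j + 1)) - ω (t j)) +
      ∑ j ∈ Finset.Ico 0 k, Y' (t j) ((ω (t (j + 1)) - ω' (t (j + 1))) - (ω (t j) - ω' (t j))) := by
    rw [← Finset.range_eq_Ico, ← Finset.sum_sub_distrib, ← Finset.sum_add_distrib]
    refine Finset.sum_congr rfl fun j _ => ?_
    simp only [map_sub, _root_.sub_apply]; abel
  rw [e]
  calc _ ≤ _ := norm_add_le _ _
    _ ≤ (D * 1 + sewingConst (a + b) * (4 * D * 1) * (4 * K) ^ a) * (4 * K) ^ b +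
      (M * (4 * D) + sewingConst (b + a) * (1 * (4 * D)) * (4 * K) ^ b) * (4 * K) ^ a := by
      refine add_le_add (s1.trans ?_) (s2.trans ?_)
      · gcongr
      · gcongr
    _ = _ := by ring

end Control

/-! ### Vector fields -/

/-- The quantitative regularity of the pair `(A, B)` of vector fields that enters the estimates:
both fields are bounded and Lipschitz, and `B` satisfies the four-point estimate. -/
structure FieldBounds (A : F → F) (B : F → E →L[ℝ] F) (M L H κ : ℝ) : Prop where
  M_nonneg : 0 ≤ M
  L_nonneg : 0 ≤ L
  H_nonneg : 0 ≤ H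
  κ_pos : 0 < κ
  κ_le : κ ≤ 1
  norm_A : ∀ x, ‖A x‖ ≤ M
  norm_B : ∀ x, ‖B x‖ ≤ M
  lip_A : ∀ x y, ‖A x - A y‖ ≤ L * ‖x - y‖
  lip_B : ∀ x y, ‖B x - B y‖ ≤ L * ‖x - y‖
  fourPoint : FourPoint L H κ B

lemma combinedField_apply (A : F → F) (B : F → E →L[ℝ] F) (x : F) (z : ℝ × E) :
    combinedField A B x z = z.1 • A x + B x z.2 := by
  simp [combinedField]

lemma FieldBounds.norm_combinedField {A : F → F} {B : F → E →L[ℝ] F} {M L H κ : ℝ}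
    (h : FieldBounds A B M L H κ) (x : F) : ‖combinedField A B x‖ ≤ 2 * M := by
  have := h.M_nonneg
  refine ContinuousLinearMap.opNorm_le_bound _ (by positivity) fun z => ?_
  rw [combinedField_apply]
  have h1 : ‖z.1 • A x‖ ≤ ‖z‖ * M := by
    rw [norm_smul]
    exact mul_le_mul (norm_fst_le z) (h.norm_A x) (norm_nonneg _) (norm_nonneg _)
  have h2 : ‖B x z.2‖ ≤ M * ‖z‖ := (ContinuousLinearMap.le_opNorm _ _).trans
    (mul_le_mul (h.norm_B x) (norm_snd_le z) (norm_nonneg _) h.M_nonneg)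
  linarith [norm_add_le (z.1 • A x) (B x z.2)]

lemma FieldBounds.lip_combinedField {A : F → F} {B : F → E →L[ℝ] F} {M L H κ : ℝ}
    (h : FieldBounds A B M L H κ) (x y : F) :
    ‖combinedField A B x - combinedField A B y‖ ≤ 2 * L * ‖x - y‖ := by
  have := h.L_nonneg
  refine ContinuousLinearMap.opNorm_le_bound _ (by positivity) fun z => ?_
  rw [_root_.sub_apply, combinedField_apply, combinedField_apply, add_sub_add_comm,
    ← smul_sub, ← _root_.sub_apply]
  have h1 : ‖z.1 • (A x - A y)‖ ≤ ‖z‖ * (L * ‖x - y‖) := by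
    rw [norm_smul]
    exact mul_le_mul (norm_fst_le z) (h.lip_A x y) (norm_nonneg _) (norm_nonneg _)
  have h2 : ‖(B x - B y) z.2‖ ≤ L * ‖x - y‖ * ‖z‖ := (ContinuousLinearMap.le_opNorm _ _).trans
    (mul_le_mul (h.lip_B x y) (norm_snd_le z) (norm_nonneg _) (by positivity))
  linarith [norm_add_le (z.1 • (A x - A y)) ((B x - B y) z.2)]

lemma varSum_lipschitz_le {V W : Type*} [NormedAddCommGroup V] [NormedAddCommGroup W] {T : Type*}
    [LinearOrder T] {r K L : ℝ} (hr : 0 < r) (hK : 0 ≤ K)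
    (hL : 0 ≤ L) {X : T → V} (hX : varSum r X ≤ ENNReal.ofReal K) {f : V → W}
    (hf : ∀ x y, ‖f x - f y‖ ≤ L * ‖x - y‖) :
    varSum r (fun s => f (X s)) ≤ ENNReal.ofReal (L ^ r * K) := by
  obtain ⟨w, h1, h2, h3⟩ := exists_control_rpow hr hK hX
  refine varSum_le_of_control hr hL h1 h2 fun s t hst => ?_
  rw [dist_eq_norm]
  refine (hf _ _).trans (mul_le_mul_of_nonneg_left ?_ hL)
  rw [← dist_eq_norm]
  exact h3 s t hst

/-! ### Solutions in the uniform sense -/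

/-- `X` solves `dX = f(X) dω`, `X(0) = ξ`, in the sense that the errors of the left-point sums tend
to zero with the mesh, uniformly in the end point. -/
def IsUniformSolution {δ : ℝ≥0} (f : W → V →L[ℝ] W) (ξ : W) (ω : ExtInterval δ → V)
    (X : ExtInterval δ → W) : Prop :=
  X (ExtInterval.zero δ) = ξ ∧ ∀ ε : ℝ, 0 < ε → ∃ η : ℝ, 0 < η ∧
    ∀ t : ℕ → ExtInterval δ, Monotone t → t 0 = ExtInterval.zero δ →
      (∀ j, (t (j + 1) : ℝ) - t j < η) → ∀ k,
      ‖∑ j ∈ Finset.range k, f (X (t j)) (ω (t (j + 1)) - ω (t j)) - (X (t k) - ξ)‖ ≤ ε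

lemma ExtInterval.zero_le' {δ : ℝ≥0} (s : ExtInterval δ) : ExtInterval.zero δ ≤ s := s.2.1

lemma IsUniformSolution.hasYoungIntegral {δ : ℝ≥0} {f : W → V →L[ℝ] W} {ξ : W}
    {ω : ExtInterval δ → V} {X : ExtInterval δ → W} (h : IsUniformSolution f ξ ω X)
    (u : ExtInterval δ) : HasYoungIntegral (fun t => f (X t)) ω u (X u - ξ) := by
  intro ε hε
  obtain ⟨η, hη, H⟩ := h.2 (ε / 2) (by positivity)
  refine ⟨η, hη, fun k t ht h0 hk hmesh => ?_⟩
  have := H (fun j => t (min j k)) (fun i j hij => ht (min_le_min_right _ hij)) (by simp [h0])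
    (fun j => by
      rcases lt_or_ge j k with hj | hj
      · rw [min_eq_left hj.le, min_eq_left hj]; exact hmesh j hj
      · rw [min_eq_right hj, min_eq_right (by omega), sub_self]; exact hη) k
  rw [min_self, hk] at this
  have e : ∑ j ∈ Finset.range k, f (X (t (min j k))) (ω (t (min (j + 1) k)) - ω (t (min j k))) =
      ∑ j ∈ Finset.range k, f (X (t j)) (ω (t (j + 1)) - ω (t j)) :=
    Finset.sum_congr rfl fun j hj => by
      rw [Finset.mem_range] at hj
      rw [min_eq_left hj.le, min_eq_left (Nat.succ_le_of_lt hj)]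
  rw [e] at this
  exact this.trans_lt (half_lt_self hε)

/-- Step functions sampled along a partition finer than their gaps. -/
lemma stepFunction_sum {W : Type*} [AddCommGroup W] {b : ℝ} {o : Icc (0 : ℝ) b}
    {G : Finset (Icc (0 : ℝ) b)} {Φ : Icc (0 : ℝ) b → Icc (0 : ℝ) b → W → W} {x : Icc (0 : ℝ) b → W}
    (hx : ∀ s s', s ≤ s' → (G.filter (fun g => s < g ∧ g ≤ s')).card ≤ 1 →
      x s' = x s + Φ (floorPoint o G s) (floorPoint o G s') (x s))
    {η : ℝ} (hη : ∀ s s' : Icc (0 : ℝ) b, (s' : ℝ) - s < η →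
      (G.filter (fun g => s < g ∧ g ≤ s')).card ≤ 1) {t : ℕ → Icc (0 : ℝ) b} (ht : Monotone t)
    (hmesh : ∀ j, (t (j + 1) : ℝ) - t j < η) (k : ℕ) :
    ∑ j ∈ Finset.range k, Φ (floorPoint o G (t j)) (floorPoint o G (t (j + 1))) (x (t j)) =
      x (t k) - x (t 0) := by
  rw [← Finset.sum_range_sub (fun j => x (t j))]
  refine Finset.sum_congr rfl fun j _ => ?_
  rw [hx _ _ (ht (Nat.le_succ j)) (hη _ _ (hmesh j)), add_sub_cancel_left]

lemma exists_pos_le_one_mul_rpow_le (C : ℝ) {e ε : ℝ} (he : 0 < e) (hε : 0 < ε) :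
    ∃ c : ℝ, 0 < c ∧ c ≤ 1 ∧ C * c ^ e ≤ ε ∧ c ≤ ε := by
  obtain ⟨c, h0, h1, h2⟩ := exists_pos_mul_rpow_le (C / (2 * ε)) he
  have h3 : C * c ^ e ≤ ε := by
    have : C / (2 * ε) * c ^ e = C * c ^ e / (2 * ε) := by ring
    rw [this, div_le_iff₀ (by positivity)] at h2
    linarith
  refine ⟨min c ε, lt_min h0 hε, (min_le_left _ _).trans h1, ?_, min_le_right _ _⟩
  by_cases hC : 0 ≤ C
  · refine le_trans (mul_le_mul_of_nonneg_left (Real.rpow_le_rpow (by positivity)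
      (min_le_left _ _) he.le) hC) h3
  · have : 0 ≤ (min c ε) ^ e := Real.rpow_nonneg (by positivity) _
    nlinarith

lemma FiniteOscillation.exists_common {V W : Type*} [NormedAddCommGroup V]
    [NormedAddCommGroup W] {T : Type*} [LinearOrder T] {ω : T → V} {X : T → W}
    (hω : FiniteOscillation ω) (hX : FiniteOscillation X) {ε : ℝ} (hε : 0 < ε) (o : T)
    (ho : ∀ s, o ≤ s) :
    ∃ G : Finset T, (∀ s, ‖ω s - ω (floorPoint o G s)‖ ≤ ε) ∧
      ∀ s, ‖X s - X (floorPoint o G s)‖ ≤ ε := by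
  obtain ⟨G₁, h1⟩ := hω ε hε
  obtain ⟨G₂, h2⟩ := hX ε hε
  refine ⟨G₁ ∪ G₂, fun s => ?_, fun s => ?_⟩
  · rw [← dist_eq_norm, dist_comm]
    exact dist_floorPoint_le (fun s s' h h' => h1 s s' h fun g hg => h' g
      (Finset.mem_union_left _ hg)) (ho s)
  · rw [← dist_eq_norm, dist_comm]
    exact dist_floorPoint_le (fun s s' h h' => h2 s s' h fun g hg => h' g
      (Finset.mem_union_right _ hg)) (ho s)

/-- For càdlàg functions of finite `r`-variation, `r < 2`, convergence of the left-point sums at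
every end point is automatically uniform in the end point. -/
theorem isUniformSolution_of_hasYoungIntegral {δ : ℝ≥0} {f : W → V →L[ℝ] W} {M L : ℝ}
    (hM0 : 0 ≤ M) (hL0 : 0 ≤ L) (hM : ∀ x, ‖f x‖ ≤ M) (hL : ∀ x y, ‖f x - f y‖ ≤ L * ‖x - y‖)
    {r a : ℝ} (hr : 1 ≤ r) (ha : 1 / 2 < a) (har : a < 1 / r) {K : ℝ} (hK : 0 ≤ K)
    {ξ : W} {ω : ExtInterval δ → V} {X : ExtInterval δ → W} (hω : FiniteOscillation ω)
    (hX : FiniteOscillation X) (hωK : varSum r ω ≤ ENNReal.ofReal K)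
    (hXK : varSum r X ≤ ENNReal.ofReal K) (h0 : X (ExtInterval.zero δ) = ξ)
    (hY : ∀ u, HasYoungIntegral (fun t => f (X t)) ω u (X u - ξ)) :
    IsUniformSolution f ξ ω X := by
  refine ⟨h0, fun ε hε => ?_⟩
  have hr0 : 0 < r := by linarith
  set K' := K + L ^ r * K with hK'
  have hLK : 0 ≤ L ^ r * K := mul_nonneg (Real.rpow_nonneg hL0 _) hK
  have hK'0 : 0 ≤ K' := by positivity
  obtain ⟨C, hC, HC⟩ := exists_riemannSum_sub_le (T := ExtInterval δ) (V := V) (W := W) hr ha har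
    hK'0 hM0
  have he : 0 < 1 - a / (1 / r) := by
    have := (div_lt_one (show (0 : ℝ) < 1 / r by positivity)).2 har; linarith
  obtain ⟨c, hc0, hc1, hcε, -⟩ := exists_pos_le_one_mul_rpow_le C he
    (show 0 < ε / 4 by positivity)
  obtain ⟨G, hG1, hG2⟩ := hω.exists_common hX (show 0 < c / (L + 1) by positivity)
    (ExtInterval.zero δ) ExtInterval.zero_le'
  set o := ExtInterval.zero δ with ho
  have hcL : c / (L + 1) ≤ c := div_le_self hc0.le (by linarith)
  have hK1 : ENNReal.ofReal K ≤ ENNReal.ofReal K' := ENNReal.ofReal_le_ofReal (by linarith)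
  have hK2 : ENNReal.ofReal (L ^ r * K) ≤ ENNReal.ofReal K' :=
    ENNReal.ofReal_le_ofReal (by linarith)
  have hfX := (varSum_lipschitz_le hr0 hK hL0 hXK hL).trans hK2
  have hωK' := hωK.trans hK1
  obtain ⟨J, hJ0, hJ⟩ := exists_stepFunction (o := o) ExtInterval.zero_le'
    (fun s s' _ => f (X s) (ω s' - ω s)) (by simp) (0 : W) G
  obtain ⟨η, hη, hgap⟩ := exists_gap G
  have key : ∀ t : ℕ → ExtInterval δ, Monotone t → t 0 = o →
      (∀ j, (t (j + 1) : ℝ) - t j < η) → ∀ k,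
      ‖∑ j ∈ Finset.range k, f (X (t j)) (ω (t (j + 1)) - ω (t j)) - J (t k)‖ ≤ ε / 4 := by
    intro t ht ht0 hmesh k
    have h1 := HC (fun s => f (X s)) (fun s => f (X (floorPoint o G s))) ω
      (fun s => ω (floorPoint o G s)) c hc0 hc1 hfX
      ((varSum_comp_le r (fun s => f (X s)) (floorPoint_mono o G)).trans hfX) hωK'
      ((varSum_comp_le r ω (floorPoint_mono o G)).trans hωK') (fun s => hM _)
      (fun s => (hL _ _).trans (by
        calc L * ‖X s - X (floorPoint o G s)‖ ≤ (L + 1) * (c / (L + 1)) := by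
              gcongr
              · linarith
              · exact hG2 s
          _ = c := by field_simp))
      (fun s => (hG1 s).trans hcL) t ht k
    rw [stepFunction_sum (Φ := fun s s' _ => f (X s) (ω s' - ω s)) hJ hgap ht hmesh k,
      ht0, hJ0, sub_zero] at h1
    exact h1.trans hcε
  refine ⟨η, hη, fun t ht ht0 hmesh k => ?_⟩
  have h1 := key t ht ht0 hmesh k
  obtain ⟨η', hη', H⟩ := hY (t k) (ε / 4) (by positivity)
  obtain ⟨v, n, hv, hv0, hvn, hvmesh⟩ := exists_fine_partition (lt_min hη hη')
    (ExtInterval.zero_le' (t k))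
  have h2 := H n v hv hv0 hvn fun j _ => (hvmesh j).trans_le (min_le_right _ _)
  have h3 := key v hv hv0 (fun j => (hvmesh j).trans_le (min_le_left _ _)) n
  rw [hvn] at h3
  have e : ∑ j ∈ Finset.range k, f (X (t j)) (ω (t (j + 1)) - ω (t j)) - (X (t k) - ξ) =
      (∑ j ∈ Finset.range k, f (X (t j)) (ω (t (j + 1)) - ω (t j)) - J (t k)) -
      (∑ j ∈ Finset.range n, f (X (v j)) (ω (v (j + 1)) - ω (v j)) - J (t k)) +
      (∑ j ∈ Finset.range n, f (X (v j)) (ω (v (j + 1)) - ω (v j)) - (X (t k) - ξ)) := by abel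
  rw [e]
  have h4 := norm_sub_le (∑ j ∈ Finset.range k, f (X (t j)) (ω (t (j + 1)) - ω (t j)) - J (t k))
    (∑ j ∈ Finset.range n, f (X (v j)) (ω (v (j + 1)) - ω (v j)) - J (t k))
  refine (norm_add_le _ _).trans ?_
  have h2' := h2.le
  dsimp only at h2'
  linarith

/-- A priori bound for the variation of Euler schemes. -/
theorem exists_varSum_euler_le (f : W → V →L[ℝ] W) {M L : ℝ}
    (hM0 : 0 ≤ M) (hL0 : 0 ≤ L) (hM : ∀ x, ‖f x‖ ≤ M) (hL : ∀ x y, ‖f x - f y‖ ≤ L * ‖x - y‖)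
    {r : ℝ} (hr : 1 ≤ r) (hr2 : r < 2) {K : ℝ} (hK : 0 ≤ K) :
    ∃ K' : ℝ, 0 ≤ K' ∧ ∀ {b : ℝ} (o : Icc (0 : ℝ) b) (ω : Icc (0 : ℝ) b → V)
      (G : Finset (Icc (0 : ℝ) b)) (x : Icc (0 : ℝ) b → W), varSum r ω ≤ ENNReal.ofReal K →
      (∀ s s', s ≤ s' → (G.filter (fun g => s < g ∧ g ≤ s')).card ≤ 1 →
        x s' = x s + f (x s) (ω (floorPoint o G s') - ω (floorPoint o G s))) →
      varSum r x ≤ ENNReal.ofReal K' := by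
  have hr0 : 0 < r := by linarith
  obtain ⟨C, hC, H⟩ := euler_apriori f hM0 hL0 hM hL (a := 1 / r)
    (one_div_lt_one_div_of_lt hr0 hr2) K hK
  refine ⟨C ^ r * K, mul_nonneg (Real.rpow_nonneg hC _) hK, fun {b} o ω G x hω hx => ?_⟩
  obtain ⟨w, hw, hwK, hw'⟩ := exists_control_rpow hr0 hK
    ((varSum_comp_le r ω (floorPoint_mono o G)).trans hω)
  refine varSum_le_of_control hr0 hC hw hwK fun s s' hss' => ?_
  obtain ⟨η, hη, hgap⟩ := exists_gap G
  obtain ⟨t, n, ht, ht0, htn, hmesh⟩ := exists_fine_partition hη hss'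
  have := H (fun i j => w (t i) (t j)) (fun j => ω (floorPoint o G (t j))) (fun j => x (t j))
    (hw.comp ht) (fun i j => hwK _ _)
    (fun i j hij => by rw [← dist_eq_norm]; exact hw' _ _ (ht hij))
    (fun k => hx _ _ (ht (Nat.le_succ k)) (hgap _ _ (hmesh k))) 0 n (Nat.zero_le n)
  rw [ht0, htn] at this
  rwa [dist_eq_norm]

end Young

/-! ### Stability, existence and uniqueness of Young solutions -/

section Solutions

variable {E F V W : Type*} [NormedAddCommGroup E] [NormedSpace ℝ E] [NormedAddCommGroup F]
  [NormedSpace ℝ F] [NormedAddCommGroup V] [NormedSpace ℝ V] [NormedAddCommGroup W]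
  [NormedSpace ℝ W]

/-- The error path of a discrete approximate solution has small increments with respect to a larger
exponent: it is uniformly small and its variation is bounded. -/
lemma eulerError_increment_le {w : ℕ → ℕ → ℝ} (hw : IsControl w) {a b K M L ε : ℝ} (ha : 0 < a)
    (hab : a < b) (hb : 1 / 2 < b) (hM0 : 0 ≤ M) (hL0 : 0 ≤ L) (hK : 0 ≤ K) (hε : 0 < ε)
    (f : W → V →L[ℝ] W) (hM : ∀ x, ‖f x‖ ≤ M) (hL : ∀ x y, ‖f x - f y‖ ≤ L * ‖x - y‖)
    (hwK : ∀ i j, w i j ≤ K) (v : ℕ → V) (x : ℕ → W) (ξ : W)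
    (hv : ∀ i j, i ≤ j → ‖v j - v i‖ ≤ w i j ^ b) (hx : ∀ i j, i ≤ j → ‖x j - x i‖ ≤ w i j ^ b)
    (he : ∀ k, ‖∑ j ∈ Finset.range k, f (x j) (v (j + 1) - v j) - (x k - ξ)‖ ≤ ε)
    {i j : ℕ} (hij : i ≤ j) :
    ‖(∑ l ∈ Finset.range j, f (x l) (v (l + 1) - v l) - (x j - ξ)) -
      (∑ l ∈ Finset.range i, f (x l) (v (l + 1) - v l) - (x i - ξ))‖ ≤
      2 * (1 + (M + sewingConst (b + b) * L * K ^ b)) * ε ^ (1 - a / b) * w i j ^ a := by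
  have hb0 : 0 < b := by linarith
  have hθ : 1 < b + b := by linarith
  have hS := (sewingConst_pos hθ).le
  have hC : 0 ≤ M + sewingConst (b + b) * L * K ^ b := by positivity
  refine interpolation_le ha hab hε (norm_nonneg _) (hw.nonneg i j) (by linarith)
    ((norm_sub_le _ _).trans (by linarith [he i, he j])) ?_
  have h1 := norm_young_sum_le (C := L) (D := 1) hw hb0.le hb0.le hθ hL0 zero_le_one hM0
    (fun l => f (x l)) v hwK (fun l => hM _)
    (fun i j h => (hL _ _).trans (mul_le_mul_of_nonneg_left (hx i j h) hL0))
    (fun i j h => by rw [one_mul]; exact hv i j h) hij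
  have h2 := hx i j hij
  have e : (∑ l ∈ Finset.range j, f (x l) (v (l + 1) - v l) - (x j - ξ)) -
      (∑ l ∈ Finset.range i, f (x l) (v (l + 1) - v l) - (x i - ξ)) =
      ∑ l ∈ Finset.Ico i j, f (x l) (v (l + 1) - v l) - (x j - x i) := by
    rw [Finset.sum_Ico_eq_sub _ hij]; abel
  rw [e]
  refine (norm_sub_le _ _).trans ?_
  calc _ ≤ (M * 1 + sewingConst (b + b) * (L * 1) * K ^ b) * w i j ^ b + w i j ^ b :=
        add_le_add h1 h2
    _ = _ := by ring

/-- Solutions depend continuously on the driver with respect to the uniform norm, with a modulus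
that depends only on the variation of drivers and solutions. -/
theorem exists_solution_sub_le {A : F → F} {B : F → E →L[ℝ] F} {M L H κ : ℝ}
    (hAB : FieldBounds A B M L H κ) {r a : ℝ} (hr : 1 ≤ r) (ha : 1 < κ * a + a) (har : a < 1 / r)
    {K : ℝ} (hK : 1 ≤ K) (ξ : F) :
    ∃ C : ℝ, 0 ≤ C ∧ ∀ {δ : ℝ≥0} (ω ω' : ExtInterval δ → ℝ × E) (X X' : ExtInterval δ → F) (ε : ℝ),
      0 < ε → ε ≤ 1 → Monotone (fun s => (ω s).1) →
      varSum r ω ≤ ENNReal.ofReal K → varSum r ω' ≤ ENNReal.ofReal K →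
      varSum r X ≤ ENNReal.ofReal K → varSum r X' ≤ ENNReal.ofReal K →
      IsUniformSolution (combinedField A B) ξ ω X →
      IsUniformSolution (combinedField A B) ξ ω' X' →
      (∀ s, ‖ω s - ω' s‖ ≤ ε) → ∀ s, ‖X s - X' s‖ ≤ C * ε ^ (1 - a / (1 / r)) := by
  set b := 1 / r with hb
  set f := combinedField A B with hf
  have hr0 : 0 < r := by linarith
  have hb0 : 0 < b := by positivity
  have hb1 : b ≤ 1 := by rw [hb, div_le_one hr0]; exact hr
  have hκ0 := hAB.κ_pos
  have hκ1 := hAB.κ_le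
  have ha0 : 0 < a := by
    by_contra h
    nlinarith
  have ha2 : 1 / 2 < a := by nlinarith
  have hb2 : 1 / 2 < b := ha2.trans har
  have hM0 := hAB.M_nonneg
  have hL0 := hAB.L_nonneg
  have hK0 : 0 ≤ K := by linarith
  -- chosen such that `w ^ b ≤ (K₁ * w) ^ a` whenever `w ≤ 4 * K`
  set K₁ : ℝ := ((4 * K) ^ (b - a)) ^ (1 / a) with hK₁
  have h4K : 1 ≤ 4 * K := by linarith
  have h4K0 : 0 ≤ 4 * K := by linarith
  have hK₁1 : 1 ≤ K₁ :=
    Real.one_le_rpow (Real.one_le_rpow h4K (by linarith)) (by positivity)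
  have hK₁a : K₁ ^ a = (4 * K) ^ (b - a) := by
    rw [hK₁, ← Real.rpow_mul (by positivity), one_div_mul_cancel ha0.ne', Real.rpow_one]
  obtain ⟨C, hC, HC⟩ := euler_stability A B hL0 hAB.H_nonneg hκ0 hκ1 hAB.lip_A hAB.lip_B
    hAB.fourPoint ha0 (har.le.trans hb1) ha (K₁ * (4 * K) + (4 * K) ^ b) (by positivity)
  have hθ : 1 < b + a := by linarith
  have hS := (sewingConst_pos hθ).le
  have hS' := (sewingConst_pos (show 1 < b + b by linarith)).le
  set C₁ : ℝ := 2 * (1 + (2 * M + sewingConst (b + b) * (2 * L) * (4 * K) ^ b)) with hC₁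
  set C₂ : ℝ := 2 * M * 4 + sewingConst (b + a) * (2 * L * 4) * (4 * K) ^ b with hC₂
  refine ⟨C * (C₂ + (C₁ + C₁)), by positivity, ?_⟩
  intro δ ω ω' X X' ε hε hε1 hmono hω hω' hX hX' hsol hsol' hωε s
  obtain ⟨w, hw, hwK, w1, w2, w3, w4⟩ := exists_common_control₄ hr0 hK0 hω hω' hX hX'
  set D := ε ^ (1 - a / b) with hD
  have hD0 : 0 ≤ D := Real.rpow_nonneg hε.le _
  obtain ⟨η, hη, Hη⟩ := hsol.2 ε hε
  obtain ⟨η', hη', Hη'⟩ := hsol'.2 ε hε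
  obtain ⟨t, n, ht, ht0, htn, hmesh⟩ := exists_fine_partition (lt_min hη hη')
    (ExtInterval.zero_le' s)
  have e1 := Hη t ht ht0 fun j => (hmesh j).trans_le (min_le_left _ _)
  have e2 := Hη' t ht ht0 fun j => (hmesh j).trans_le (min_le_right _ _)
  set wd : ℕ → ℕ → ℝ := fun i j => w (t i) (t j) with hwd
  have hwdc : IsControl wd := hw.comp ht
  have hwdK : ∀ i j, wd i j ≤ 4 * K := fun i j => hwK _ _
  -- the time component is monotone, so its increments form a control themselves
  set wT : ℕ → ℕ → ℝ := fun i j => |(ω (t j)).1 - (ω (t i)).1| with hwT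
  have hwTle : ∀ i j, i ≤ j → wT i j ≤ (4 * K) ^ b := fun i j hij =>
    (norm_fst_le (ω (t j) - ω (t i))).trans ((w1 _ _ (ht hij)).trans
      (Real.rpow_le_rpow (hw.nonneg _ _) (hwK _ _) hb0.le))
  have hwTc : IsControl wT := by
    refine ⟨fun _ _ => abs_nonneg _, fun i j k hij hjk => ?_⟩
    have m1 : (ω (t i)).1 ≤ (ω (t j)).1 := hmono (ht hij)
    have m2 : (ω (t j)).1 ≤ (ω (t k)).1 := hmono (ht hjk)
    simp only [hwT]
    rw [abs_of_nonneg (by linarith), abs_of_nonneg (by linarith), abs_of_nonneg (by linarith)]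
    linarith
  set ws : ℕ → ℕ → ℝ := fun i j => K₁ * wd i j + wT i j with hws
  have hwsc : IsControl ws := (hwdc.const_mul (by linarith)).add hwTc
  have hwsa : ∀ i j, wd i j ^ a ≤ ws i j ^ a := fun i j =>
    Real.rpow_le_rpow (hwdc.nonneg _ _) (by
      have := hwdc.nonneg i j
      have := hwTc.nonneg i j
      simp only [hws]
      nlinarith) ha0.le
  have hwsb : ∀ i j, wd i j ^ b ≤ ws i j ^ a := fun i j => by
    have h0 := hwdc.nonneg i j
    calc wd i j ^ b = wd i j ^ ((b - a) + a) := by rw [sub_add_cancel]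
      _ ≤ (4 * K) ^ (b - a) * wd i j ^ a :=
        rpow_mul_self_le h0 (hwdK _ _) (by linarith) ha0.le
      _ = (K₁ * wd i j) ^ a := by rw [Real.mul_rpow (by linarith) h0, hK₁a]
      _ ≤ ws i j ^ a := Real.rpow_le_rpow (by positivity)
        (le_add_of_nonneg_right (hwTc.nonneg i j)) ha0.le
  -- `X - X'` solves the difference equation driven by `ω` up to the Euler errors `e`, `e'` of the
  -- two solutions and the effect `g` of the difference of the drivers
  set e : ℕ → F := fun k =>
    ∑ j ∈ Finset.range k, f (X (t j)) (ω (t (j + 1)) - ω (t j)) - (X (t k) - ξ) with he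
  set e' : ℕ → F := fun k =>
    ∑ j ∈ Finset.range k, f (X' (t j)) (ω' (t (j + 1)) - ω' (t j)) - (X' (t k) - ξ) with he'
  set g : ℕ → F := fun k => ∑ j ∈ Finset.range k,
    f (X' (t j)) ((ω (t (j + 1)) - ω' (t (j + 1))) - (ω (t j) - ω' (t j))) with hg
  have he_le : ∀ i j, i ≤ j → ‖e j - e i‖ ≤ C₁ * D * wd i j ^ a := fun i j hij =>
    eulerError_increment_le hwdc ha0 har hb2 (by positivity) (by positivity) h4K0 hε f
      hAB.norm_combinedField hAB.lip_combinedField hwdK (fun j => ω (t j)) (fun j => X (t j)) ξ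
      (fun i j h => w1 _ _ (ht h)) (fun i j h => w3 _ _ (ht h)) e1 hij
  have he'_le : ∀ i j, i ≤ j → ‖e' j - e' i‖ ≤ C₁ * D * wd i j ^ a := fun i j hij =>
    eulerError_increment_le hwdc ha0 har hb2 (by positivity) (by positivity) h4K0 hε f
      hAB.norm_combinedField hAB.lip_combinedField hwdK (fun j => ω' (t j)) (fun j => X' (t j)) ξ
      (fun i j h => w2 _ _ (ht h)) (fun i j h => w4 _ _ (ht h)) e2 hij
  have hg_le : ∀ i j, i ≤ j → ‖g j - g i‖ ≤ C₂ * D * wd i j ^ a := fun i j hij => by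
    have := norm_young_sum_le (M := 2 * M) (C := 2 * L) (D := 4 * D) hwdc hb0.le ha0.le hθ
      (by positivity) (by positivity) (by positivity) (fun j => f (X' (t j)))
      (fun j => ω (t j) - ω' (t j)) hwdK (fun i => hAB.norm_combinedField _)
      (fun i j h => (hAB.lip_combinedField _ _).trans (mul_le_mul_of_nonneg_left
        (w4 _ _ (ht h)) (by positivity)))
      (fun i j h => norm_sub_increment_le ha0 har hε hw hωε w1 w2 _ _ (ht h)) hij
    simp only [hg]
    rw [← Finset.sum_Ico_eq_sub _ hij]
    calc _ ≤ _ := this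
      _ = _ := by rw [hC₂]; ring
  have main := HC ws (fun j => (ω (t j)).1) (fun j => (ω (t j)).2) (fun j => X (t j))
    (fun j => X' (t j)) (fun k => g k - (e k - e' k)) ((C₂ + (C₁ + C₁)) * D) (by positivity) hwsc
    (fun i j => by
      have h1 : K₁ * wd i j ≤ K₁ * (4 * K) :=
        mul_le_mul_of_nonneg_left (hwdK i j) (by linarith)
      have h2 : wT i j ≤ (4 * K) ^ b := by
        rcases le_total i j with h | h
        · exact hwTle i j h
        · have := hwTle j i h
          simp only [hwT] at this ⊢
          rwa [abs_sub_comm]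
      exact add_le_add h1 h2)
    (fun i j hij => le_add_of_nonneg_left (by have := hwdc.nonneg i j; positivity))
    (fun i j hij => (norm_snd_le (ω (t j) - ω (t i))).trans ((w1 _ _ (ht hij)).trans (hwsb i j)))
    (fun i j hij => (w3 _ _ (ht hij)).trans (hwsb i j))
    (fun i j hij => (w4 _ _ (ht hij)).trans (hwsb i j))
    (fun i j hij => by
      have h : g j - (e j - e' j) - (g i - (e i - e' i)) =
        (g j - g i) - ((e j - e i) - (e' j - e' i)) := by abel
      rw [h]
      have h1 := norm_sub_le (g j - g i) ((e j - e i) - (e' j - e' i))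
      have h2 := norm_sub_le (e j - e i) (e' j - e' i)
      have h3 := he_le i j hij
      have h4 := he'_le i j hij
      have h5 := hg_le i j hij
      have h6 : (C₂ + (C₁ + C₁)) * D * wd i j ^ a ≤ (C₂ + (C₁ + C₁)) * D * ws i j ^ a := by
        exact mul_le_mul_of_nonneg_left (hwsa i j) (by positivity)
      nlinarith)
    (fun k => by
      have hA : (( ω (t (k + 1))).1 - (ω (t k)).1) • (A (X (t k)) - A (X' (t k))) +
          (B (X (t k)) - B (X' (t k))) ((ω (t (k + 1))).2 - (ω (t k)).2) =
          f (X (t k)) (ω (t (k + 1)) - ω (t k)) - f (X' (t k)) (ω (t (k + 1)) - ω (t k)) := by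
        simp only [hf, combinedField_apply, Prod.fst_sub, Prod.snd_sub, smul_sub,
          _root_.sub_apply]
        abel
      rw [hA]
      simp only [hg, he, he', Finset.sum_range_succ, map_sub]
      abel) 0 n (Nat.zero_le n)
  rw [ht0, htn, hsol.1, hsol'.1, sub_self, norm_zero, zero_add] at main
  calc _ ≤ _ := main
    _ = _ := by ring

lemma isUniformSolution_of_step {δ : ℝ≥0} {f : W → V →L[ℝ] W} {ξ : W} {ω : ExtInterval δ → V}
    {G : Finset (ExtInterval δ)} {x : ExtInterval δ → W} (h0 : x (ExtInterval.zero δ) = ξ)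
    (hx : ∀ s s', s ≤ s' → (G.filter (fun g => s < g ∧ g ≤ s')).card ≤ 1 →
      x s' = x s + f (x s) (ω (floorPoint (ExtInterval.zero δ) G s') -
        ω (floorPoint (ExtInterval.zero δ) G s))) :
    IsUniformSolution f ξ (fun s => ω (floorPoint (ExtInterval.zero δ) G s)) x := by
  refine ⟨h0, fun ε hε => ?_⟩
  obtain ⟨η, hη, hgap⟩ := exists_gap G
  refine ⟨η, hη, fun t ht ht0 hmesh k => ?_⟩
  rw [stepFunction_sum (Φ := fun s s' z => f z (ω s' - ω s)) hx hgap ht hmesh k, ht0, h0,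
    sub_self, norm_zero]
  exact hε.le

lemma finiteOscillation_of_step {δ : ℝ≥0} {f : W → V →L[ℝ] W} {ω : ExtInterval δ → V}
    {o : ExtInterval δ} {G : Finset (ExtInterval δ)} {x : ExtInterval δ → W}
    (hx : ∀ s s', s ≤ s' → (G.filter (fun g => s < g ∧ g ≤ s')).card ≤ 1 →
      x s' = x s + f (x s) (ω (floorPoint o G s') - ω (floorPoint o G s))) :
    FiniteOscillation x := by
  intro ε hε
  refine ⟨G, fun s s' hss' hg => ?_⟩
  have h1 := hx s s' hss' (by
    rw [Finset.filter_eq_empty_iff.2 fun g hgG h => not_lt.2 h.2 (hg g hgG h.1)]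
    simp)
  have h2 : floorPoint o G s' = floorPoint o G s := floorPoint_congr o fun g =>
    ⟨fun h => ⟨h.1, not_lt.1 fun hlt => not_lt.2 h.2 (hg g h.1 hlt)⟩,
      fun h => ⟨h.1, h.2.trans hss'⟩⟩
  rw [h2, sub_self, map_zero, add_zero] at h1
  rw [h1, dist_self]
  exact hε.le

/-- Existence of solutions, as uniform limits of Euler schemes along partitions adapted to the
oscillations of the driver, together with a bound for their variation. -/
theorem exists_uniformSolution [CompleteSpace F] {A : F → F} {B : F → E →L[ℝ] F} {M L H κ : ℝ}
    (hAB : FieldBounds A B M L H κ) {r : ℝ} (hr : 1 ≤ r) (hrκ : r < 1 + κ) {K : ℝ} (hK : 1 ≤ K)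
    (ξ : F) :
    ∃ K' : ℝ, 1 ≤ K' ∧ ∀ {δ : ℝ≥0} (ω : ExtInterval δ → ℝ × E),
      Monotone (fun s => (ω s).1) → FiniteOscillation ω → varSum r ω ≤ ENNReal.ofReal K →
      ∃ X : ExtInterval δ → F, IsUniformSolution (combinedField A B) ξ ω X ∧
        FiniteOscillation X ∧ varSum r X ≤ ENNReal.ofReal K' := by
  set f := combinedField A B with hf
  have hr0 : 0 < r := by linarith
  have hκ0 := hAB.κ_pos
  have hκ1 := hAB.κ_le
  have hM0 := hAB.M_nonneg
  have hL0 := hAB.L_nonneg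
  have hK0 : 0 ≤ K := by linarith
  obtain ⟨a, ha1, har⟩ := exists_between (one_div_lt_one_div_of_lt hr0 hrκ)
  have ha : 1 < κ * a + a := by
    rw [div_lt_iff₀ (by linarith)] at ha1
    linarith
  have ha0 : 0 < a := lt_trans (by positivity) ha1
  have ha2 : 1 / 2 < a := by nlinarith
  have hexp : 0 < 1 - a / (1 / r) := by
    have := (div_lt_one (show (0 : ℝ) < 1 / r by positivity)).2 har; linarith
  obtain ⟨K₀, hK₀, HK₀⟩ := exists_varSum_euler_le f (by positivity) (by positivity)
    hAB.norm_combinedField hAB.lip_combinedField hr (by linarith) hK0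
  set K₁ := max K (max K₀ 1) with hK₁
  have hK₁1 : 1 ≤ K₁ := (le_max_right _ _).trans (le_max_right _ _)
  have hKK₁ : ENNReal.ofReal K ≤ ENNReal.ofReal K₁ := ENNReal.ofReal_le_ofReal (le_max_left _ _)
  have hKK₀ : ENNReal.ofReal K₀ ≤ ENNReal.ofReal K₁ :=
    ENNReal.ofReal_le_ofReal ((le_max_left _ _).trans (le_max_right _ _))
  obtain ⟨C, hC, HC⟩ := exists_solution_sub_le hAB hr ha har hK₁1 ξ
  refine ⟨K₁, hK₁1, fun {δ} ω hmono hosc hω => ?_⟩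
  set o := ExtInterval.zero δ with ho
  set ε : ℕ → ℝ := fun n => 1 / ((n : ℝ) + 1) with hε
  have hε0 : ∀ n, 0 < ε n := fun n => by positivity
  have hε1 : ∀ n, ε n ≤ 1 := fun n => by
    simp only [hε]
    rw [div_le_one (by positivity)]
    linarith [(Nat.cast_nonneg n : (0 : ℝ) ≤ n)]
  have hεanti : ∀ n m, n ≤ m → ε m ≤ ε n := fun n m h =>
    one_div_le_one_div_of_le (by positivity) (by exact_mod_cast Nat.succ_le_succ h)
  have hεlim : Tendsto ε atTop (𝓝 0) := tendsto_one_div_add_atTop_nhds_zero_nat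
  have hstep : ∀ n : ℕ, ∃ (G : Finset (ExtInterval δ)) (x : ExtInterval δ → F),
      (∀ s, ‖ω s - ω (floorPoint o G s)‖ ≤ ε n / 2) ∧ x o = ξ ∧
      ∀ s s', s ≤ s' → (G.filter (fun g => s < g ∧ g ≤ s')).card ≤ 1 →
        x s' = x s + f (x s) (ω (floorPoint o G s') - ω (floorPoint o G s)) := fun n => by
    obtain ⟨G, hG⟩ := hosc (ε n / 2) (by have := hε0 n; positivity)
    obtain ⟨x, h1, h2⟩ := exists_stepFunction (o := o) ExtInterval.zero_le'
      (fun s s' z => f z (ω s' - ω s)) (by simp) ξ G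
    refine ⟨G, x, fun s => ?_, h1, h2⟩
    rw [← dist_eq_norm, dist_comm]
    exact dist_floorPoint_le hG (ExtInterval.zero_le' s)
  choose G x hG hx0 hx using hstep
  set ω' : ℕ → ExtInterval δ → ℝ × E := fun n s => ω (floorPoint o (G n) s) with hω'
  have hω'K : ∀ n, varSum r (ω' n) ≤ ENNReal.ofReal K := fun n =>
    (varSum_comp_le r ω (floorPoint_mono o (G n))).trans hω
  have hxK : ∀ n, varSum r (x n) ≤ ENNReal.ofReal K₀ := fun n => HK₀ o ω (G n) (x n) hω (hx n)
  have hxsol : ∀ n, IsUniformSolution f ξ (ω' n) (x n) := fun n =>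
    isUniformSolution_of_step (hx0 n) (hx n)
  have hcau : ∀ s n m, n ≤ m → dist (x n s) (x m s) ≤ C * ε n ^ (1 - a / (1 / r)) := by
    intro s n m hnm
    rw [dist_eq_norm]
    refine HC (ω' n) (ω' m) (x n) (x m) (ε n) (hε0 n) (hε1 n)
      (hmono.comp (floorPoint_mono o (G n))) ((hω'K n).trans hKK₁) ((hω'K m).trans hKK₁)
      ((hxK n).trans hKK₀) ((hxK m).trans hKK₀) (hxsol n) (hxsol m) (fun s => ?_) s
    have h1 := hG n s
    have h2 := hG m s
    have h3 := hεanti n m hnm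
    have h4 : ω' n s - ω' m s = (ω s - ω' m s) - (ω s - ω' n s) := by abel
    rw [h4]
    refine (norm_sub_le _ _).trans ?_
    simp only [hω']
    linarith
  have hlim0 : Tendsto (fun n => C * ε n ^ (1 - a / (1 / r))) atTop (𝓝 0) := by
    have := (hεlim.rpow_const (p := 1 - a / (1 / r)) (Or.inr hexp.le)).const_mul C
    rwa [Real.zero_rpow hexp.ne', mul_zero] at this
  have hX : ∀ s, ∃ y, Tendsto (fun n => x n s) atTop (𝓝 y) := fun s =>
    cauchySeq_tendsto_of_complete (cauchySeq_of_le_tendsto_0' _ (hcau s) hlim0)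
  choose X hX using hX
  have hXle : ∀ n s, dist (x n s) (X s) ≤ C * ε n ^ (1 - a / (1 / r)) := fun n s =>
    le_of_tendsto (tendsto_const_nhds.dist (hX s)) (by
      filter_upwards [eventually_ge_atTop n] with m hm using hcau s n m hm)
  have hXK : varSum r X ≤ ENNReal.ofReal K₁ :=
    (varSum_le_of_tendsto (Eventually.of_forall hxK) hX).trans hKK₀
  have hX0 : X o = ξ := tendsto_nhds_unique (hX o) (by simp [hx0])
  refine ⟨X, ⟨hX0, fun e he => ?_⟩, ?_, hXK⟩
  · have hKL : 0 ≤ K₁ + (2 * L) ^ r * K₁ := by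
      have := Real.rpow_nonneg (show 0 ≤ 2 * L by positivity) r
      nlinarith
    obtain ⟨C', hC', HC'⟩ := exists_riemannSum_sub_le (T := ExtInterval δ) (V := ℝ × E) (W := F) hr
      ha2 har hKL (show 0 ≤ 2 * M by positivity)
    obtain ⟨c, hc0, hc1, hce, -⟩ := exists_pos_le_one_mul_rpow_le C' hexp
      (show 0 < e / 2 by positivity)
    obtain ⟨n, hn1, hn2⟩ := ((hεlim.eventually (gt_mem_nhds hc0)).and
      (hlim0.eventually (gt_mem_nhds (show 0 < min (c / (2 * L + 1)) (e / 2) by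
        positivity)))).exists
    obtain ⟨η, hη, hgap⟩ := exists_gap (G n)
    have hLr : 0 ≤ (2 * L) ^ r * K₁ :=
      mul_nonneg (Real.rpow_nonneg (by positivity) r) (by linarith)
    have k1 : ENNReal.ofReal K₁ ≤ ENNReal.ofReal (K₁ + (2 * L) ^ r * K₁) :=
      ENNReal.ofReal_le_ofReal (by linarith)
    have k2 : ENNReal.ofReal ((2 * L) ^ r * K₁) ≤ ENNReal.ofReal (K₁ + (2 * L) ^ r * K₁) :=
      ENNReal.ofReal_le_ofReal (by linarith)
    refine ⟨η, hη, fun t ht ht0 hmesh k => ?_⟩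
    have h1 := HC' (fun s => f (X s)) (fun s => f (x n s)) ω (ω' n) c hc0 hc1
      ((varSum_lipschitz_le hr0 (by linarith) (by positivity) hXK
        hAB.lip_combinedField).trans k2)
      ((varSum_lipschitz_le hr0 (by linarith) (by positivity) ((hxK n).trans hKK₀)
        hAB.lip_combinedField).trans k2)
      ((hω.trans hKK₁).trans k1) (((hω'K n).trans hKK₁).trans k1)
      (fun s => hAB.norm_combinedField _)
      (fun s => (hAB.lip_combinedField _ _).trans (by
        have h5 := (hXle n s).trans (hn2.le.trans (min_le_left _ _))
        rw [dist_comm, dist_eq_norm] at h5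
        calc 2 * L * ‖X s - x n s‖ ≤ (2 * L + 1) * (c / (2 * L + 1)) := by
              gcongr
              linarith
          _ = c := by field_simp))
      (fun s => (hG n s).trans (by have := hε0 n; linarith)) t ht k
    have h2 := stepFunction_sum (Φ := fun s s' z => f z (ω s' - ω s)) (hx n) hgap ht hmesh k
    simp only [hω'] at h1
    rw [h2, ht0, hx0] at h1
    have h3 := (hXle n (t k)).trans (hn2.le.trans (min_le_right _ _))
    rw [dist_eq_norm] at h3
    have e1 : ∑ j ∈ Finset.range k, f (X (t j)) (ω (t (j + 1)) - ω (t j)) - (X (t k) - ξ) =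
        (∑ j ∈ Finset.range k, f (X (t j)) (ω (t (j + 1)) - ω (t j)) - (x n (t k) - ξ)) +
        (x n (t k) - X (t k)) := by abel
    rw [e1]
    refine (norm_add_le _ _).trans ?_
    linarith
  · refine FiniteOscillation.of_forall_close fun e he => ?_
    obtain ⟨n, hn⟩ := (hlim0.eventually (gt_mem_nhds he)).exists
    exact ⟨x n, finiteOscillation_of_step (hx n), fun s => by
      rw [dist_comm]; exact (hXle n s).trans hn.le⟩

end Solutions

/-! ### The geometry of the `δ`-extension -/

section TimeChange

variable {Pi : Set I} (hPi : Pi.Countable)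

lemma weight_pos (s : Pi) : 0 < weight hPi s := by unfold weight; positivity

lemma summable_weight : Summable (weight hPi) := by
  let _ := hPi.toEncodable
  have := (summable_geometric_two_encode (ι := Pi)).mul_right (1 / 2)
  refine this.congr fun s => ?_
  rw [weight, pow_succ]

lemma gapLength_eq (δ : ℝ≥0) (s : Pi) : gapLength hPi δ s = δ * gapLength hPi 1 s := by
  simp [gapLength]; ring

lemma summable_gapLength : Summable (gapLength hPi 1) := by
  refine ((summable_weight hPi).div_const (∑' s : Pi, weight hPi s)).congr fun s => ?_
  rw [gapLength, NNReal.coe_one, one_mul]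

lemma tsum_weight_pos (hne : Pi ≠ ∅) : 0 < ∑' s : Pi, weight hPi s := by
  obtain ⟨s, hs⟩ := nonempty_iff_ne_empty.2 hne
  exact (summable_weight hPi).tsum_pos (fun s => (weight_pos hPi s).le) ⟨s, hs⟩ (weight_pos hPi _)

lemma gapLength_pos (s : Pi) : 0 < gapLength hPi 1 s := by
  have h := tsum_weight_pos hPi (nonempty_iff_ne_empty.1 ⟨s.1, s.2⟩)
  have := weight_pos hPi s
  simp only [gapLength, NNReal.coe_one, one_mul]
  positivity

lemma tsum_gapLength (hne : Pi ≠ ∅) : ∑' s : Pi, gapLength hPi 1 s = 1 := by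
  have h := tsum_weight_pos hPi hne
  simp only [gapLength, NNReal.coe_one, one_mul]
  rw [tsum_div_const, div_self h.ne']

open Classical in
/-- The total relative length of the gaps at times `s` satisfying a condition. -/
noncomputable def gapMass (P : I → Prop) : ℝ := ∑' s : Pi, if P s then gapLength hPi 1 s else 0

open Classical in
lemma summable_gapMass (P : I → Prop) :
    Summable (fun s : Pi => if P s then gapLength hPi 1 s else 0) :=
  (summable_gapLength hPi).of_nonneg_of_le
    (fun s => by split_ifs; exacts [(gapLength_pos hPi s).le, le_rfl])
    (fun s => by split_ifs; exacts [le_rfl, (gapLength_pos hPi s).le])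

lemma gapMass_mono {P Q : I → Prop} (h : ∀ s, P s → Q s) : gapMass hPi P ≤ gapMass hPi Q := by
  classical
  refine (summable_gapMass hPi P).tsum_le_tsum (fun s => ?_) (summable_gapMass hPi Q)
  by_cases hP : P s
  · rw [if_pos hP, if_pos (h s hP)]
  · rw [if_neg hP]
    split_ifs
    exacts [(gapLength_pos hPi s).le, le_rfl]

lemma gapMass_false : gapMass hPi (fun _ => False) = 0 := by simp [gapMass]

lemma gapMass_true (hne : Pi ≠ ∅) : gapMass hPi (fun _ => True) = 1 := by
  simpa [gapMass] using tsum_gapLength hPi hne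

lemma gapMass_le_eq (t : Pi) :
    gapMass hPi (· ≤ (t : I)) = gapMass hPi (· < (t : I)) + gapLength hPi 1 t := by
  classical
  rw [gapMass, (summable_gapMass hPi (· ≤ (t : I))).tsum_eq_add_tsum_ite t, if_pos le_rfl,
    add_comm, gapMass]
  congr 1
  refine tsum_congr fun s => ?_
  rcases eq_or_ne s t with rfl | h
  · simp
  · have h' : (s : I) ≤ t ↔ (s : I) < t :=
      ⟨fun hle => lt_of_le_of_ne hle fun e => h (Subtype.ext e), le_of_lt⟩
    rw [if_neg h]
    simp only [h']

open Classical in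
/-- The total length of the gaps at times `≤ t`, for `δ = 1`. For empty `Π`, the interval
`[1, 1 + δ]` that is appended to `[0, 1]` is regarded as a gap at time `1`. -/
noncomputable def gapSum (t : I) : ℝ :=
  if Pi = ∅ then (if t = 1 then 1 else 0) else gapMass hPi (· ≤ t)

open Classical in
/-- The total length of the gaps at times `< t`, for `δ = 1`. -/
noncomputable def gapSumLeft (t : I) : ℝ := if Pi = ∅ then 0 else gapMass hPi (· < t)

lemma gapSumLeft_nonneg (t : I) : 0 ≤ gapSumLeft hPi t := by
  unfold gapSumLeft
  split_ifs
  · exact le_rfl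
  · rw [← gapMass_false hPi]; exact gapMass_mono hPi (by simp)

lemma gapSumLeft_le (t : I) : gapSumLeft hPi t ≤ gapSum hPi t := by
  unfold gapSumLeft gapSum
  split_ifs
  · exact zero_le_one
  · exact le_rfl
  · exact gapMass_mono hPi fun s hs => hs.le

lemma gapSum_le_left {s t : I} (hst : s < t) : gapSum hPi s ≤ gapSumLeft hPi t := by
  unfold gapSumLeft gapSum
  split_ifs with h1 h2
  · exact absurd (h2 ▸ hst) (not_lt.2 unitInterval.le_one')
  · exact le_rfl
  · exact gapMass_mono hPi fun r hr => hr.trans_lt hst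

lemma gapSum_one : gapSum hPi 1 = 1 := by
  by_cases h : Pi = ∅
  · rw [gapSum, if_pos h, if_pos rfl]
  · rw [gapSum, if_neg h, ← gapMass_true hPi h]
    congr 1
    ext s
    simpa using unitInterval.le_one'

lemma gapSum_le_one (t : I) : gapSum hPi t ≤ 1 := by
  rcases (unitInterval.le_one' (t := t)).eq_or_lt with rfl | h
  · exact (gapSum_one hPi).le
  · exact (gapSum_le_left hPi h).trans ((gapSumLeft_le hPi 1).trans (gapSum_one hPi).le)

lemma gapSumLeft_lt {t : I} (ht : t ∈ Pi) : gapSumLeft hPi t < gapSum hPi t := by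
  have hne : Pi ≠ ∅ := nonempty_iff_ne_empty.1 ⟨t, ht⟩
  rw [gapSumLeft, gapSum, if_neg hne, if_neg hne, gapMass_le_eq hPi ⟨t, ht⟩]
  linarith [gapLength_pos hPi ⟨t, ht⟩]

lemma timeChange_eq (hne : Pi ≠ ∅) (δ : ℝ≥0) (t : I) :
    timeChange hPi δ t = t + δ * gapSum hPi t := by
  classical
  rw [timeChange, gapSum, if_neg hne, gapMass, ← tsum_mul_left]
  congr 1
  refine tsum_congr fun s => ?_
  rw [mul_ite, mul_zero, ← gapLength_eq]

lemma timeChangeLeft_eq (hne : Pi ≠ ∅) (δ : ℝ≥0) (t : I) :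
    timeChangeLeft hPi δ t = t + δ * gapSumLeft hPi t := by
  classical
  rw [timeChangeLeft, gapSumLeft, if_neg hne, gapMass, ← tsum_mul_left]
  congr 1
  refine tsum_congr fun s => ?_
  rw [mul_ite, mul_zero, ← gapLength_eq]

lemma tendsto_gapMass {l : Filter ℝ} {P : I → Prop}
    (h : ∀ s : I, ∀ᶠ x in l, ((s : ℝ) ≤ x ↔ P s)) :
    Tendsto (fun x : ℝ => gapMass hPi (fun s => (s : ℝ) ≤ x)) l (𝓝 (gapMass hPi P)) := by
  classical
  refine tendsto_tsum_of_dominated_convergence (summable_gapLength hPi) (fun s => ?_)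
    (Eventually.of_forall fun x s => ?_)
  · refine tendsto_const_nhds.congr' ?_
    filter_upwards [h s] with x hx
    simp [hx]
  · have := (gapLength_pos hPi s).le
    split_ifs
    · rw [Real.norm_of_nonneg this]
    · simpa using this

/-- `timeChangeInv` finds the time `t` whose gap, ends included, contains `u`. -/
lemma timeChangeInv_spec (hne : Pi ≠ ∅) (δ : ℝ≥0) {u : ℝ} (hu0 : 0 ≤ u) (hu1 : u ≤ 1 + δ) :
    (timeChangeInv hPi δ u : ℝ) + δ * gapSumLeft hPi (timeChangeInv hPi δ u) ≤ u ∧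
      u ≤ timeChangeInv hPi δ u + δ * gapSum hPi (timeChangeInv hPi δ u) := by
  set S : Set ℝ := {x : ℝ | ∃ s : I, (s : ℝ) = x ∧ u ≤ timeChange hPi δ s} with hS
  have h1S : (1 : ℝ) ∈ S := ⟨1, rfl, by rw [timeChange_eq hPi hne, gapSum_one]; simpa using hu1⟩
  have hbdd : BddBelow S := ⟨0, by rintro _ ⟨s, rfl, -⟩; exact s.2.1⟩
  have hmem : sInf S ∈ Icc (0 : ℝ) 1 :=
    ⟨le_csInf ⟨1, h1S⟩ (by rintro _ ⟨s, rfl, -⟩; exact s.2.1), csInf_le hbdd h1S⟩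
  have ht : timeChangeInv hPi δ u = ⟨sInf S, hmem⟩ := projIcc_of_mem zero_le_one hmem
  rw [ht]
  set t : I := ⟨sInf S, hmem⟩ with htdef
  have htc : (t : ℝ) = sInf S := rfl
  have hmassle : ∀ s : I, gapSum hPi s = gapMass hPi (fun r => (r : ℝ) ≤ (s : ℝ)) := fun s => by
    rw [gapSum, if_neg hne]; rfl
  constructor
  · rw [gapSumLeft, if_neg hne]
    have hlim := tendsto_gapMass hPi (l := 𝓝[<] (t : ℝ)) (P := (· < t)) fun s => by
      by_cases hs : s < t
      · filter_upwards [nhdsWithin_le_nhds (eventually_gt_nhds (show (s : ℝ) < t from hs))]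
          with x hx
        simp [hs, le_of_lt hx]
      · filter_upwards [self_mem_nhdsWithin] with x hx
        have : x < (s : ℝ) := lt_of_lt_of_le hx (show (t : ℝ) ≤ s from not_lt.1 hs)
        simp [hs, not_le.2 this]
    have hid : Tendsto (fun x : ℝ => x) (𝓝[<] (t : ℝ)) (𝓝 t) := nhdsWithin_le_nhds
    refine le_of_tendsto (hid.add (hlim.const_mul (δ : ℝ))) ?_
    filter_upwards [self_mem_nhdsWithin] with x hx
    rcases lt_or_ge x 0 with h0 | h0
    · have : gapMass hPi (fun s => (s : ℝ) ≤ x) = 0 := by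
        rw [← gapMass_false hPi]
        congr 1
        ext s
        simpa using h0.trans_le s.2.1
      rw [this]
      linarith
    · have hx1 : x ≤ 1 := (le_of_lt hx).trans hmem.2
      have hxS : x ∉ S := notMem_of_lt_csInf hx hbdd
      by_contra hlt
      refine hxS ⟨⟨x, h0, hx1⟩, rfl, ?_⟩
      rw [timeChange_eq hPi hne, hmassle]
      exact (not_le.1 hlt).le
  · rw [hmassle]
    have hlim := tendsto_gapMass hPi (l := 𝓝[>] (t : ℝ)) (P := (fun r => (r : ℝ) ≤ (t : ℝ)))
      fun s => by
        by_cases hs : (s : ℝ) ≤ t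
        · filter_upwards [self_mem_nhdsWithin] with x hx
          simp [hs, hs.trans (le_of_lt hx)]
        · filter_upwards [nhdsWithin_le_nhds (eventually_lt_nhds (not_le.1 hs))] with x hx
          simp [hs, not_le.2 hx]
    have hid : Tendsto (fun x : ℝ => x) (𝓝[>] (t : ℝ)) (𝓝 t) := nhdsWithin_le_nhds
    refine ge_of_tendsto (hid.add (hlim.const_mul (δ : ℝ))) ?_
    filter_upwards [self_mem_nhdsWithin] with x hx
    obtain ⟨_, ⟨s, rfl, hs⟩, hsx⟩ := exists_lt_of_csInf_lt ⟨1, h1S⟩ hx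
    rw [timeChange_eq hPi hne, hmassle] at hs
    refine hs.trans (add_le_add hsx.le (mul_le_mul_of_nonneg_left ?_ δ.2))
    exact gapMass_mono hPi fun r hr => hr.trans hsx.le

open Classical in
/-- The time `t ∈ [0, 1]` to which a point of the extended interval belongs. -/
noncomputable def baseTime (δ : ℝ≥0) (u : ℝ) : I :=
  if Pi = ∅ then projIcc (0 : ℝ) 1 zero_le_one u else timeChangeInv hPi δ u

open Classical in
/-- The relative position of a point of the extended interval inside its gap. -/
noncomputable def gapPosition (δ : ℝ≥0) (u : ℝ) : I :=
  if Pi = ∅ then 1 else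
    if u = timeChange hPi δ (baseTime hPi δ u) then 1 else
      projIcc (0 : ℝ) 1 zero_le_one ((u - timeChangeLeft hPi δ (baseTime hPi δ u)) /
        (timeChange hPi δ (baseTime hPi δ u) - timeChangeLeft hPi δ (baseTime hPi δ u)))

lemma deltaExtension_eq {V : Type*} (φ : I → I → V) (δ : ℝ≥0) (u : ExtInterval δ) :
    deltaExtension φ hPi δ u = φ (baseTime hPi δ u) (gapPosition hPi δ u) := by
  unfold deltaExtension gapPosition baseTime
  dsimp only
  split_ifs <;> rfl

lemma baseTime_spec {δ : ℝ≥0} (u : ExtInterval δ) :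
    (baseTime hPi δ u : ℝ) + δ * gapSumLeft hPi (baseTime hPi δ u) ≤ u ∧
      (u : ℝ) ≤ baseTime hPi δ u + δ * gapSum hPi (baseTime hPi δ u) := by
  by_cases hne : Pi = ∅
  · have hb : baseTime hPi δ u = projIcc (0 : ℝ) 1 zero_le_one u := by rw [baseTime, if_pos hne]
    rw [gapSumLeft, gapSum, if_pos hne, if_pos hne, hb, mul_zero, add_zero]
    have h1 := u.2.1
    have h2 := u.2.2
    rcases le_total (u : ℝ) 1 with h | h
    · rw [projIcc_of_mem zero_le_one ⟨h1, h⟩]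
      refine ⟨le_rfl, le_add_of_nonneg_right ?_⟩
      have := δ.2
      split_ifs <;> simp
    · have e : projIcc (0 : ℝ) 1 zero_le_one u = (1 : I) := projIcc_of_right_le zero_le_one h
      rw [e]
      refine ⟨h, ?_⟩
      rw [if_pos rfl]
      simpa using h2
  · have hb : baseTime hPi δ u = timeChangeInv hPi δ u := by rw [baseTime, if_neg hne]
    rw [hb]
    exact timeChangeInv_spec hPi hne δ u.2.1 u.2.2

lemma baseTime_spec_one (u : ExtInterval 1) :
    (baseTime hPi 1 u : ℝ) + gapSumLeft hPi (baseTime hPi 1 u) ≤ u ∧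
      (u : ℝ) ≤ baseTime hPi 1 u + gapSum hPi (baseTime hPi 1 u) := by
  simpa using baseTime_spec hPi u

lemma gap_lt_gap (δ : ℝ≥0) {s t : I} (hst : s < t) :
    (s : ℝ) + δ * gapSum hPi s < t + δ * gapSumLeft hPi t := by
  have h1 : (s : ℝ) < t := hst
  have := mul_le_mul_of_nonneg_left (gapSum_le_left hPi hst) δ.2
  exact add_lt_add_of_lt_of_le h1 this

lemma baseTime_unique {δ : ℝ≥0} {u : ExtInterval δ} {t : I}
    (h1 : (t : ℝ) + δ * gapSumLeft hPi t ≤ u) (h2 : (u : ℝ) ≤ t + δ * gapSum hPi t) :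
    baseTime hPi δ u = t := by
  obtain ⟨h3, h4⟩ := baseTime_spec hPi u
  rcases lt_trichotomy (baseTime hPi δ u) t with h | h | h
  · linarith [gap_lt_gap hPi δ h]
  · exact h
  · linarith [gap_lt_gap hPi δ h]

lemma baseTime_mono (δ : ℝ≥0) : Monotone (fun u : ExtInterval δ => baseTime hPi δ u) := by
  intro u v huv
  by_contra h
  have h1 := gap_lt_gap hPi δ (not_le.1 h)
  have h2 := (baseTime_spec hPi u).1
  have h3 := (baseTime_spec hPi v).2
  have h4 : (u : ℝ) ≤ v := huv
  linarith

/-- The time change `u ↦ u - t(u)` is monotone, that is, `t(u)` is `1`-Lipschitz. -/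
lemma baseTime_sub_le {δ : ℝ≥0} {u v : ExtInterval δ} (huv : u ≤ v) :
    (baseTime hPi δ v : ℝ) - baseTime hPi δ u ≤ v - u := by
  have h4 : (u : ℝ) ≤ v := huv
  rcases (baseTime_mono hPi δ huv).eq_or_lt with h | h
  · have : (baseTime hPi δ u : ℝ) = baseTime hPi δ v := congrArg _ h
    linarith
  · have h2 := (baseTime_spec hPi u).2
    have h3 := (baseTime_spec hPi v).1
    have h5 := mul_le_mul_of_nonneg_left (gapSum_le_left hPi h) δ.2
    have h6 : (δ : ℝ) * gapSum hPi (baseTime hPi δ u) ≤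
      δ * gapSumLeft hPi (baseTime hPi δ v) := h5
    linarith

/-- The increasing bijection of `[0, 1 + δ]` onto `[0, 1 + δ']` that rescales the gaps. -/
noncomputable def rescale (δ δ' : ℝ≥0) (u : ExtInterval δ) : ExtInterval δ' :=
  ⟨baseTime hPi δ u + δ' / δ * (u - baseTime hPi δ u), by
    obtain ⟨h1, h2⟩ := baseTime_spec hPi u
    have h3 := (baseTime hPi δ u).2
    have h4 := mul_nonneg δ.2 (gapSumLeft_nonneg hPi (baseTime hPi δ u))
    have h5 : (0 : ℝ) ≤ δ' / δ := by positivity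
    have h4' : 0 ≤ (δ : ℝ) * gapSumLeft hPi (baseTime hPi δ u) := h4
    have h6 : (0 : ℝ) ≤ u - baseTime hPi δ u := by linarith
    refine ⟨add_nonneg h3.1 (mul_nonneg h5 h6), add_le_add h3.2 ?_⟩
    have h7 : (δ : ℝ) * gapSum hPi (baseTime hPi δ u) ≤ δ :=
      mul_le_of_le_one_right δ.2 (gapSum_le_one hPi _)
    rcases eq_or_lt_of_le δ.2 with h0 | h0
    · have h0'' : (δ : ℝ) = 0 := h0.symm
      have h0' : (δ' : ℝ) / δ = 0 := by simp [h0'']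
      rw [h0', zero_mul]
      exact δ'.2
    · have h0' : (0 : ℝ) < δ := h0
      rw [div_mul_eq_mul_div, div_le_iff₀ h0']
      exact mul_le_mul_of_nonneg_left (by linarith) δ'.2⟩

lemma rescale_coe (δ δ' : ℝ≥0) (u : ExtInterval δ) :
    (rescale hPi δ δ' u : ℝ) = baseTime hPi δ u + δ' / δ * (u - baseTime hPi δ u) := rfl

lemma baseTime_rescale {δ δ' : ℝ≥0} (hδ : 0 < δ) (u : ExtInterval δ) :
    baseTime hPi δ' (rescale hPi δ δ' u) = baseTime hPi δ u := by
  obtain ⟨h1, h2⟩ := baseTime_spec hPi u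
  have hδ' : (0 : ℝ) < δ := hδ
  have h5 : (0 : ℝ) ≤ δ' / δ := by positivity
  refine baseTime_unique hPi ?_ ?_
  · rw [rescale_coe]
    have : (δ' : ℝ) * gapSumLeft hPi (baseTime hPi δ u) =
      δ' / δ * (δ * gapSumLeft hPi (baseTime hPi δ u)) := by field_simp
    rw [this]
    gcongr
    linarith
  · rw [rescale_coe]
    have : (δ' : ℝ) * gapSum hPi (baseTime hPi δ u) =
      δ' / δ * (δ * gapSum hPi (baseTime hPi δ u)) := by field_simp
    rw [this]
    gcongr
    linarith

lemma gapPosition_rescale {δ δ' : ℝ≥0} (hδ : 0 < δ) (hδ' : 0 < δ') (u : ExtInterval δ) :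
    gapPosition hPi δ' (rescale hPi δ δ' u) = gapPosition hPi δ u := by
  have h1 : (0 : ℝ) < δ := hδ
  have h2 : (0 : ℝ) < δ' := hδ'
  unfold gapPosition
  rw [baseTime_rescale hPi hδ]
  by_cases hne : Pi = ∅
  · rw [if_pos hne, if_pos hne]
  rw [if_neg hne, if_neg hne]
  simp only [timeChange_eq hPi hne, timeChangeLeft_eq hPi hne, rescale_coe]
  set t := baseTime hPi δ u
  have e1 : (t : ℝ) + δ' / δ * (u - t) = t + δ' * gapSum hPi t ↔
      (u : ℝ) = t + δ * gapSum hPi t := by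
    constructor
    · intro h
      have : (δ' : ℝ) / δ * (u - t) = δ' * gapSum hPi t := by linarith
      field_simp at this
      linarith
    · intro h
      rw [h]
      field_simp
      ring
  have e2 : ((t : ℝ) + δ' / δ * (u - t) - (t + δ' * gapSumLeft hPi t)) /
      (t + δ' * gapSum hPi t - (t + δ' * gapSumLeft hPi t)) =
      ((u : ℝ) - (t + δ * gapSumLeft hPi t)) /
      (t + δ * gapSum hPi t - (t + δ * gapSumLeft hPi t)) := by
    have a1 : (t : ℝ) + δ' / δ * (u - t) - (t + δ' * gapSumLeft hPi t) =
      δ' / δ * ((u : ℝ) - (t + δ * gapSumLeft hPi t)) := by field_simp; ring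
    have a2 : (t : ℝ) + δ' * gapSum hPi t - (t + δ' * gapSumLeft hPi t) =
      δ' / δ * (t + δ * gapSum hPi t - (t + δ * gapSumLeft hPi t)) := by field_simp; ring
    rw [a1, a2, mul_div_mul_left _ _ (by positivity)]
  rw [e2]
  simp only [e1]

lemma rescale_rescale {δ δ' : ℝ≥0} (hδ : 0 < δ) (hδ' : 0 < δ') (u : ExtInterval δ) :
    rescale hPi δ' δ (rescale hPi δ δ' u) = u := by
  have h1 : (0 : ℝ) < δ := hδ
  have h2 : (0 : ℝ) < δ' := hδ'
  refine Subtype.ext ?_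
  rw [rescale_coe, baseTime_rescale hPi hδ, rescale_coe]
  field_simp
  ring

lemma rescale_mono {δ δ' : ℝ≥0} : Monotone (rescale hPi δ δ') := by
  intro u v huv
  have h1 : (baseTime hPi δ u : ℝ) ≤ baseTime hPi δ v := baseTime_mono hPi δ huv
  have h2 := baseTime_sub_le hPi huv
  have h3 : (0 : ℝ) ≤ δ' / δ := by positivity
  refine Subtype.coe_le_coe.1 ?_
  rw [rescale_coe, rescale_coe]
  have := mul_le_mul_of_nonneg_left (show (u : ℝ) - baseTime hPi δ u ≤ v - baseTime hPi δ v by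
    linarith) h3
  linarith

/-- `rescale` as an order isomorphism. -/
noncomputable def rescaleIso {δ δ' : ℝ≥0} (hδ : 0 < δ) (hδ' : 0 < δ') :
    ExtInterval δ ≃o ExtInterval δ' :=
  Equiv.toOrderIso ⟨rescale hPi δ δ', rescale hPi δ' δ, rescale_rescale hPi hδ hδ',
    rescale_rescale hPi hδ' hδ⟩ (rescale_mono hPi) (rescale_mono hPi)

lemma rescaleIso_apply {δ δ' : ℝ≥0} (hδ : 0 < δ) (hδ' : 0 < δ') (u : ExtInterval δ) :
    rescaleIso hPi hδ hδ' u = rescale hPi δ δ' u := rfl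

/-- Different extensions of a path are reparametrisations of each other. -/
lemma deltaExtension_rescale {V : Type*} (φ : I → I → V) {δ δ' : ℝ≥0} (hδ : 0 < δ) (hδ' : 0 < δ')
    (u : ExtInterval δ) :
    deltaExtension φ hPi δ' (rescaleIso hPi hδ hδ' u) = deltaExtension φ hPi δ u := by
  rw [deltaExtension_eq, deltaExtension_eq, rescaleIso_apply, baseTime_rescale hPi hδ,
    gapPosition_rescale hPi hδ hδ']

/-- The point of `[0, 2]` at relative position `s` in the gap at time `t`. -/
noncomputable def gapPoint (t s : I) : ExtInterval 1 :=
  ⟨t + gapSumLeft hPi t + s * (gapSum hPi t - gapSumLeft hPi t), by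
    have h1 := gapSumLeft_nonneg hPi t
    have h2 := gapSumLeft_le hPi t
    have h3 := gapSum_le_one hPi t
    have h4 := t.2
    have h5 := s.2
    have h6 : (s : ℝ) * (gapSum hPi t - gapSumLeft hPi t) ≤ 1 * (gapSum hPi t - gapSumLeft hPi t) :=
      mul_le_mul_of_nonneg_right h5.2 (by linarith)
    have h7 : 0 ≤ (s : ℝ) * (gapSum hPi t - gapSumLeft hPi t) := mul_nonneg h5.1 (by linarith)
    rw [NNReal.coe_one]
    exact ⟨by linarith [h4.1], by linarith [h4.2]⟩⟩

lemma gapPoint_coe (t s : I) : (gapPoint hPi t s : ℝ) =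
    t + gapSumLeft hPi t + s * (gapSum hPi t - gapSumLeft hPi t) := rfl

lemma gapPoint_one_coe (t : I) : (gapPoint hPi t 1 : ℝ) = t + gapSum hPi t := by
  rw [gapPoint_coe]; simp

lemma gapPoint_zero_coe (t : I) : (gapPoint hPi t 0 : ℝ) = t + gapSumLeft hPi t := by
  rw [gapPoint_coe]; simp

lemma gapPoint_mono (t : I) : Monotone (gapPoint hPi t) := by
  intro s s' h
  refine Subtype.coe_le_coe.1 ?_
  rw [gapPoint_coe, gapPoint_coe]
  have h1 := gapSumLeft_le hPi t
  have h2 : (s : ℝ) ≤ s' := h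
  exact add_le_add le_rfl (mul_le_mul_of_nonneg_right h2 (by linarith))

lemma baseTime_gapPoint (t s : I) : baseTime hPi 1 (gapPoint hPi t s) = t := by
  refine baseTime_unique hPi ?_ ?_
  · have := gapPoint_mono hPi t (show 0 ≤ s from unitInterval.nonneg')
    have h : (gapPoint hPi t 0 : ℝ) ≤ gapPoint hPi t s := this
    rw [gapPoint_zero_coe] at h
    simpa using h
  · have := gapPoint_mono hPi t (show s ≤ 1 from unitInterval.le_one')
    have h : (gapPoint hPi t s : ℝ) ≤ gapPoint hPi t 1 := this
    rw [gapPoint_one_coe] at h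
    simpa using h

lemma gapPoint_gapPosition (hne : Pi ≠ ∅) (u : ExtInterval 1) :
    gapPoint hPi (baseTime hPi 1 u) (gapPosition hPi 1 u) = u := by
  obtain ⟨h1, h2⟩ := baseTime_spec_one hPi u
  refine Subtype.ext ?_
  unfold gapPosition
  rw [if_neg hne, timeChange_eq hPi hne, timeChangeLeft_eq hPi hne]
  simp only [NNReal.coe_one, one_mul]
  split_ifs with h
  · rw [gapPoint_one_coe]; exact h.symm
  · have h3 := lt_of_le_of_ne h2 h
    set t := baseTime hPi 1 u
    have h4 : 0 < (t : ℝ) + gapSum hPi t - (t + gapSumLeft hPi t) := by linarith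
    rw [projIcc_of_mem zero_le_one ⟨div_nonneg (by linarith) h4.le, (div_le_one h4).2
      (by linarith)⟩, gapPoint_coe]
    have h5 : gapSum hPi t - gapSumLeft hPi t =
        (t : ℝ) + gapSum hPi t - (t + gapSumLeft hPi t) := by
      ring
    rw [h5]
    dsimp only
    rw [div_mul_cancel₀ _ h4.ne']
    ring

lemma gapPoint_lt_gapPoint {s t : I} (hst : s < t) (x y : I) :
    gapPoint hPi s x < gapPoint hPi t y := by
  by_contra h
  have := baseTime_mono hPi 1 (not_lt.1 h)
  simp only [baseTime_gapPoint] at this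
  exact not_lt.2 this hst

lemma le_gapPoint_one (u : ExtInterval 1) : u ≤ gapPoint hPi (baseTime hPi 1 u) 1 := by
  have := (baseTime_spec_one hPi u).2
  rwa [← gapPoint_one_coe] at this

lemma gapPoint_zero_le (u : ExtInterval 1) : gapPoint hPi (baseTime hPi 1 u) 0 ≤ u := by
  have := (baseTime_spec_one hPi u).1
  rwa [← gapPoint_zero_coe] at this

end TimeChange

/-! ### Extensions of decorated paths are càdlàg -/

section Extension

variable {E : Type*} [NormedAddCommGroup E]

lemma gapPoint_strictMono {Pi : Set I} (hPi : Pi.Countable) {t : I} (ht : t ∈ Pi) :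
    StrictMono (gapPoint hPi t) := by
  intro s s' h
  refine Subtype.coe_lt_coe.1 ?_
  rw [gapPoint_coe, gapPoint_coe]
  have h1 := gapSumLeft_lt hPi ht
  have h2 : (s : ℝ) < s' := h
  exact add_lt_add_of_le_of_lt le_rfl (mul_lt_mul_of_pos_right h2 (by linarith))

lemma gapPoint_le_gapPoint {Pi : Set I} (hPi : Pi.Countable) {t t' : I} (h : t ≤ t') (x : I) :
    gapPoint hPi t x ≤ gapPoint hPi t' x := by
  rcases h.eq_or_lt with rfl | h
  · exact le_rfl
  · exact (gapPoint_lt_gapPoint hPi h x x).le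

lemma PreDecoratedPath.ext_eq (φ : PreDecoratedPath E) (δ : ℝ≥0) (u : ExtInterval δ) :
    φ.ext δ u = φ.path (baseTime φ.countable_Pi δ u) (gapPosition φ.countable_Pi δ u) :=
  deltaExtension_eq _ _ _ _

lemma PreDecoratedPath.timeExt_eq (φ : PreDecoratedPath E) (δ : ℝ≥0) (u : ExtInterval δ) :
    φ.timeExt δ u = ((baseTime φ.countable_Pi δ u : ℝ), φ.ext δ u) := by
  rw [PreDecoratedPath.ext_eq]
  exact deltaExtension_eq _ _ _ _

lemma PreDecoratedPath.ext_rescale (φ : PreDecoratedPath E) {δ δ' : ℝ≥0} (hδ : 0 < δ)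
    (hδ' : 0 < δ') (u : ExtInterval δ) :
    φ.ext δ' (rescaleIso φ.countable_Pi hδ hδ' u) = φ.ext δ u :=
  deltaExtension_rescale _ _ hδ hδ' u

lemma PreDecoratedPath.timeExt_rescale (φ : PreDecoratedPath E) {δ δ' : ℝ≥0} (hδ : 0 < δ)
    (hδ' : 0 < δ') (u : ExtInterval δ) :
    φ.timeExt δ' (rescaleIso φ.countable_Pi hδ hδ' u) = φ.timeExt δ u :=
  deltaExtension_rescale _ _ hδ hδ' u

/-- The oscillation points of the extension are the ends of the gaps at the oscillation points of
the endpoint path and at the finitely many large decorations, and the oscillation points of the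
latter. -/
theorem PreDecoratedPath.finiteOscillation_ext (φ : PreDecoratedPath E) :
    FiniteOscillation (φ.ext 1) := by
  classical
  intro ε hε
  set e := ε / 5 with he
  have he0 : 0 < e := by positivity
  set hPi := φ.countable_Pi
  obtain ⟨G, hG⟩ := IsCadlag.finiteOscillation (b := 1) φ.isCadlag_endpoint e he0
  set P := (φ.finite_oscillations e he0).toFinset with hP
  have hPmem : ∀ t ∈ P, t ∈ φ.Pi := fun t ht => ((Set.Finite.mem_toFinset _).1 ht).1
  have hpath : ∀ t, ∃ F : Finset I, ∀ s s', s ≤ s' → (∀ g ∈ F, s < g → s' < g) →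
      dist (φ.path t s) (φ.path t s') ≤ e := fun t =>
    IsCadlag.finiteOscillation (b := 1) (φ.isCadlag_path t) e he0
  choose F hF using hpath
  have hsmall : ∀ t, t ∉ P → ∀ x y, dist (φ.path t x) (φ.path t y) ≤ 2 * e := by
    intro t ht x y
    have h0 : ∀ x, ‖φ.path t x - φ.path t 0‖ ≤ e := by
      intro x
      by_cases htPi : t ∈ φ.Pi
      · by_contra hlt
        exact ht ((Set.Finite.mem_toFinset _).2 ⟨htPi, x, not_le.1 hlt⟩)
      · rw [φ.stationary t htPi x, sub_self, norm_zero]; exact he0.le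
    have h1 := h0 x
    have h2 := h0 y
    rw [← dist_eq_norm] at h1 h2
    linarith [dist_triangle_right (φ.path t x) (φ.path t y) (φ.path t 0)]
  refine ⟨((G ∪ P).image fun t => gapPoint hPi t 0) ∪ ((G ∪ P).image fun t => gapPoint hPi t 1) ∪
    P.biUnion fun t => (F t).image (gapPoint hPi t), fun s s' hss' hg => ?_⟩
  have hg0 : ∀ t ∈ G ∪ P, s < gapPoint hPi t 0 → s' < gapPoint hPi t 0 := fun t ht =>
    hg _ (Finset.mem_union_left _ (Finset.mem_union_left _
      (Finset.mem_image_of_mem (fun t => gapPoint hPi t 0) ht)))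
  have hg1 : ∀ t ∈ G ∪ P, s < gapPoint hPi t 1 → s' < gapPoint hPi t 1 := fun t ht =>
    hg _ (Finset.mem_union_left _ (Finset.mem_union_right _
      (Finset.mem_image_of_mem (fun t => gapPoint hPi t 1) ht)))
  have hgF : ∀ t ∈ P, ∀ g ∈ F t, s < gapPoint hPi t g → s' < gapPoint hPi t g := fun t ht g hgt =>
    hg _ (Finset.mem_union_right _ (Finset.mem_biUnion.2 ⟨t, ht, Finset.mem_image_of_mem _ hgt⟩))
  rw [φ.ext_eq, φ.ext_eq]
  have hpos : ∀ u : ExtInterval 1, baseTime hPi 1 u ∈ P →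
      gapPoint hPi (baseTime hPi 1 u) (gapPosition hPi 1 u) = u := fun u hu =>
    gapPoint_gapPosition hPi (nonempty_iff_ne_empty.1 ⟨_, hPmem _ hu⟩) u
  rcases hss'.eq_or_lt with rfl | hlt
  · rw [dist_self]; exact hε.le
  have hposs := hpos s
  have hposs' := hpos s'
  have hs1 := le_gapPoint_one hPi s
  have hs0 := gapPoint_zero_le hPi s'
  have htt := baseTime_mono hPi 1 hss'
  dsimp only at htt
  set t := baseTime hPi 1 s with ht
  set t' := baseTime hPi 1 s' with ht'
  set x := gapPosition hPi 1 s
  set x' := gapPosition hPi 1 s'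
  rcases htt.eq_or_lt with heq | htlt
  · rw [← heq] at hposs' ⊢
    by_cases htP : t ∈ P
    · have h1 := hposs htP
      have h2 := hposs' htP
      have hmono := gapPoint_strictMono hPi (hPmem t htP)
      refine (hF t x x' ?_ ?_).trans (by linarith)
      · rw [← hmono.le_iff_le, h1, h2]; exact hss'
      · intro g hgt hxg
        have h3 := hgF t htP g hgt (by rw [← h1]; exact hmono hxg)
        rw [← h2] at h3
        exact hmono.lt_iff_lt.1 h3
    · exact (hsmall t htP x x').trans (by linarith)
  · have hst' : s < gapPoint hPi t' 0 := hs1.trans_lt (gapPoint_lt_gapPoint hPi htlt 1 0)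
    have ht'P : t' ∉ P := fun h => not_lt.2 hs0 (hg0 t' (Finset.mem_union_right _ h) hst')
    have d1 := hsmall t' ht'P x' 1
    have d2 : dist (φ.path t 1) (φ.path t' 1) ≤ e := by
      refine hG t t' htlt.le fun g hgG htg => ?_
      by_contra hgt'
      have h3 := hg0 g (Finset.mem_union_left _ hgG)
        (hs1.trans_lt (gapPoint_lt_gapPoint hPi htg 1 0))
      exact not_lt.2 ((gapPoint_le_gapPoint hPi (not_lt.1 hgt') 0).trans hs0) h3
    have d3 : dist (φ.path t x) (φ.path t 1) ≤ 2 * e := by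
      by_cases htP : t ∈ P
      · have h1 := hposs htP
        have h2 : s = gapPoint hPi t 1 := by
          refine le_antisymm hs1 (not_lt.1 fun h => ?_)
          have h3 := hg1 t (Finset.mem_union_right _ htP) h
          exact not_lt.2 (((gapPoint_lt_gapPoint hPi htlt 1 0).trans_le hs0).le) h3
        have h4 : x = 1 := (gapPoint_strictMono hPi (hPmem t htP)).injective (h1.trans h2)
        rw [h4, dist_self]
        positivity
      · exact hsmall t htP x 1
    have := dist_triangle4_right (φ.path t x) (φ.path t' x') (φ.path t 1) (φ.path t' 1)
    linarith

lemma FiniteOscillation.prodMk {T V W : Type*} [LinearOrder T] [PseudoMetricSpace V]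
    [PseudoMetricSpace W] {h : T → V} {k : T → W} (hh : FiniteOscillation h)
    (hk : FiniteOscillation k) : FiniteOscillation (fun s => (h s, k s)) := by
  classical
  intro ε hε
  obtain ⟨F, hF⟩ := hh ε hε
  obtain ⟨G, hG⟩ := hk ε hε
  refine ⟨F ∪ G, fun s s' hss' hg => ?_⟩
  rw [Prod.dist_eq]
  exact max_le (hF s s' hss' fun g h => hg g (Finset.mem_union_left _ h))
    (hG s s' hss' fun g h => hg g (Finset.mem_union_right _ h))

lemma finiteOscillation_coe {b : ℝ} : FiniteOscillation (fun u : Icc (0 : ℝ) b => (u : ℝ)) :=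
  IsCadlag.finiteOscillation fun t =>
    ⟨continuous_subtype_val.continuousWithinAt, t, continuous_subtype_val.continuousAt.mono_left
      nhdsWithin_le_nhds⟩

lemma abs_baseTime_sub_le {Pi : Set I} (hPi : Pi.Countable) (u v : ExtInterval 1) :
    |(baseTime hPi 1 u : ℝ) - baseTime hPi 1 v| ≤ |(u : ℝ) - v| := by
  wlog huv : u ≤ v generalizing u v
  · rw [abs_sub_comm, abs_sub_comm (u : ℝ)]
    exact this v u (le_of_not_ge huv)
  have h1 := baseTime_sub_le hPi huv
  have h2 : (baseTime hPi 1 u : ℝ) ≤ baseTime hPi 1 v := baseTime_mono hPi 1 huv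
  have h3 : (u : ℝ) ≤ v := huv
  rw [abs_of_nonpos (by linarith), abs_of_nonpos (by linarith)]
  linarith

lemma PreDecoratedPath.finiteOscillation_timeExt (φ : PreDecoratedPath E) :
    FiniteOscillation (φ.timeExt 1) := by
  have h1 : FiniteOscillation (fun u : ExtInterval 1 => (baseTime φ.countable_Pi 1 u : ℝ)) :=
    (finiteOscillation_coe (b := 1 + ((1 : ℝ≥0) : ℝ))).of_lipschitz zero_le_one fun u v => by
      rw [one_mul, Real.dist_eq, Real.dist_eq]
      exact abs_baseTime_sub_le _ u v
  have := h1.prodMk φ.finiteOscillation_ext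
  refine fun ε hε => ?_
  obtain ⟨F, hF⟩ := this ε hε
  exact ⟨F, fun s s' h1 h2 => by rw [φ.timeExt_eq, φ.timeExt_eq]; exact hF s s' h1 h2⟩

lemma PreDecoratedPath.monotone_timeExt_fst (φ : PreDecoratedPath E) :
    Monotone (fun s => (φ.timeExt 1 s).1) := by
  intro s s' h
  simp only [φ.timeExt_eq]
  exact baseTime_mono _ 1 h

end Extension

/-! ### The distances of decorated paths as distances of parametrised graphs -/

section Distance

variable {E : Type*} [NormedAddCommGroup E]

/-- The uniform distance of two functions modulo reparametrisation. -/
noncomputable def reparamDist {T Z : Type*} [LinearOrder T] [PseudoEMetricSpace Z] (h₁ h₂ : T → Z) :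
    ℝ≥0∞ := ⨅ ρ : T ≃o T, ⨆ u, edist (h₁ (ρ u)) (h₂ u)

section

variable {T Z : Type*} [LinearOrder T] [PseudoEMetricSpace Z]

lemma reparamDist_self (h : T → Z) : reparamDist h h = 0 :=
  le_antisymm (iInf_le_of_le (OrderIso.refl T) (by simp)) bot_le

lemma reparamDist_comm_le (h₁ h₂ : T → Z) : reparamDist h₁ h₂ ≤ reparamDist h₂ h₁ := by
  refine le_iInf fun ρ => iInf_le_of_le ρ.symm (iSup_le fun u => ?_)
  have := le_iSup (fun u => edist (h₂ (ρ u)) (h₁ u)) (ρ.symm u)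
  simpa [edist_comm] using this

lemma reparamDist_comm (h₁ h₂ : T → Z) : reparamDist h₁ h₂ = reparamDist h₂ h₁ :=
  le_antisymm (reparamDist_comm_le _ _) (reparamDist_comm_le _ _)

lemma reparamDist_triangle (h₁ h₂ h₃ : T → Z) :
    reparamDist h₁ h₃ ≤ reparamDist h₁ h₂ + reparamDist h₂ h₃ := by
  unfold reparamDist
  rw [ENNReal.iInf_add]
  refine le_iInf fun ρ => ?_
  rw [ENNReal.add_iInf]
  refine le_iInf fun ρ' => iInf_le_of_le (ρ'.trans ρ) (iSup_le fun u => ?_)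
  refine (edist_triangle _ (h₂ (ρ' u)) _).trans (add_le_add ?_ ?_)
  · exact le_iSup (fun u => edist (h₁ (ρ u)) (h₂ u)) (ρ' u)
  · exact le_iSup (fun u => edist (h₂ (ρ' u)) (h₃ u)) u

end

lemma abs_rescale_sub_baseTime_le {Pi : Set I} (hPi : Pi.Countable) (δ : ℝ≥0) (u : ExtInterval 1) :
    edist ((rescale hPi 1 δ u : ℝ)) (baseTime hPi 1 u : ℝ) ≤ δ := by
  have h0 : (δ : ℝ) / ((1 : ℝ≥0) : ℝ) = δ := by simp
  rw [edist_dist, Real.dist_eq, rescale_coe, add_sub_cancel_left, h0]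
  obtain ⟨h1, h2⟩ := baseTime_spec_one hPi u
  have h3 := gapSumLeft_nonneg hPi (baseTime hPi 1 u)
  have h4 := gapSum_le_one hPi (baseTime hPi 1 u)
  have h5 : (δ : ℝ≥0∞) = ENNReal.ofReal δ := ENNReal.ofReal_coe_nnreal.symm
  rw [h5]
  refine ENNReal.ofReal_le_ofReal ?_
  have h6 : (0 : ℝ) ≤ δ := δ.2
  rw [abs_of_nonneg (mul_nonneg h6 (by linarith))]
  exact mul_le_of_le_one_right h6 (by linarith)

/-- The Skorokhod-type distances of the `δ`-extensions differ by at most `2 δ` from an expression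
in which the distance of the time changes is replaced by that of the base times. -/
lemma limUnder_skorokhod {Pi₁ Pi₂ : Set I} (h₁ : Pi₁.Countable) (h₂ : Pi₂.Countable)
    (J : (ExtInterval 1 ≃o ExtInterval 1) → ℝ≥0∞)
    (Jδ : ∀ δ : ℝ≥0, (ExtInterval δ ≃o ExtInterval δ) → ℝ≥0∞)
    (hJ : ∀ (δ : ℝ≥0) (hδ : 0 < δ) (ρ : ExtInterval 1 ≃o ExtInterval 1),
      Jδ δ (((rescaleIso h₂ one_pos hδ).symm.trans ρ).trans (rescaleIso h₁ one_pos hδ)) = J ρ) :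
    limUnder (𝓝[>] (0 : ℝ≥0)) (fun δ => ⨅ ρ : ExtInterval δ ≃o ExtInterval δ,
      max (⨆ u, edist (ρ u) u) (Jδ δ ρ)) =
    ⨅ ρ : ExtInterval 1 ≃o ExtInterval 1,
      max (⨆ u, edist (baseTime h₁ 1 (ρ u) : ℝ) (baseTime h₂ 1 u : ℝ)) (J ρ) := by
  set S : ℝ≥0∞ := ⨅ ρ : ExtInterval 1 ≃o ExtInterval 1,
      max (⨆ u, edist (baseTime h₁ 1 (ρ u) : ℝ) (baseTime h₂ 1 u : ℝ)) (J ρ) with hS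
  set Sδ : ℝ≥0 → ℝ≥0∞ := fun δ => ⨅ ρ : ExtInterval δ ≃o ExtInterval δ,
      max (⨆ u, edist (ρ u) u) (Jδ δ ρ) with hSδ
  have hle1 : ∀ δ : ℝ≥0, 0 < δ → Sδ δ ≤ S + 2 * δ := by
    intro δ hδ
    rw [hS, ENNReal.iInf_add]
    refine le_iInf fun ρ => ?_
    refine iInf_le_of_le (((rescaleIso h₂ one_pos hδ).symm.trans ρ).trans
      (rescaleIso h₁ one_pos hδ)) ?_
    rw [hJ δ hδ ρ]
    refine max_le (iSup_le fun v => ?_) ((le_max_right _ _).trans le_self_add)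
    obtain ⟨u, rfl⟩ := (rescaleIso h₂ one_pos hδ).surjective v
    rw [OrderIso.trans_apply, OrderIso.trans_apply, OrderIso.symm_apply_apply, rescaleIso_apply,
      rescaleIso_apply, Subtype.edist_eq]
    have e1 := abs_rescale_sub_baseTime_le h₁ δ (ρ u)
    have e2 := abs_rescale_sub_baseTime_le h₂ δ u
    rw [edist_comm] at e2
    have e3 := le_iSup (fun u => edist (baseTime h₁ 1 (ρ u) : ℝ) (baseTime h₂ 1 u : ℝ)) u
    calc edist (rescale h₁ 1 δ (ρ u) : ℝ) (rescale h₂ 1 δ u)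
        ≤ edist (rescale h₁ 1 δ (ρ u) : ℝ) (baseTime h₁ 1 (ρ u)) +
          edist (baseTime h₁ 1 (ρ u) : ℝ) (baseTime h₂ 1 u) +
          edist (baseTime h₂ 1 u : ℝ) (rescale h₂ 1 δ u) := edist_triangle4 _ _ _ _
      _ ≤ δ + max (⨆ u, edist (baseTime h₁ 1 (ρ u) : ℝ) (baseTime h₂ 1 u : ℝ)) (J ρ) + δ := by
        gcongr
        exact e3.trans (le_max_left _ _)
      _ = _ := by ring
  have hle2 : ∀ δ : ℝ≥0, 0 < δ → S ≤ Sδ δ + 2 * δ := by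
    intro δ hδ
    simp only [hSδ]
    rw [ENNReal.iInf_add]
    refine le_iInf fun ρ' => ?_
    set ρ := ((rescaleIso h₂ one_pos hδ).trans ρ').trans (rescaleIso h₁ one_pos hδ).symm with hρ
    have hρ' : ((rescaleIso h₂ one_pos hδ).symm.trans ρ).trans (rescaleIso h₁ one_pos hδ) = ρ' := by
      ext v
      simp [hρ]
    refine iInf_le_of_le ρ ?_
    rw [← hJ δ hδ ρ, hρ']
    refine max_le (iSup_le fun u => ?_) ((le_max_right _ _).trans le_self_add)
    have e1 := abs_rescale_sub_baseTime_le h₁ δ (ρ u)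
    have e2 := abs_rescale_sub_baseTime_le h₂ δ u
    rw [edist_comm] at e1
    have e3 := le_iSup (fun v => edist (ρ' v) v) (rescaleIso h₂ one_pos hδ u)
    have e4 : ρ' (rescaleIso h₂ one_pos hδ u) = rescale h₁ 1 δ (ρ u) := by
      rw [← rescaleIso_apply h₁ one_pos hδ, hρ]; simp
    rw [e4, Subtype.edist_eq, rescaleIso_apply] at e3
    calc edist (baseTime h₁ 1 (ρ u) : ℝ) (baseTime h₂ 1 u : ℝ)
        ≤ edist (baseTime h₁ 1 (ρ u) : ℝ) (rescale h₁ 1 δ (ρ u)) +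
          edist (rescale h₁ 1 δ (ρ u) : ℝ) (rescale h₂ 1 δ u) +
          edist (rescale h₂ 1 δ u : ℝ) (baseTime h₂ 1 u) := edist_triangle4 _ _ _ _
      _ ≤ δ + max (⨆ v, edist (ρ' v) v) (Jδ δ ρ') + δ := by
        gcongr
        exact e3.trans (le_max_left _ _)
      _ = _ := by ring
  have hδ0 : Tendsto (fun δ : ℝ≥0 => 2 * (δ : ℝ≥0∞)) (𝓝[>] 0) (𝓝 0) := by
    have h : Tendsto (fun δ : ℝ≥0 => (δ : ℝ≥0∞)) (𝓝[>] 0) (𝓝 ((0 : ℝ≥0) : ℝ≥0∞)) :=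
      (ENNReal.continuous_coe.tendsto 0).mono_left nhdsWithin_le_nhds
    have := ENNReal.Tendsto.const_mul (a := 2) h (Or.inr (by simp))
    simpa using this
  refine Tendsto.limUnder_eq (tendsto_of_tendsto_of_tendsto_of_le_of_le'
    (g := fun δ : ℝ≥0 => S - 2 * δ) (h := fun δ : ℝ≥0 => S + 2 * δ) ?_ ?_ ?_ ?_)
  · have := ENNReal.Tendsto.sub (tendsto_const_nhds (x := S) (f := 𝓝[>] (0 : ℝ≥0))) hδ0
      (Or.inr ENNReal.zero_ne_top)
    simpa using this
  · have := (tendsto_const_nhds (x := S) (f := 𝓝[>] (0 : ℝ≥0))).add hδ0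
    simpa using this
  · filter_upwards [self_mem_nhdsWithin] with δ hδ
    exact tsub_le_iff_right.2 (hle2 δ hδ)
  · filter_upwards [self_mem_nhdsWithin] with δ hδ using hle1 δ hδ

/-- `α_∞` is the reparametrisation distance of the graphs `(t, φ(t))` at `δ = 1`. -/
theorem PreDecoratedPath.alphaInf_eq (φ₁ φ₂ : PreDecoratedPath E) :
    φ₁.alphaInf φ₂ = reparamDist (φ₁.timeExt 1) (φ₂.timeExt 1) := by
  unfold PreDecoratedPath.alphaInf skorokhodDist
  rw [limUnder_skorokhod φ₁.countable_Pi φ₂.countable_Pi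
    (fun ρ => ⨆ u, edist (φ₁.ext 1 (ρ u)) (φ₂.ext 1 u))
    (fun δ ρ => ⨆ u, edist (φ₁.ext δ (ρ u)) (φ₂.ext δ u))]
  · unfold reparamDist
    refine iInf_congr fun ρ => ?_
    rw [← iSup_sup_eq]
    refine iSup_congr fun u => ?_
    rw [φ₁.timeExt_eq, φ₂.timeExt_eq, Prod.edist_eq]
  · intro δ hδ ρ
    rw [← (rescaleIso φ₂.countable_Pi one_pos hδ).surjective.iSup_comp]
    refine iSup_congr fun u => ?_
    simp only [OrderIso.trans_apply, OrderIso.symm_apply_apply]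
    rw [φ₁.ext_rescale, φ₂.ext_rescale]

lemma varSum_comp_orderIso {T S V : Type*} [LinearOrder T] [LinearOrder S] [PseudoEMetricSpace V]
    (r : ℝ) (h : T → V) (e : S ≃o T) : varSum r (fun s => h (e s)) = varSum r h := by
  refine le_antisymm (varSum_comp_le r h e.monotone) ?_
  have := varSum_comp_le r (fun s => h (e s)) e.symm.monotone
  simpa using this

lemma pVariation_comp_orderIso {T S V : Type*} [LinearOrder T] [LinearOrder S]
    [PseudoEMetricSpace V] (q : ℝ≥0∞) (h : T → V) (e : S ≃o T) :
    pVariation q (fun s => h (e s)) = pVariation q h := by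
  by_cases hq : q = ∞
  · rw [pVariation, pVariation, if_pos hq, if_pos hq]
    rw [← e.surjective.iSup_comp]
    refine iSup_congr fun s => ?_
    rw [← e.surjective.iSup_comp (fun t => edist (h (e s)) (h t))]
  · rw [pVariation_eq_varSum hq, pVariation_eq_varSum hq, varSum_comp_orderIso]

lemma orderIso_zero {δ δ' : ℝ≥0} (e : ExtInterval δ ≃o ExtInterval δ') :
    e (ExtInterval.zero δ) = ExtInterval.zero δ' := by
  refine le_antisymm ?_ (ExtInterval.zero_le' _)
  rw [← e.le_symm_apply]
  exact ExtInterval.zero_le' _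

/-- `α_{q-var}` in terms of the extensions at `δ = 1`. -/
theorem PreDecoratedPath.alphaVar_eq (q : ℝ≥0∞) (φ₁ φ₂ : PreDecoratedPath E) :
    PreDecoratedPath.alphaVar q φ₁ φ₂ = ⨅ ρ : ExtInterval 1 ≃o ExtInterval 1,
      max (⨆ u, edist (φ₁.timeExt 1 (ρ u)).1 (φ₂.timeExt 1 u).1)
        (‖φ₁.ext 1 (ρ (ExtInterval.zero 1)) - φ₂.ext 1 (ExtInterval.zero 1)‖ₑ +
          pVariation q (fun u => φ₁.ext 1 (ρ u) - φ₂.ext 1 u)) := by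
  unfold PreDecoratedPath.alphaVar skorokhodVarDist
  rw [limUnder_skorokhod φ₁.countable_Pi φ₂.countable_Pi
    (fun ρ => ‖φ₁.ext 1 (ρ (ExtInterval.zero 1)) - φ₂.ext 1 (ExtInterval.zero 1)‖ₑ +
          pVariation q (fun u => φ₁.ext 1 (ρ u) - φ₂.ext 1 u))
    (fun δ ρ => ‖φ₁.ext δ (ρ (ExtInterval.zero δ)) - φ₂.ext δ (ExtInterval.zero δ)‖ₑ +
          pVariation q (fun u => φ₁.ext δ (ρ u) - φ₂.ext δ u))]
  · simp only [φ₁.timeExt_eq, φ₂.timeExt_eq]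
  · intro δ hδ ρ
    rw [← orderIso_zero (rescaleIso φ₂.countable_Pi one_pos hδ),
      ← pVariation_comp_orderIso q _ (rescaleIso φ₂.countable_Pi one_pos hδ)]
    simp only [OrderIso.trans_apply, OrderIso.symm_apply_apply, φ₁.ext_rescale, φ₂.ext_rescale]

end Distance

/-! ### The metric space of decorated paths -/

section Metric

variable {E : Type*} [NormedAddCommGroup E]

lemma PreDecoratedPath.alphaInf_self (φ : PreDecoratedPath E) : φ.alphaInf φ = 0 := by
  rw [PreDecoratedPath.alphaInf_eq, reparamDist_self]

lemma PreDecoratedPath.alphaInf_comm (φ₁ φ₂ : PreDecoratedPath E) :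
    φ₁.alphaInf φ₂ = φ₂.alphaInf φ₁ := by
  rw [PreDecoratedPath.alphaInf_eq, PreDecoratedPath.alphaInf_eq, reparamDist_comm]

lemma PreDecoratedPath.alphaInf_triangle (φ₁ φ₂ φ₃ : PreDecoratedPath E) :
    φ₁.alphaInf φ₃ ≤ φ₁.alphaInf φ₂ + φ₂.alphaInf φ₃ := by
  simp only [PreDecoratedPath.alphaInf_eq]
  exact reparamDist_triangle _ _ _

lemma PreDecoratedPath.topology_eq :
    (inferInstance : TopologicalSpace (PreDecoratedPath E)) =
      (uniformSpaceOfEDist PreDecoratedPath.alphaInf PreDecoratedPath.alphaInf_self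
        PreDecoratedPath.alphaInf_comm
        (PreDecoratedPath.alphaInf_triangle (E := E))).toTopologicalSpace := by
  let m : PseudoEMetricSpace (PreDecoratedPath E) :=
    { edist := PreDecoratedPath.alphaInf
      edist_self := PreDecoratedPath.alphaInf_self
      edist_comm := PreDecoratedPath.alphaInf_comm
      edist_triangle := PreDecoratedPath.alphaInf_triangle }
  refine TopologicalSpace.ext_iff.2 fun U => ?_
  refine Iff.trans ?_ (EMetric.isOpen_iff (s := U)).symm
  refine forall₂_congr fun x _ => exists_congr fun ε => and_congr Iff.rfl ?_
  refine forall_congr' fun y => ?_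
  rw [PreDecoratedPath.alphaInf_comm]
  rfl

/-- The pseudometric `α_∞`, with the topology that pairs `(φ, Π)` already carry. -/
noncomputable instance : PseudoEMetricSpace (PreDecoratedPath E) where
  edist := PreDecoratedPath.alphaInf
  edist_self := PreDecoratedPath.alphaInf_self
  edist_comm := PreDecoratedPath.alphaInf_comm
  edist_triangle := PreDecoratedPath.alphaInf_triangle
  toUniformSpace := (uniformSpaceOfEDist PreDecoratedPath.alphaInf PreDecoratedPath.alphaInf_self
    PreDecoratedPath.alphaInf_comm PreDecoratedPath.alphaInf_triangle).replaceTopology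
      PreDecoratedPath.topology_eq
  uniformity_edist := rfl

lemma PreDecoratedPath.edist_eq (φ₁ φ₂ : PreDecoratedPath E) : edist φ₁ φ₂ = φ₁.alphaInf φ₂ := rfl

lemma DecoratedPath.mk_eq_mk {φ₁ φ₂ : PreDecoratedPath E} :
    (SeparationQuotient.mk φ₁ : DecoratedPath E) = SeparationQuotient.mk φ₂ ↔
      φ₁.alphaInf φ₂ = 0 := by
  rw [SeparationQuotient.mk_eq_mk, EMetric.inseparable_iff, PreDecoratedPath.edist_eq]

lemma DecoratedPath.mk_out (φ : DecoratedPath E) :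
    SeparationQuotient.mk (Quotient.out φ : PreDecoratedPath E) = φ := Quotient.out_eq φ

lemma DecoratedPath.alphaInf_out (φ₁ : PreDecoratedPath E) :
    (Quotient.out (SeparationQuotient.mk φ₁ : DecoratedPath E)).alphaInf φ₁ = 0 :=
  DecoratedPath.mk_eq_mk.1 (DecoratedPath.mk_out _)

lemma DecoratedPath.hasOuterApproxClosed (E : Type*) [NormedAddCommGroup E] :
    HasOuterApproxClosed (DecoratedPath E) := inferInstance

lemma DecoratedPath.exists_edist_lt {s : Set (DecoratedPath E)}
    {x : DecoratedPath E} (hx : x ∈ closure s) {ε : ℝ≥0∞} (hε : 0 < ε) : ∃ y ∈ s, edist x y < ε :=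
  EMetric.mem_closure_iff.1 hx ε hε

/-! ### Lower semicontinuity of the variation -/

lemma varSum_le_of_reparamDist {T Z : Type*} [LinearOrder T] [PseudoEMetricSpace Z] {r : ℝ}
    {h₀ : T → Z} {c : ℝ≥0∞}
    (H : ∀ ε : ℝ≥0∞, 0 < ε → ∃ h : T → Z, reparamDist h h₀ < ε ∧ varSum r h ≤ c) :
    varSum r h₀ ≤ c := by
  have H' : ∀ n : ℕ, ∃ h : T → Z, varSum r h ≤ c ∧ ∀ u, edist (h u) (h₀ u) ≤ (n : ℝ≥0∞)⁻¹ := by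
    intro n
    obtain ⟨h, h1, h2⟩ := H (n : ℝ≥0∞)⁻¹ (by simp)
    obtain ⟨ρ, hρ⟩ := iInf_lt_iff.1 h1
    exact ⟨fun u => h (ρ u), by rwa [varSum_comp_orderIso],
      fun u => (le_iSup (fun u => edist (h (ρ u)) (h₀ u)) u).trans hρ.le⟩
  choose h h1 h2 using H'
  refine varSum_le_of_tendsto (l := atTop) (Eventually.of_forall h1) fun s => ?_
  rw [tendsto_iff_edist_tendsto_0]
  exact tendsto_of_tendsto_of_tendsto_of_le_of_le tendsto_const_nhds
    ENNReal.tendsto_inv_nat_nhds_zero (fun _ => bot_le) fun n => h2 n s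

lemma PreDecoratedPath.reparamDist_ext_le (φ₁ φ₂ : PreDecoratedPath E) :
    reparamDist (φ₁.ext 1) (φ₂.ext 1) ≤ φ₁.alphaInf φ₂ := by
  rw [PreDecoratedPath.alphaInf_eq]
  refine iInf_mono fun ρ => iSup_mono fun u => ?_
  rw [φ₁.timeExt_eq, φ₂.timeExt_eq, Prod.edist_eq]
  exact le_max_right _ _

lemma pVariation_le_iff {T V : Type*} [LinearOrder T] [PseudoEMetricSpace V] {p : ℝ≥0∞}
    (hp0 : p ≠ 0) (hp : p ≠ ∞) {h : T → V} {c : ℝ≥0∞} :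
    pVariation p h ≤ c ↔ varSum p.toReal h ≤ c ^ p.toReal := by
  rw [pVariation_eq_varSum hp, one_div, ENNReal.rpow_inv_le_iff (ENNReal.toReal_pos hp0 hp)]

lemma PreDecoratedPath.pVariation_ext_le {p : ℝ≥0∞} (hp0 : p ≠ 0) (hp : p ≠ ∞)
    {φ₀ : PreDecoratedPath E} {c : ℝ≥0∞}
    (H : ∀ ε : ℝ≥0∞, 0 < ε → ∃ φ : PreDecoratedPath E, φ.alphaInf φ₀ < ε ∧
      pVariation p (φ.ext 1) ≤ c) : pVariation p (φ₀.ext 1) ≤ c := by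
  rw [pVariation_le_iff hp0 hp]
  refine varSum_le_of_reparamDist fun ε hε => ?_
  obtain ⟨φ, h1, h2⟩ := H ε hε
  exact ⟨φ.ext 1, (φ.reparamDist_ext_le φ₀).trans_lt h1, (pVariation_le_iff hp0 hp).1 h2⟩

lemma PreDecoratedPath.pVariation_ext_congr {p : ℝ≥0∞} (hp0 : p ≠ 0) (hp : p ≠ ∞)
    {φ₁ φ₂ : PreDecoratedPath E} (h : φ₁.alphaInf φ₂ = 0) :
    pVariation p (φ₁.ext 1) = pVariation p (φ₂.ext 1) :=
  le_antisymm
    (PreDecoratedPath.pVariation_ext_le hp0 hp fun ε hε =>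
      ⟨φ₂, by rwa [PreDecoratedPath.alphaInf_comm, h], le_rfl⟩)
    (PreDecoratedPath.pVariation_ext_le hp0 hp fun ε hε => ⟨φ₁, by rwa [h], le_rfl⟩)

lemma DecoratedPath.pVar_mk {p : ℝ≥0∞} (hp0 : p ≠ 0) (hp : p ≠ ∞) (φ : PreDecoratedPath E) :
    DecoratedPath.pVar p (SeparationQuotient.mk φ) = pVariation p (φ.ext 1) :=
  PreDecoratedPath.pVariation_ext_congr hp0 hp (DecoratedPath.alphaInf_out φ)

theorem DecoratedPath.isClosed_pVar_le {p : ℝ≥0∞} (hp0 : p ≠ 0) (hp : p ≠ ∞) (c : ℝ≥0∞) :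
    IsClosed {φ : DecoratedPath E | DecoratedPath.pVar p φ ≤ c} := by
  rw [← SeparationQuotient.isQuotientMap_mk.isClosed_preimage]
  refine isClosed_of_closure_subset fun φ₀ hφ₀ => ?_
  rw [mem_preimage, mem_ofPred_eq, DecoratedPath.pVar_mk hp0 hp]
  refine PreDecoratedPath.pVariation_ext_le hp0 hp fun ε hε => ?_
  obtain ⟨φ, h1, h2⟩ := EMetric.mem_closure_iff.1 hφ₀ ε hε
  rw [mem_preimage, mem_ofPred_eq, DecoratedPath.pVar_mk hp0 hp] at h1
  exact ⟨φ, by rwa [PreDecoratedPath.alphaInf_comm], h1⟩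

/-! ### Interpolation between the uniform and the variation distance -/

lemma varSum_sub_le {T V : Type*} [LinearOrder T] [SeminormedAddCommGroup V] {r q : ℝ} (hr : 1 ≤ r)
    (hrq : r ≤ q) {f g : T → V} {ε : ℝ≥0∞} (hfg : ∀ s, edist (f s) (g s) ≤ ε) :
    varSum q (fun s => f s - g s) ≤
      (2 * ε) ^ (q - r) * (2 ^ (r - 1) * (varSum r f + varSum r g)) := by
  refine varSum_le fun k t ht => ?_
  calc ∑ j ∈ Finset.range k, edist (f (t (j + 1)) - g (t (j + 1))) (f (t j) - g (t j)) ^ q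
      ≤ ∑ j ∈ Finset.range k, (2 * ε) ^ (q - r) * (2 ^ (r - 1) *
          (edist (f (t (j + 1))) (f (t j)) ^ r + edist (g (t (j + 1))) (g (t j)) ^ r)) := by
        refine Finset.sum_le_sum fun j _ => ?_
        have e : edist (f (t (j + 1)) - g (t (j + 1))) (f (t j) - g (t j)) ^ q =
            edist (f (t (j + 1)) - g (t (j + 1))) (f (t j) - g (t j)) ^ (q - r) *
            edist (f (t (j + 1)) - g (t (j + 1))) (f (t j) - g (t j)) ^ r := by
          rw [← ENNReal.rpow_add_of_nonneg _ _ (by linarith) (by linarith), sub_add_cancel]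
        rw [e]
        refine mul_le_mul' (ENNReal.rpow_le_rpow ?_ (by linarith)) ?_
        · rw [two_mul, edist_eq_enorm_sub]
          refine enorm_sub_le.trans (add_le_add ?_ ?_)
          · rw [← edist_eq_enorm_sub]; exact hfg _
          · rw [← edist_eq_enorm_sub]; exact hfg _
        · refine (ENNReal.rpow_le_rpow ?_ (by linarith)).trans
            (ENNReal.rpow_add_le_mul_rpow_add_rpow _ _ hr)
          rw [edist_eq_enorm_sub, edist_eq_enorm_sub, edist_eq_enorm_sub,
            sub_sub_sub_comm]
          exact enorm_sub_le
    _ = (2 * ε) ^ (q - r) * (2 ^ (r - 1) *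
          (∑ j ∈ Finset.range k, edist (f (t (j + 1))) (f (t j)) ^ r +
            ∑ j ∈ Finset.range k, edist (g (t (j + 1))) (g (t j)) ^ r)) := by
        rw [← Finset.mul_sum, ← Finset.mul_sum, Finset.sum_add_distrib]
    _ ≤ _ := by
        gcongr
        · exact sum_le_varSum r f k ht
        · exact sum_le_varSum r g k ht

/-- The difference of uniformly close functions of bounded `p`-variation has small
`q`-variation. -/
lemma exists_pVariation_sub_le {p q : ℝ≥0∞} (hp1 : 1 ≤ p) (hpq : p < q) (K : ℝ≥0) {η : ℝ≥0∞}
    (hη : 0 < η) :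
    ∃ ε : ℝ≥0∞, 0 < ε ∧ ε < η ∧ ∀ {T V : Type*} [LinearOrder T] [SeminormedAddCommGroup V]
      {f g : T → V}, varSum p.toReal f ≤ K → varSum p.toReal g ≤ K →
      (∀ s, edist (f s) (g s) ≤ ε) → ε + pVariation q (fun s => f s - g s) < η := by
  have hp : p ≠ ∞ := ne_top_of_lt hpq
  have hr : 1 ≤ p.toReal := by
    rw [← ENNReal.toReal_one]; exact (ENNReal.toReal_le_toReal ENNReal.one_ne_top hp).2 hp1
  by_cases hq : q = ∞
  · subst hq
    have ht : Tendsto (fun ε : ℝ≥0∞ => ε + 2 * ε) (𝓝 0) (𝓝 0) := by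
      have : Tendsto (fun ε : ℝ≥0∞ => ε + 2 * ε) (𝓝 0) (𝓝 (0 + 2 * 0)) :=
        tendsto_id.add (ENNReal.Tendsto.const_mul tendsto_id (Or.inr (by simp)))
      simpa using this
    obtain ⟨a, ha, H⟩ := ENNReal.nhds_zero_basis.eventually_iff.1
      ((ht.eventually (gt_mem_nhds hη)).and (gt_mem_nhds hη))
    obtain ⟨ε, h0, hε⟩ := exists_between ha
    refine ⟨ε, h0, (H hε).2, fun {T V} _ _ {f g} _ _ hfg => lt_of_le_of_lt ?_ (H hε).1⟩
    rw [pVariation, if_pos rfl]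
    gcongr
    refine iSup₂_le fun s t => ?_
    rw [two_mul, edist_eq_enorm_sub]
    refine enorm_sub_le.trans (add_le_add ?_ ?_)
    · rw [← edist_eq_enorm_sub]; exact hfg _
    · rw [← edist_eq_enorm_sub]; exact hfg _
  · have hlt : p.toReal < q.toReal := (ENNReal.toReal_lt_toReal hp hq).2 hpq
    set C : ℝ≥0∞ := 2 ^ (p.toReal - 1) * (K + K) with hC
    have hCt : C ≠ ∞ := ENNReal.mul_ne_top
      (ENNReal.rpow_ne_top_of_nonneg (by linarith) (by simp)) (by simp)
    have ht : Tendsto (fun ε : ℝ≥0∞ => ε + ((2 * ε) ^ (q.toReal - p.toReal) * C) ^ (1 / q.toReal))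
        (𝓝 0) (𝓝 0) := by
      have h1 : Tendsto (fun ε : ℝ≥0∞ => 2 * ε) (𝓝 0) (𝓝 (2 * 0)) :=
        ENNReal.Tendsto.const_mul tendsto_id (Or.inr (by simp))
      have h2 := (ENNReal.continuous_rpow_const (y := q.toReal - p.toReal)).tendsto _ |>.comp h1
      have h3 := ENNReal.Tendsto.mul_const h2 (Or.inr hCt)
      have h4 := (ENNReal.continuous_rpow_const (y := 1 / q.toReal)).tendsto _ |>.comp h3
      have h5 := (tendsto_id (x := 𝓝 (0 : ℝ≥0∞))).add h4
      have e : (0 : ℝ≥0∞) + ((2 * 0) ^ (q.toReal - p.toReal) * C) ^ (1 / q.toReal) = 0 := by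
        rw [mul_zero, ENNReal.zero_rpow_of_pos (by linarith), zero_mul,
          ENNReal.zero_rpow_of_pos (by apply one_div_pos.2; linarith), add_zero]
      rw [e] at h5
      exact h5
    obtain ⟨a, ha, H⟩ := ENNReal.nhds_zero_basis.eventually_iff.1
      ((ht.eventually (gt_mem_nhds hη)).and (gt_mem_nhds hη))
    obtain ⟨ε, h0, hε⟩ := exists_between ha
    refine ⟨ε, h0, (H hε).2, fun {T V} _ _ {f g} hf hg hfg => lt_of_le_of_lt ?_ (H hε).1⟩
    rw [pVariation_eq_varSum hq]
    gcongr
    refine (varSum_sub_le hr hlt.le hfg).trans ?_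
    rw [hC]
    gcongr

/-- On sets of bounded `p`-variation, `α_∞` controls `α_{q-var}`. -/
theorem PreDecoratedPath.exists_alphaVar_lt {p q : ℝ≥0∞} (hp1 : 1 ≤ p) (hpq : p < q) (K : ℝ≥0)
    {η : ℝ≥0∞} (hη : 0 < η) :
    ∃ ε : ℝ≥0∞, 0 < ε ∧ ∀ φ₁ φ₂ : PreDecoratedPath E, varSum p.toReal (φ₁.ext 1) ≤ K →
      varSum p.toReal (φ₂.ext 1) ≤ K → φ₁.alphaInf φ₂ < ε →
      PreDecoratedPath.alphaVar q φ₁ φ₂ < η := by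
  obtain ⟨ε, hε, hεη, H⟩ := exists_pVariation_sub_le hp1 hpq K hη
  refine ⟨ε, hε, fun φ₁ φ₂ h1 h2 h => ?_⟩
  rw [PreDecoratedPath.alphaInf_eq] at h
  obtain ⟨ρ, hρ⟩ := iInf_lt_iff.1 h
  have hρ' : ∀ u, edist (φ₁.timeExt 1 (ρ u)) (φ₂.timeExt 1 u) ≤ ε := fun u =>
    (le_iSup (fun u => edist (φ₁.timeExt 1 (ρ u)) (φ₂.timeExt 1 u)) u).trans hρ.le
  have hx : ∀ u, edist (φ₁.ext 1 (ρ u)) (φ₂.ext 1 u) ≤ ε := fun u => by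
    refine le_trans ?_ (hρ' u)
    rw [φ₁.timeExt_eq, φ₂.timeExt_eq, Prod.edist_eq]
    exact le_max_right _ _
  rw [PreDecoratedPath.alphaVar_eq]
  refine (iInf_le _ ρ).trans_lt (max_lt (lt_of_le_of_lt (iSup_le fun u => ?_) hεη) ?_)
  · refine le_trans ?_ (hρ' u)
    rw [Prod.edist_eq]
    exact le_max_left _ _
  · refine lt_of_le_of_lt ?_ (H (f := fun u => φ₁.ext 1 (ρ u)) (g := φ₂.ext 1)
      (by rwa [varSum_comp_orderIso]) h2 hx)
    gcongr
    rw [← edist_eq_enorm_sub]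
    exact hx _

end Metric

/-! ### Hölder classes of vector fields -/

section Holder

variable {V W : Type*} [NormedAddCommGroup V] [NormedSpace ℝ V] [NormedAddCommGroup W]
  [NormedSpace ℝ W]

lemma IsHolderClass.two_le_ceil {γ : ℝ} (hγ : 1 < γ) : 2 ≤ ⌈γ⌉₊ := by
  have : 1 < ⌈γ⌉₊ := Nat.lt_ceil.2 (by simpa using hγ)
  omega

lemma IsHolderClass.contDiff_one {γ : ℝ} (hγ : 1 < γ) {f : V → W} (hf : IsHolderClass γ f) :
    ContDiff ℝ 1 f := by
  have h2 := IsHolderClass.two_le_ceil hγ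
  refine hf.1.of_le ?_
  have : 1 ≤ ⌈γ⌉₊ - 1 := by omega
  exact_mod_cast this

lemma IsHolderClass.exists_bound {γ : ℝ} (hγ : 1 < γ) {f : V → W} (hf : IsHolderClass γ f) :
    ∃ C : ℝ, 0 ≤ C ∧ (∀ x, ‖f x‖ ≤ C) ∧ (∀ x, ‖fderiv ℝ f x‖ ≤ C) ∧
      ∀ x y, ‖f x - f y‖ ≤ C * ‖x - y‖ := by
  have h2 := IsHolderClass.two_le_ceil hγ
  have hd := (hf.contDiff_one hγ).differentiable one_ne_zero
  obtain ⟨-, C, hC, -⟩ := hf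
  have h0 : ∀ x, ‖f x‖ ≤ C := fun x => by
    have := hC 0 (Nat.zero_le _) x
    rwa [norm_iteratedFDeriv_zero] at this
  have h1 : ∀ x, ‖fderiv ℝ f x‖ ≤ C := fun x => by
    have := hC 1 (by omega) x
    rwa [norm_iteratedFDeriv_one] at this
  refine ⟨C, (norm_nonneg _).trans (h0 0), h0, h1, fun x y => ?_⟩
  exact convex_univ.norm_image_sub_le_of_norm_fderiv_le (fun z _ => hd z) (fun z _ => h1 z)
    (mem_univ y) (mem_univ x)

lemma IsHolderClass.exists_fderiv_holder {γ : ℝ} (hγ : 1 < γ) {f : V → W}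
    (hf : IsHolderClass γ f) :
    ∃ C : ℝ, 0 ≤ C ∧ ∀ x y, ‖fderiv ℝ f x - fderiv ℝ f y‖ ≤ C * ‖x - y‖ ^ min (γ - 1) 1 := by
  have h2 := IsHolderClass.two_le_ceil hγ
  obtain ⟨hcd, C, hC, hH⟩ := hf
  have hC0 : 0 ≤ C := (norm_nonneg _).trans (hC 0 (Nat.zero_le _) 0)
  refine ⟨C, hC0, fun x y => ?_⟩
  rcases h2.eq_or_lt with h | h
  · have hγ2 : γ ≤ 2 := by
      have := Nat.le_ceil γ
      rw [← h] at this
      exact_mod_cast this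
    have hxy := hH x y
    rw [← h] at hxy
    have e : γ - ((2 - 1 : ℕ) : ℝ) = min (γ - 1) 1 := by
      rw [min_eq_left (by linarith)]; norm_num
    rw [e] at hxy
    refine le_trans (ContinuousLinearMap.opNorm_le_bound _ (norm_nonneg _) fun v => ?_) hxy
    have := (iteratedFDeriv ℝ 1 f x - iteratedFDeriv ℝ 1 f y).le_opNorm (fun _ => v)
    simpa [iteratedFDeriv_one_apply] using this
  · have hγ2 : 2 < γ := by
      have := Nat.lt_ceil.1 h
      exact_mod_cast this
    rw [min_eq_right (by linarith), Real.rpow_one]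
    have hle : (1 + 1 : WithTop ℕ∞) ≤ ((⌈γ⌉₊ - 1 : ℕ) : WithTop ℕ∞) := by
      have h3 : 2 ≤ ⌈γ⌉₊ - 1 := by omega
      have h4 : ((2 : ℕ) : WithTop ℕ∞) ≤ ((⌈γ⌉₊ - 1 : ℕ) : WithTop ℕ∞) := by exact_mod_cast h3
      rw [one_add_one_eq_two]
      exact h4
    have hd : Differentiable ℝ (fderiv ℝ f) :=
      (hcd.fderiv_right hle).differentiable (by simp)
    refine convex_univ.norm_image_sub_le_of_norm_fderiv_le (fun z _ => hd z) (fun z _ => ?_)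
      (mem_univ y) (mem_univ x)
    have := hC 2 (by omega) z
    rwa [← norm_iteratedFDeriv_fderiv, norm_iteratedFDeriv_one] at this

/-- A bounded Hölder derivative controls second differences, by the mean value inequality along the
two segments. -/
lemma fourPoint_of_fderiv_holder {f : V → W} (hf : ContDiff ℝ 1 f) {L H κ : ℝ} (hκ : 0 < κ)
    (hH0 : 0 ≤ H) (hL : ∀ x, ‖fderiv ℝ f x‖ ≤ L)
    (hH : ∀ x y, ‖fderiv ℝ f x - fderiv ℝ f y‖ ≤ H * ‖x - y‖ ^ κ) : FourPoint L H κ f := by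
  intro x y x' y'
  have hd := hf.differentiable one_ne_zero
  have hline : ∀ (a b : V) (θ : ℝ), HasDerivAt (fun θ : ℝ => f (b + θ • (a - b)))
      (fderiv ℝ f (b + θ • (a - b)) (a - b)) θ := by
    intro a b θ
    refine (hd _).hasFDerivAt.comp_hasDerivAt θ ?_
    simpa using ((hasDerivAt_id θ).smul_const (a - b)).const_add b
  have key := norm_image_sub_le_of_norm_deriv_le_segment_01'
    (f := fun θ : ℝ => f (y + θ • (x - y)) - f (y' + θ • (x' - y')))
    (f' := fun θ : ℝ => fderiv ℝ f (y + θ • (x - y)) (x - y) -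
      fderiv ℝ f (y' + θ • (x' - y')) (x' - y'))
    (C := L * ‖(x - y) - (x' - y')‖ + H * max ‖x - x'‖ ‖y - y'‖ ^ κ * ‖x - y‖)
    (fun θ _ => ((hline x y θ).sub (hline x' y' θ)).hasDerivWithinAt) (fun θ hθ => by
      set a := y + θ • (x - y)
      set a' := y' + θ • (x' - y')
      have e : fderiv ℝ f a (x - y) - fderiv ℝ f a' (x' - y') =
          fderiv ℝ f a' ((x - y) - (x' - y')) + (fderiv ℝ f a - fderiv ℝ f a') (x - y) := by
        simp only [map_sub, _root_.sub_apply]; abel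
      have ha : ‖a - a'‖ ≤ max ‖x - x'‖ ‖y - y'‖ := by
        have e2 : a - a' = (1 - θ) • (y - y') + θ • (x - x') := by
          simp only [a, a']; module
        rw [e2]
        refine (norm_add_le _ _).trans ?_
        rw [norm_smul, norm_smul, Real.norm_of_nonneg (by linarith [hθ.2]),
          Real.norm_of_nonneg hθ.1]
        nlinarith [le_max_left ‖x - x'‖ ‖y - y'‖, le_max_right ‖x - x'‖ ‖y - y'‖, hθ.1, hθ.2,
          mul_le_mul_of_nonneg_left (le_max_left ‖x - x'‖ ‖y - y'‖) hθ.1,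
          mul_le_mul_of_nonneg_left (le_max_right ‖x - x'‖ ‖y - y'‖)
            (show 0 ≤ 1 - θ by linarith [hθ.2])]
      rw [e]
      refine (norm_add_le _ _).trans (add_le_add ?_ ?_)
      · exact (ContinuousLinearMap.le_opNorm _ _).trans (by gcongr; exact hL _)
      · refine (ContinuousLinearMap.le_opNorm _ _).trans ?_
        gcongr
        refine (hH _ _).trans ?_
        gcongr)
  refine le_trans (le_of_eq ?_) key
  simp only [one_smul, zero_smul, add_zero, add_sub_cancel]
  congr 1
  abel

/-- The regularity of the vector fields as a set of scalar bounds. -/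
theorem IsHolderClass.exists_fieldBounds {E F : Type*} [NormedAddCommGroup E] [NormedSpace ℝ E]
    [NormedAddCommGroup F] [NormedSpace ℝ F] {A : F → F} {B : F → E →L[ℝ] F} {β γ : ℝ}
    (hβ : 1 < β) (hγ : 1 < γ) (hA : IsHolderClass β A) (hB : IsHolderClass γ B) :
    ∃ M L H : ℝ, FieldBounds A B M L H (min (γ - 1) 1) := by
  obtain ⟨C, hC0, hC, -, hCL⟩ := hA.exists_bound hβ
  obtain ⟨D, hD0, hD, hDd, hDL⟩ := hB.exists_bound hγ
  obtain ⟨H, hH0, hH⟩ := hB.exists_fderiv_holder hγ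
  have hκ : 0 < min (γ - 1) 1 := lt_min (by linarith) one_pos
  refine ⟨max C D, max C D, H, le_max_of_le_left hC0, le_max_of_le_left hC0, hH0, hκ,
    min_le_right _ _, fun x => (hC x).trans (le_max_left _ _),
    fun x => (hD x).trans (le_max_right _ _), fun x y => (hCL x y).trans ?_,
    fun x y => (hDL x y).trans ?_, ?_⟩
  · gcongr; exact le_max_left _ _
  · gcongr; exact le_max_right _ _
  · exact fourPoint_of_fderiv_holder (hB.contDiff_one hγ) hκ hH0
      (fun x => (hDd x).trans (le_max_right _ _)) hH

end Holder

/-! ### Reparametrisation of equations and constancy intervals -/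

section Transfer

variable {V W : Type*} [NormedAddCommGroup V] [NormedSpace ℝ V] [NormedAddCommGroup W]
  [NormedSpace ℝ W]

lemma IsUniformSolution.comp_orderIso {δ δ' : ℝ≥0} {f : W → V →L[ℝ] W} {ξ : W}
    {ω : ExtInterval δ' → V} {X : ExtInterval δ' → W} (h : IsUniformSolution f ξ ω X)
    (e : ExtInterval δ ≃o ExtInterval δ') :
    IsUniformSolution f ξ (fun u => ω (e u)) (fun u => X (e u)) := by
  refine ⟨(congrArg X (orderIso_zero e)).trans h.1, fun ε hε => ?_⟩
  obtain ⟨η, hη, H⟩ := h.2 ε hε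
  have hu : UniformContinuous e := CompactSpace.uniformContinuous_of_continuous e.continuous
  obtain ⟨η', hη', H'⟩ := Metric.uniformContinuous_iff.1 hu η hη
  refine ⟨η', hη', fun t ht h0 hmesh k => H (fun j => e (t j)) (e.monotone.comp ht)
    (by rw [h0, orderIso_zero]) (fun j => ?_) k⟩
  have h1 : (t j : ℝ) ≤ t (j + 1) := ht (Nat.le_succ j)
  have h2 : dist (t (j + 1)) (t j) < η' := by
    rw [Subtype.dist_eq, Real.dist_eq, abs_of_nonneg (by linarith)]
    exact hmesh j
  have h3 := H' h2
  rw [Subtype.dist_eq, Real.dist_eq] at h3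
  exact (le_abs_self _).trans_lt h3

lemma exists_concat {b : ℝ} {η : ℝ} {u : Icc (0 : ℝ) b} {t₁ t₂ : ℕ → Icc (0 : ℝ) b} {n : ℕ}
    (h₁ : Monotone t₁) (h₂ : Monotone t₂) (hn : t₁ n = u) (h0 : t₂ 0 = u)
    (m₁ : ∀ j, (t₁ (j + 1) : ℝ) - t₁ j < η) (m₂ : ∀ j, (t₂ (j + 1) : ℝ) - t₂ j < η) :
    ∃ t : ℕ → Icc (0 : ℝ) b, Monotone t ∧ t 0 = t₁ 0 ∧ (∀ j, t (n + j) = t₂ j) ∧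
      ∀ j, (t (j + 1) : ℝ) - t j < η := by
  have key : ∀ j, (fun j => if j ≤ n then t₁ j else t₂ (j - n)) (n + j) = t₂ j := by
    intro j
    rcases Nat.eq_zero_or_pos j with rfl | hj
    · simp [hn, h0]
    · simp [hj.ne']
  have hcase : ∀ P : Icc (0 : ℝ) b → Icc (0 : ℝ) b → Prop, (∀ j, P (t₁ j) (t₁ (j + 1))) →
      (∀ j, P (t₂ j) (t₂ (j + 1))) → ∀ j, P (if j ≤ n then t₁ j else t₂ (j - n))
        (if j + 1 ≤ n then t₁ (j + 1) else t₂ (j + 1 - n)) := by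
    intro P hP1 hP2 j
    by_cases hj : j + 1 ≤ n
    · rw [if_pos hj, if_pos (by omega)]; exact hP1 j
    · obtain ⟨i, rfl⟩ := Nat.exists_eq_add_of_le (show n ≤ j by omega)
      have := hP2 i
      rw [← key i, ← key (i + 1)] at this
      exact this
  exact ⟨fun j => if j ≤ n then t₁ j else t₂ (j - n),
    monotone_nat_of_le_succ (hcase (· ≤ ·) (fun j => h₁ (Nat.le_succ j))
      fun j => h₂ (Nat.le_succ j)), by simp, key,
    hcase (fun x y => (y : ℝ) - x < η) m₁ m₂⟩

/-- Solutions are constant where the driver is constant. -/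
lemma IsUniformSolution.eq_of_const {δ : ℝ≥0} {f : W → V →L[ℝ] W} {ξ : W}
    {ω : ExtInterval δ → V} {X : ExtInterval δ → W} (h : IsUniformSolution f ξ ω X)
    {u v : ExtInterval δ} (huv : u ≤ v) (hω : ∀ s, u ≤ s → s ≤ v → ω s = ω u) : X u = X v := by
  rw [eq_comm, ← sub_eq_zero, ← norm_le_zero_iff]
  refine le_of_forall_pos_le_add fun ε hε => ?_
  obtain ⟨η, hη, H⟩ := h.2 (ε / 2) (by positivity)
  obtain ⟨t₁, n₁, a₁, b₁, c₁, d₁⟩ := exists_fine_partition hη (ExtInterval.zero_le' u)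
  obtain ⟨t₂, n₂, a₂, b₂, c₂, d₂⟩ := exists_fine_partition hη huv
  obtain ⟨t, ht, ht0, htj, hmesh⟩ := exists_concat a₁ a₂ c₁ b₂ d₁ d₂
  have h1 := H t ht (ht0.trans b₁) hmesh n₁
  have h2 := H t ht (ht0.trans b₁) hmesh (n₁ + n₂)
  have hω' : ∀ j ≤ n₂, ω (t (n₁ + j)) = ω u := fun j hj => by
    rw [htj]
    exact hω _ (b₂ ▸ a₂ (Nat.zero_le j)) (c₂ ▸ a₂ hj)
  have e1 : t n₁ = u := by have := htj 0; rwa [add_zero, b₂] at this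
  have e2 : t (n₁ + n₂) = v := by rw [htj, c₂]
  rw [Finset.sum_range_add, Finset.sum_eq_zero (s := Finset.range n₂), add_zero, e2] at h2
  · rw [e1] at h1
    set R := ∑ j ∈ Finset.range n₁, f (X (t j)) (ω (t (j + 1)) - ω (t j))
    have e : X v - X u = (R - (X u - ξ)) - (R - (X v - ξ)) := by abel
    rw [e]
    refine (norm_sub_le _ _).trans ?_
    linarith
  · intro j hj
    rw [Finset.mem_range] at hj
    rw [add_assoc, hω' _ hj, hω' _ hj.le, sub_self, map_zero]

end Transfer

/-! ### Decorated paths with given extension -/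

section OfExt

variable {E F : Type*} [NormedAddCommGroup E] [NormedAddCommGroup F] [CompleteSpace F]

/-- The decorated path with the time set of `φ` whose extension is a given function `X` which is
constant on the stationary fibres. -/
noncomputable def PreDecoratedPath.ofExt (φ : PreDecoratedPath E) (X : ExtInterval 1 → F)
    (hX : FiniteOscillation X)
    (hc : ∀ u v : ExtInterval 1, baseTime φ.countable_Pi 1 u = baseTime φ.countable_Pi 1 v →
      (baseTime φ.countable_Pi 1 u : I) ∉ φ.Pi → X u = X v) : PreDecoratedPath F where
  path t s := X (gapPoint φ.countable_Pi t s)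
  Pi := φ.Pi
  countable_Pi := φ.countable_Pi
  isCadlag_path := by
    intro t
    by_cases ht : t ∈ φ.Pi
    · have hne : φ.Pi ≠ ∅ := nonempty_iff_ne_empty.1 ⟨t, ht⟩
      have hs := gapPoint_strictMono φ.countable_Pi ht
      refine (hX.comp hs.monotone fun g => ⟨gapPosition φ.countable_Pi 1 g,
        fun s s' _ h1 h2 => ?_⟩).isCadlag
      have h3 := baseTime_mono φ.countable_Pi 1 h1.le
      have h4 := baseTime_mono φ.countable_Pi 1 h2
      simp only [baseTime_gapPoint] at h3 h4
      have hg := gapPoint_gapPosition φ.countable_Pi hne g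
      rw [← le_antisymm h3 h4] at hg
      rw [← hg] at h1 h2
      exact ⟨hs.lt_iff_lt.1 h1, hs.le_iff_le.1 h2⟩
    · have e : (fun s => X (gapPoint φ.countable_Pi t s)) =
          fun _ => X (gapPoint φ.countable_Pi t 0) := by
        funext s
        exact hc _ _ (by rw [baseTime_gapPoint, baseTime_gapPoint]) (by rwa [baseTime_gapPoint])
      rw [e]
      exact fun s => ⟨continuousWithinAt_const, _, tendsto_const_nhds⟩
  isCadlag_endpoint := by
    refine (hX.comp (m := fun t => gapPoint φ.countable_Pi t 1)
      (fun t t' h => gapPoint_le_gapPoint φ.countable_Pi h 1)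
      fun g => ⟨baseTime φ.countable_Pi 1 g, fun s s' _ h1 h2 => ?_⟩).isCadlag
    have h3 := baseTime_mono φ.countable_Pi 1 h1.le
    have h4 := baseTime_mono φ.countable_Pi 1 h2
    simp only [baseTime_gapPoint] at h3 h4
    refine ⟨lt_of_le_of_ne h3 fun e => ?_, h4⟩
    have h5 := le_gapPoint_one φ.countable_Pi g
    rw [← e] at h5
    exact not_lt.2 h5 h1
  stationary := fun t ht s =>
    hc _ _ (by rw [baseTime_gapPoint, baseTime_gapPoint]) (by rwa [baseTime_gapPoint])
  finite_oscillations := by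
    classical
    intro ε hε
    obtain ⟨G, hG⟩ := hX ε hε
    refine (G.image fun g : ExtInterval 1 => baseTime φ.countable_Pi 1 g).finite_toSet.subset ?_
    rintro t ⟨-, s, hs⟩
    by_contra hn
    refine not_le.2 hs ?_
    rw [← dist_eq_norm, dist_comm]
    refine hG _ _ (gapPoint_mono φ.countable_Pi t unitInterval.nonneg') fun g hg h1 => ?_
    by_contra h2
    refine hn (Finset.mem_coe.2 (Finset.mem_image.2 ⟨g, hg, ?_⟩))
    have h3 := baseTime_mono φ.countable_Pi 1 h1.le
    have h4 := baseTime_mono φ.countable_Pi 1 (not_lt.1 h2)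
    simp only [baseTime_gapPoint] at h3 h4
    exact le_antisymm h4 h3

lemma PreDecoratedPath.ofExt_ext (φ : PreDecoratedPath E) (X : ExtInterval 1 → F)
    (hX : FiniteOscillation X)
    (hc : ∀ u v : ExtInterval 1, baseTime φ.countable_Pi 1 u = baseTime φ.countable_Pi 1 v →
      (baseTime φ.countable_Pi 1 u : I) ∉ φ.Pi → X u = X v) :
    (φ.ofExt X hX hc).ext 1 = X := by
  funext u
  rw [PreDecoratedPath.ext_eq]
  change X (gapPoint φ.countable_Pi (baseTime φ.countable_Pi 1 u)
    (gapPosition φ.countable_Pi 1 u)) = X u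
  by_cases hne : φ.Pi = ∅
  · exact hc _ _ (by rw [baseTime_gapPoint]) fun h => by simp [hne] at h
  · rw [gapPoint_gapPosition φ.countable_Pi hne]

lemma PreDecoratedPath.varSum_timeExt_le (φ : PreDecoratedPath E) {r : ℝ} (hr : 1 ≤ r) :
    varSum r (φ.timeExt 1) ≤ varSum r (φ.ext 1) + 1 := by
  refine varSum_le fun k t ht => ?_
  have hT : ∀ j, edist (φ.timeExt 1 (t (j + 1))).1 (φ.timeExt 1 (t j)).1 =
      ENNReal.ofReal ((φ.timeExt 1 (t (j + 1))).1 - (φ.timeExt 1 (t j)).1) := fun j => by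
    rw [edist_dist, Real.dist_eq,
      abs_of_nonneg (sub_nonneg.2 (φ.monotone_timeExt_fst (ht (Nat.le_succ j))))]
  have hT1 : ∀ u, (φ.timeExt 1 u).1 ∈ Icc (0 : ℝ) 1 := fun u => by
    rw [φ.timeExt_eq]; exact (baseTime φ.countable_Pi 1 u).2
  calc ∑ j ∈ Finset.range k, edist (φ.timeExt 1 (t (j + 1))) (φ.timeExt 1 (t j)) ^ r
      ≤ ∑ j ∈ Finset.range k, (edist (φ.ext 1 (t (j + 1))) (φ.ext 1 (t j)) ^ r +
          edist (φ.timeExt 1 (t (j + 1))).1 (φ.timeExt 1 (t j)).1) := by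
        refine Finset.sum_le_sum fun j _ => ?_
        have h1 : edist (φ.timeExt 1 (t (j + 1))).1 (φ.timeExt 1 (t j)).1 ≤ 1 := by
          rw [hT, ← ENNReal.ofReal_one]
          exact ENNReal.ofReal_le_ofReal (by linarith [(hT1 (t (j + 1))).2, (hT1 (t j)).1])
        rw [Prod.edist_eq]
        rcases le_total (edist (φ.timeExt 1 (t (j + 1))).1 (φ.timeExt 1 (t j)).1)
          (edist (φ.timeExt 1 (t (j + 1))).2 (φ.timeExt 1 (t j)).2) with h | h
        · rw [max_eq_right h, φ.timeExt_eq, φ.timeExt_eq]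
          exact le_self_add
        · rw [max_eq_left h]
          exact (ENNReal.rpow_le_self_of_le_one h1 hr).trans le_add_self
    _ ≤ _ := by
        rw [Finset.sum_add_distrib]
        refine add_le_add (sum_le_varSum r _ k ht) ?_
        simp only [hT]
        rw [← ENNReal.ofReal_sum_of_nonneg fun j _ =>
          sub_nonneg.2 (φ.monotone_timeExt_fst (ht (Nat.le_succ j))),
          Finset.sum_range_sub (fun j => (φ.timeExt 1 (t j)).1), ← ENNReal.ofReal_one]
        exact ENNReal.ofReal_le_ofReal (by linarith [(hT1 (t k)).2, (hT1 (t 0)).1])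

end OfExt

/-! ### Equations driven by decorated paths -/

section Solution

variable {E F : Type*} [NormedAddCommGroup E] [NormedSpace ℝ E] [NormedAddCommGroup F]
  [NormedSpace ℝ F]

/-- `X` solves the equation driven by `φ` at `δ = 1`, with the same time set and with finite
`r`-variation. -/
structure Solves (r : ℝ) (A : F → F) (B : F → E →L[ℝ] F) (ξ : F) (φ : PreDecoratedPath E)
    (X : PreDecoratedPath F) : Prop where
  Pi_eq : X.Pi = φ.Pi
  solution : IsUniformSolution (combinedField A B) ξ (φ.timeExt 1) (X.ext 1)
  varSum_lt : varSum r (X.ext 1) < ∞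

lemma baseTime_congr {Pi Pi' : Set I} (h : Pi = Pi') (hPi : Pi.Countable) (hPi' : Pi'.Countable)
    (δ : ℝ≥0) (u : ℝ) : baseTime hPi δ u = baseTime hPi' δ u := by
  subst h; rfl

lemma rescaleIso_congr {Pi Pi' : Set I} (h : Pi = Pi') (hPi : Pi.Countable) (hPi' : Pi'.Countable)
    {δ δ' : ℝ≥0} (hδ : 0 < δ) (hδ' : 0 < δ') :
    rescaleIso hPi hδ hδ' = rescaleIso hPi' hδ hδ' := by
  subst h; rfl

variable {A : F → F} {B : F → E →L[ℝ] F} {ξ : F} {p : ℝ≥0∞}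

lemma varSum_lt_top_iff {T Z : Type*} [LinearOrder T] [PseudoEMetricSpace Z] (hp1 : 1 ≤ p)
    (hp : p ≠ ∞) {h : T → Z} : varSum p.toReal h < ∞ ↔ pVariation p h < ∞ := by
  have h0 := ENNReal.toReal_pos (one_pos.trans_le hp1).ne' hp
  rw [pVariation_eq_varSum hp, ENNReal.rpow_lt_top_iff_of_pos (by positivity)]

/-- The defining property of solutions holds for all `δ` as soon as the equation at `δ = 1` is
solved. -/
lemma Solves.isYoungSolution [CompleteSpace F] (hp1 : 1 ≤ p) (hp : p ≠ ∞)
    {φ : PreDecoratedPath E} {X : PreDecoratedPath F} (h : Solves p.toReal A B ξ φ X) {δ : ℝ≥0}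
    (hδ : 0 < δ) : IsYoungSolution p (combinedField A B) ξ (φ.timeExt δ) (X.ext δ) := by
  have e1 : X.ext δ = fun u => X.ext 1 (rescaleIso φ.countable_Pi hδ one_pos u) := by
    funext u
    rw [← rescaleIso_congr h.Pi_eq X.countable_Pi, X.ext_rescale]
  have e2 : φ.timeExt δ = fun u => φ.timeExt 1 (rescaleIso φ.countable_Pi hδ one_pos u) := by
    funext u
    rw [φ.timeExt_rescale]
  have hs := h.solution.comp_orderIso (rescaleIso φ.countable_Pi hδ one_pos)
  rw [← e1, ← e2] at hs
  refine ⟨?_, ?_, hs.1, hs.hasYoungIntegral⟩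
  · rw [e1]; exact (X.finiteOscillation_ext.comp_orderIso _).isCadlag
  · rw [e1, pVariation_comp_orderIso]; exact (varSum_lt_top_iff hp1 hp).1 h.varSum_lt

lemma exists_le_ofReal {a b : ℝ≥0∞} (ha : a < ∞) (hb : b < ∞) :
    ∃ K : ℝ, 1 ≤ K ∧ a ≤ ENNReal.ofReal K ∧ b ≤ ENNReal.ofReal K := by
  refine ⟨max 1 (max a.toReal b.toReal), le_max_left _ _, ?_, ?_⟩
  · rw [← ENNReal.ofReal_toReal ha.ne]
    refine ENNReal.ofReal_le_ofReal ?_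
    rw [ENNReal.ofReal_toReal ha.ne]
    exact (le_max_left _ _).trans (le_max_right _ _)
  · rw [← ENNReal.ofReal_toReal hb.ne]
    refine ENNReal.ofReal_le_ofReal ?_
    rw [ENNReal.ofReal_toReal hb.ne]
    exact (le_max_right _ _).trans (le_max_right _ _)

lemma exists_exponent {r κ : ℝ} (hr : 1 ≤ r) (hrκ : r < 1 + κ) (hκ : κ ≤ 1) :
    ∃ a : ℝ, 1 / 2 < a ∧ 1 < κ * a + a ∧ a < 1 / r := by
  have h0 : 0 < r := by linarith
  obtain ⟨a, h1, h2⟩ := exists_between (one_div_lt_one_div_of_lt h0 hrκ)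
  have h3 : 0 < 1 + κ := by linarith
  refine ⟨a, lt_of_le_of_lt (one_div_le_one_div_of_le h3 (by linarith)) h1, ?_, h2⟩
  rw [div_lt_iff₀ h3] at h1
  linarith

lemma Solves.of_isYoungSolution {M L H κ : ℝ} (hAB : FieldBounds A B M L H κ) (hp1 : 1 ≤ p)
    (hp : p ≠ ∞) (hpκ : p.toReal < 1 + κ) {φ : PreDecoratedPath E} {X : PreDecoratedPath F}
    (hφ : varSum p.toReal (φ.ext 1) < ∞) (hPi : X.Pi = φ.Pi)
    (h : IsYoungSolution p (combinedField A B) ξ (φ.timeExt 1) (X.ext 1)) :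
    Solves p.toReal A B ξ φ X := by
  have hr : 1 ≤ p.toReal := by
    rw [← ENNReal.toReal_one]; exact (ENNReal.toReal_le_toReal ENNReal.one_ne_top hp).2 hp1
  have hX := (varSum_lt_top_iff hp1 hp).2 h.2.1
  have hω : varSum p.toReal (φ.timeExt 1) < ∞ :=
    (φ.varSum_timeExt_le hr).trans_lt (ENNReal.add_lt_top.2 ⟨hφ, ENNReal.one_lt_top⟩)
  obtain ⟨K, hK1, hKω, hKX⟩ := exists_le_ofReal hω hX
  obtain ⟨a, ha, -, har⟩ := exists_exponent hr hpκ hAB.κ_le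
  exact ⟨hPi, isUniformSolution_of_hasYoungIntegral (mul_nonneg zero_le_two hAB.M_nonneg)
    (mul_nonneg zero_le_two hAB.L_nonneg) hAB.norm_combinedField hAB.lip_combinedField hr ha har
    (zero_le_one.trans hK1) φ.finiteOscillation_timeExt X.finiteOscillation_ext hKω hKX h.2.2.1
    h.2.2.2, hX⟩

/-- Existence, with a bound on the variation of the solution by that of the driver. -/
theorem exists_solves [CompleteSpace F] {M L H κ : ℝ} (hAB : FieldBounds A B M L H κ) {r : ℝ}
    (hr : 1 ≤ r) (hrκ : r < 1 + κ) (ξ : F) (K : ℝ≥0) :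
    ∃ K' : ℝ≥0, ∀ φ : PreDecoratedPath E, varSum r (φ.ext 1) ≤ K →
      ∃ X : PreDecoratedPath F, Solves r A B ξ φ X ∧ varSum r (X.ext 1) ≤ K' := by
  obtain ⟨K', -, hK'⟩ := exists_uniformSolution hAB hr hrκ
    (show (1 : ℝ) ≤ K + 1 by linarith [K.2]) ξ
  refine ⟨K'.toNNReal, fun φ hφ => ?_⟩
  have hω : varSum r (φ.timeExt 1) ≤ ENNReal.ofReal (K + 1) := by
    refine (φ.varSum_timeExt_le hr).trans ?_
    have hK0 : (0 : ℝ) ≤ K := K.2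
    rw [ENNReal.ofReal_add hK0 zero_le_one, ENNReal.ofReal_coe_nnreal, ENNReal.ofReal_one]
    gcongr
  obtain ⟨X, h1, h2, h3⟩ := hK' (φ.timeExt 1) φ.monotone_timeExt_fst φ.finiteOscillation_timeExt hω
  have hc : ∀ u v : ExtInterval 1, baseTime φ.countable_Pi 1 u = baseTime φ.countable_Pi 1 v →
      (baseTime φ.countable_Pi 1 u : I) ∉ φ.Pi → X u = X v := by
    intro u v huv hu
    wlog hle : u ≤ v generalizing u v
    · exact (this v u huv.symm (huv ▸ hu) (le_of_not_ge hle)).symm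
    refine h1.eq_of_const hle fun s hus hsv => ?_
    have hs : baseTime φ.countable_Pi 1 s = baseTime φ.countable_Pi 1 u :=
      le_antisymm ((baseTime_mono φ.countable_Pi 1 hsv).trans_eq huv.symm)
        (baseTime_mono φ.countable_Pi 1 hus)
    rw [φ.timeExt_eq, φ.timeExt_eq, φ.ext_eq, φ.ext_eq, hs, φ.stationary _ hu,
      φ.stationary _ hu (gapPosition φ.countable_Pi 1 u)]
  refine ⟨φ.ofExt X h2 hc, ⟨rfl, ?_, ?_⟩, ?_⟩
  · rw [φ.ofExt_ext]; exact h1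
  · rw [φ.ofExt_ext]; exact h3.trans_lt ENNReal.ofReal_lt_top
  · rw [φ.ofExt_ext]; exact h3

lemma le_coe_ofReal {a : ℝ≥0∞} {K : ℝ≥0} (h : a ≤ K) : a ≤ ENNReal.ofReal K := by
  rwa [ENNReal.ofReal_coe_nnreal]

/-- On bounded sets of `r`-variation solutions depend uniformly continuously on the driver, with
respect to `α_∞`. -/
theorem Solves.exists_alphaInf_lt {M L H κ : ℝ} (hAB : FieldBounds A B M L H κ) {r : ℝ}
    (hr : 1 ≤ r) (hrκ : r < 1 + κ) (ξ : F) (K : ℝ≥0) {η : ℝ≥0∞} (hη : 0 < η) :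
    ∃ ε : ℝ≥0∞, 0 < ε ∧ ∀ (φ₁ φ₂ : PreDecoratedPath E) (X₁ X₂ : PreDecoratedPath F),
      Solves r A B ξ φ₁ X₁ → Solves r A B ξ φ₂ X₂ → varSum r (φ₁.ext 1) ≤ K →
      varSum r (φ₂.ext 1) ≤ K → varSum r (X₁.ext 1) ≤ K → varSum r (X₂.ext 1) ≤ K →
      φ₁.alphaInf φ₂ < ε → X₁.alphaInf X₂ < η := by
  obtain ⟨a, ha, ha1, har⟩ := exists_exponent hr hrκ hAB.κ_le
  obtain ⟨C, hC0, hC⟩ := exists_solution_sub_le hAB hr ha1 har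
    (show (1 : ℝ) ≤ ((K + 1 : ℝ≥0) : ℝ) by push_cast; linarith [K.2]) ξ
  have hθ : 0 < 1 - a / (1 / r) := by
    rw [sub_pos, div_lt_one (by positivity)]; exact har
  obtain ⟨η', h0, h1⟩ := exists_between hη
  have hη' : 0 < η'.toReal := ENNReal.toReal_pos h0.ne' (ne_top_of_lt h1)
  obtain ⟨ε, hε, hε1, hCε, hεη⟩ := exists_pos_le_one_mul_rpow_le C hθ hη'
  refine ⟨ENNReal.ofReal ε, ENNReal.ofReal_pos.2 hε,
    fun φ₁ φ₂ X₁ X₂ hs₁ hs₂ hφ₁ hφ₂ hX₁ hX₂ h => lt_of_le_of_lt ?_ h1⟩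
  have hω : ∀ φ : PreDecoratedPath E, varSum r (φ.ext 1) ≤ K →
      varSum r (φ.timeExt 1) ≤ ENNReal.ofReal (K + 1 : ℝ≥0) := fun φ hφ =>
    le_coe_ofReal ((φ.varSum_timeExt_le hr).trans (by push_cast; gcongr))
  have hX : ∀ X : PreDecoratedPath F, varSum r (X.ext 1) ≤ K →
      varSum r (X.ext 1) ≤ ENNReal.ofReal (K + 1 : ℝ≥0) := fun X hX =>
    le_coe_ofReal (hX.trans (by push_cast; exact le_self_add))
  rw [PreDecoratedPath.alphaInf_eq] at h ⊢
  obtain ⟨ρ, hρ⟩ := iInf_lt_iff.1 h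
  have hρ' : ∀ u, ‖φ₁.timeExt 1 (ρ u) - φ₂.timeExt 1 u‖ ≤ ε := fun u => by
    have := (le_iSup (fun u => edist (φ₁.timeExt 1 (ρ u)) (φ₂.timeExt 1 u)) u).trans hρ.le
    rwa [edist_dist, dist_eq_norm, ENNReal.ofReal_le_ofReal_iff hε.le] at this
  have key := hC (fun u => φ₁.timeExt 1 (ρ u)) (φ₂.timeExt 1) (fun u => X₁.ext 1 (ρ u)) (X₂.ext 1)
    ε hε hε1 (fun s s' hss' => φ₁.monotone_timeExt_fst (ρ.monotone hss'))
    (by rw [varSum_comp_orderIso]; exact hω φ₁ hφ₁) (hω φ₂ hφ₂)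
    (by rw [varSum_comp_orderIso]; exact hX X₁ hX₁) (hX X₂ hX₂)
    (hs₁.solution.comp_orderIso ρ) hs₂.solution hρ'
  refine iInf_le_of_le ρ (iSup_le fun u => ?_)
  rw [X₁.timeExt_eq, X₂.timeExt_eq, Prod.edist_eq, ← ENNReal.ofReal_toReal (ne_top_of_lt h1)]
  refine max_le ?_ ?_
  · rw [baseTime_congr hs₁.Pi_eq _ φ₁.countable_Pi, baseTime_congr hs₂.Pi_eq _ φ₂.countable_Pi,
      edist_dist]
    refine ENNReal.ofReal_le_ofReal (le_trans ?_ hεη)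
    have h2 := (norm_fst_le (φ₁.timeExt 1 (ρ u) - φ₂.timeExt 1 u)).trans (hρ' u)
    rw [φ₁.timeExt_eq, φ₂.timeExt_eq] at h2
    exact h2
  · rw [edist_dist, dist_eq_norm]
    exact ENNReal.ofReal_le_ofReal ((key u).trans hCε)

lemma Solves.alphaInf_eq_zero {M L H κ : ℝ} (hAB : FieldBounds A B M L H κ) {r : ℝ}
    (hr : 1 ≤ r) (hrκ : r < 1 + κ) {φ₁ φ₂ : PreDecoratedPath E} {X₁ X₂ : PreDecoratedPath F}
    (h₁ : Solves r A B ξ φ₁ X₁) (h₂ : Solves r A B ξ φ₂ X₂) (hφ₁ : varSum r (φ₁.ext 1) < ∞)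
    (hφ₂ : varSum r (φ₂.ext 1) < ∞) (h : φ₁.alphaInf φ₂ = 0) : X₁.alphaInf X₂ = 0 := by
  refine nonpos_iff_eq_zero.1 (le_of_forall_gt_imp_ge_of_dense fun η hη => ?_)
  lift varSum r (φ₁.ext 1) to ℝ≥0 using hφ₁.ne with a ha
  lift varSum r (φ₂.ext 1) to ℝ≥0 using hφ₂.ne with b hb
  have hX₁ := h₁.varSum_lt
  have hX₂ := h₂.varSum_lt
  lift varSum r (X₁.ext 1) to ℝ≥0 using hX₁.ne with c hc
  lift varSum r (X₂.ext 1) to ℝ≥0 using hX₂.ne with d hd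
  obtain ⟨ε, hε, H⟩ := Solves.exists_alphaInf_lt hAB hr hrκ ξ (a + b + c + d) hη
  refine (H φ₁ φ₂ X₁ X₂ h₁ h₂ ?_ ?_ ?_ ?_ (by rwa [h])).le
  · rw [← ha]; exact_mod_cast le_self_add.trans (le_self_add.trans le_self_add)
  · rw [← hb]; exact_mod_cast (le_add_self.trans le_self_add).trans le_self_add
  · rw [← hc]; exact_mod_cast le_add_self.trans le_self_add
  · rw [← hd]; exact_mod_cast le_add_self

end Solution

/-! ### The solution map -/

section SolutionMap

variable {E F : Type*} [NormedAddCommGroup E] [NormedSpace ℝ E] [NormedAddCommGroup F]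
  [NormedSpace ℝ F] [CompleteSpace F]

lemma varSum_le_of_pVariation_le {T Z : Type*} [LinearOrder T] [PseudoEMetricSpace Z] {p : ℝ≥0∞}
    (hp1 : 1 ≤ p) (hp : p ≠ ∞) {h : T → Z} {K : ℝ≥0} (hK : pVariation p h ≤ K) :
    varSum p.toReal h ≤ (K ^ p.toReal : ℝ≥0) := by
  rw [ENNReal.coe_rpow_of_nonneg _ ENNReal.toReal_nonneg]
  exact (pVariation_le_iff (one_pos.trans_le hp1).ne' hp).1 hK

/-- The solution map, together with its continuity from `α_∞` to `α_{q-var}` on sets of bounded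
`p`-variation. -/
theorem exists_solutionMap {A : F → F} {B : F → E →L[ℝ] F} {M L H κ : ℝ}
    (hAB : FieldBounds A B M L H κ) {p : ℝ≥0∞} (hp1 : 1 ≤ p) (hp : p ≠ ∞)
    (hpκ : p.toReal < 1 + κ) (ξ : F) :
    ∃ S : VarDecoratedPath p E → VarDecoratedPath p F,
      (∀ ψ X, IsDecoratedSolution p A B ξ ψ.1 X.1 ↔ X = S ψ) ∧
      ∀ (K : ℝ≥0) (q : ℝ≥0∞), p < q → ∀ η : ℝ≥0∞, 0 < η → ∃ ε : ℝ≥0∞, 0 < ε ∧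
        ∀ ψ₁ ψ₂ : VarDecoratedPath p E, DecoratedPath.pVar p ψ₁.1 ≤ K →
          DecoratedPath.pVar p ψ₂.1 ≤ K → edist ψ₁.1 ψ₂.1 < ε →
          PreDecoratedPath.alphaVar q (Quotient.out (S ψ₁).1) (Quotient.out (S ψ₂).1) < η := by
  have hp0 : p ≠ 0 := (one_pos.trans_le hp1).ne'
  have hr : 1 ≤ p.toReal := by
    rw [← ENNReal.toReal_one]; exact (ENNReal.toReal_le_toReal ENNReal.one_ne_top hp).2 hp1
  have hfin : ∀ ψ : VarDecoratedPath p E,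
      varSum p.toReal ((Quotient.out ψ.1 : PreDecoratedPath E).ext 1) < ∞ := fun ψ =>
    (varSum_lt_top_iff hp1 hp).2 ψ.2
  have hex : ∀ ψ : VarDecoratedPath p E, ∃ X : PreDecoratedPath F,
      Solves p.toReal A B ξ (Quotient.out ψ.1) X := by
    intro ψ
    have h := hfin ψ
    lift varSum p.toReal ((Quotient.out ψ.1 : PreDecoratedPath E).ext 1) to ℝ≥0 using h.ne
      with a ha
    obtain ⟨K', hK'⟩ := exists_solves hAB hr hpκ ξ a
    obtain ⟨X, hX, -⟩ := hK' (Quotient.out ψ.1) ha.ge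
    exact ⟨X, hX⟩
  choose X hX using hex
  let S : VarDecoratedPath p E → VarDecoratedPath p F := fun ψ =>
    ⟨SeparationQuotient.mk (X ψ), by
      rw [DecoratedPath.pVar_mk hp0 hp]; exact (varSum_lt_top_iff hp1 hp).1 (hX ψ).varSum_lt⟩
  have hout : ∀ ψ, (Quotient.out (S ψ).1).alphaInf (X ψ) = 0 := fun ψ =>
    DecoratedPath.alphaInf_out _
  refine ⟨S, fun ψ Y => ⟨?_, ?_⟩, fun K q hpq η hη => ?_⟩
  · rintro ⟨φ', X', h1, h2, hPi, hsol⟩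
    have h0 : φ'.alphaInf (Quotient.out ψ.1) = 0 := by
      rw [← DecoratedPath.mk_eq_mk, h1, DecoratedPath.mk_out]
    have hφ' : varSum p.toReal (φ'.ext 1) < ∞ := by
      rw [varSum_lt_top_iff hp1 hp, PreDecoratedPath.pVariation_ext_congr hp0 hp h0]
      exact ψ.2
    have hs := Solves.of_isYoungSolution hAB hp1 hp hpκ hφ' hPi (hsol 1 one_pos)
    refine Subtype.ext ?_
    rw [← h2]
    exact DecoratedPath.mk_eq_mk.2 (hs.alphaInf_eq_zero hAB hr hpκ (hX ψ) hφ' (hfin ψ) h0)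
  · rintro rfl
    exact ⟨Quotient.out ψ.1, X ψ, DecoratedPath.mk_out _, rfl, (hX ψ).Pi_eq,
      fun δ hδ => (hX ψ).isYoungSolution hp1 hp hδ⟩
  · obtain ⟨K', hK'⟩ := exists_solves hAB hr hpκ ξ (K ^ p.toReal)
    have hbd : ∀ ψ : VarDecoratedPath p E, DecoratedPath.pVar p ψ.1 ≤ K →
        varSum p.toReal ((X ψ).ext 1) ≤ K' ∧
          varSum p.toReal ((Quotient.out (S ψ).1 : PreDecoratedPath F).ext 1) ≤ K' := by
      intro ψ hψ
      obtain ⟨X', hs, hle⟩ := hK' (Quotient.out ψ.1) (varSum_le_of_pVariation_le hp1 hp hψ)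
      have h0 := (hX ψ).alphaInf_eq_zero hAB hr hpκ hs (hfin ψ) (hfin ψ)
        (PreDecoratedPath.alphaInf_self _)
      have e1 := PreDecoratedPath.pVariation_ext_congr hp0 hp h0
      have e2 := PreDecoratedPath.pVariation_ext_congr hp0 hp (hout ψ)
      have hrp := ENNReal.toReal_pos hp0 hp
      have hinj := ENNReal.rpow_left_injective (one_div_pos.2 hrp).ne'
      rw [pVariation_eq_varSum hp, pVariation_eq_varSum hp] at e1 e2
      have e1' := hinj e1
      have e2' := hinj e2
      exact ⟨e1'.le.trans hle, e2'.le.trans (e1'.le.trans hle)⟩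
    obtain ⟨ε', hε', H'⟩ := PreDecoratedPath.exists_alphaVar_lt (E := F) hp1 hpq K' hη
    obtain ⟨ε, hε, H⟩ := Solves.exists_alphaInf_lt hAB hr hpκ ξ (K ^ p.toReal + K') hε'
    refine ⟨ε, hε, fun ψ₁ ψ₂ h₁ h₂ h => H' _ _ (hbd ψ₁ h₁).2 (hbd ψ₂ h₂).2 ?_⟩
    have hd : (Quotient.out ψ₁.1).alphaInf (Quotient.out ψ₂.1) < ε := by
      rwa [← DecoratedPath.mk_out ψ₁.1, ← DecoratedPath.mk_out ψ₂.1,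
        SeparationQuotient.edist_mk] at h
    have key := H _ _ _ _ (hX ψ₁) (hX ψ₂)
      ((varSum_le_of_pVariation_le hp1 hp h₁).trans (by push_cast; exact le_self_add))
      ((varSum_le_of_pVariation_le hp1 hp h₂).trans (by push_cast; exact le_self_add))
      ((hbd ψ₁ h₁).1.trans (by push_cast; exact le_add_self))
      ((hbd ψ₂ h₂).1.trans (by push_cast; exact le_add_self)) hd
    have h₂' := hout ψ₂
    rw [PreDecoratedPath.alphaInf_comm] at h₂'
    refine lt_of_le_of_lt ?_ key
    calc (Quotient.out (S ψ₁).1).alphaInf (Quotient.out (S ψ₂).1)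
        ≤ (Quotient.out (S ψ₁).1).alphaInf (X ψ₁) + ((X ψ₁).alphaInf (X ψ₂) +
            (X ψ₂).alphaInf (Quotient.out (S ψ₂).1)) :=
          (PreDecoratedPath.alphaInf_triangle _ (X ψ₁) _).trans
            (add_le_add le_rfl (PreDecoratedPath.alphaInf_triangle _ (X ψ₂) _))
      _ = (X ψ₁).alphaInf (X ψ₂) := by rw [hout, h₂', zero_add, add_zero]

end SolutionMap

/-! ### Weak convergence under tightness -/

section Weak

variable {D Z : Type*} [TopologicalSpace D] [MeasurableSpace D] [BorelSpace D]
  [HasOuterApproxClosed D] {Ω : ℕ → Type*} {Ω' : Type*} [∀ n, MeasurableSpace (Ω n)]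
  [MeasurableSpace Ω'] {P : ∀ n, Measure (Ω n)} {P' : Measure Ω'}
  [∀ n, IsProbabilityMeasure (P n)] [IsProbabilityMeasure P'] {X : ∀ n, Ω n → D} {X' : Ω' → D}
  {v : D → ℝ≥0∞}

/-- Tightness of a lower semicontinuous functional passes to the weak limit. -/
theorem ae_lt_top_of_tight (h : TendstoInDistribution X atTop X' P P')
    (hv : ∀ K : ℝ≥0, IsClosed {x | v x ≤ K})
    (ht : ∀ ε : ℝ≥0∞, 0 < ε → ∃ K : ℝ≥0, ∀ n, P n {ω | (K : ℝ≥0∞) < v (X n ω)} ≤ ε) :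
    ∀ᵐ ω ∂P', v (X' ω) < ∞ := by
  rw [ae_iff]
  refine nonpos_iff_eq_zero.1 (le_of_forall_gt_imp_ge_of_dense fun ε hε => ?_)
  obtain ⟨K, hK⟩ := ht ε hε
  have hopen : IsOpen {x | v x ≤ K}ᶜ := (hv K).isOpen_compl
  have h1 := ProbabilityMeasure.le_liminf_measure_open_of_tendsto h.tendsto hopen
  have h2 : ∀ n, (P n).map (X n) {x | v x ≤ K}ᶜ ≤ ε := fun n => by
    rw [Measure.map_apply_of_aemeasurable (h.forall_aemeasurable n) hopen.measurableSet]
    refine le_trans (measure_mono fun ω hω => ?_) (hK n)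
    have hω' : ¬ v (X n ω) ≤ K := hω
    exact not_le.1 hω'
  calc P' {ω | ¬ v (X' ω) < ∞} ≤ P' (X' ⁻¹' {x | v x ≤ K}ᶜ) := by
        refine measure_mono fun ω hω => ?_
        have : v (X' ω) = ∞ := not_lt_top_iff.1 hω
        simp [this]
    _ = P'.map X' {x | v x ≤ K}ᶜ :=
        (Measure.map_apply_of_aemeasurable h.aemeasurable_limit hopen.measurableSet).symm
    _ ≤ _ := h1
    _ ≤ liminf (fun _ : ℕ => ε) atTop := liminf_le_liminf (Eventually.of_forall h2)
    _ = ε := liminf_const ε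

variable [TopologicalSpace Z] [MeasurableSpace Z] [BorelSpace Z]

/-- A continuous mapping theorem for maps `S` which are continuous on the closed sets `{v ≤ K}`
only, where `v` is tight along the sequence. -/
theorem tendstoInDistribution_comp_of_tight (h : TendstoInDistribution X atTop X' P P')
    (hv : ∀ K : ℝ≥0, IsClosed {x | v x ≤ K})
    (ht : ∀ ε : ℝ≥0∞, 0 < ε → ∃ K : ℝ≥0, ∀ n, P n {ω | (K : ℝ≥0∞) < v (X n ω)} ≤ ε)
    {S : D → Z} (hS : ∀ (K : ℝ≥0) (G : Set Z), IsClosed G → IsClosed {x | v x ≤ K ∧ S x ∈ G})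
    {z : Z} (hz : ∀ x, v x = ∞ → S x = z) :
    TendstoInDistribution (fun n ω => S (X n ω)) atTop (fun ω => S (X' ω)) P P' := by
  classical
  have hsplit : ∀ G : Set Z, S ⁻¹' G = (⋃ K : ℕ, {x | v x ≤ ((K : ℝ≥0) : ℝ≥0∞) ∧ S x ∈ G}) ∪
      (if z ∈ G then (⋃ K : ℕ, {x | v x ≤ ((K : ℝ≥0) : ℝ≥0∞)})ᶜ else ∅) := by
    intro G
    ext x
    simp only [mem_preimage, mem_union, mem_iUnion, mem_ofPred_eq]
    by_cases hx : v x = ∞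
    · rw [hz x hx]
      split_ifs with hzG <;> simp [hx, hzG]
    · obtain ⟨K, hK⟩ := ENNReal.exists_nat_gt hx
      have hK' : v x ≤ ((K : ℝ≥0) : ℝ≥0∞) := by simpa using hK.le
      constructor
      · exact fun hG => Or.inl ⟨K, hK', hG⟩
      · rintro (⟨_, _, hG⟩ | hG)
        · exact hG
        · split_ifs at hG
          · exact absurd (mem_iUnion.2 ⟨K, hK'⟩) hG
          · exact absurd hG (notMem_empty x)
  have hmeas : Measurable S := by
    refine measurable_of_isClosed fun G hG => ?_
    rw [hsplit]
    refine (MeasurableSet.iUnion fun K : ℕ => (hS K G hG).measurableSet).union ?_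
    split_ifs
    · exact (MeasurableSet.iUnion fun K : ℕ => (hv K).measurableSet).compl
    · exact MeasurableSet.empty
  have hX := h.forall_aemeasurable
  have hX' := h.aemeasurable_limit
  have hSX : ∀ n, AEMeasurable (fun ω => S (X n ω)) (P n) := fun n => hmeas.comp_aemeasurable (hX n)
  have hSX' : AEMeasurable (fun ω => S (X' ω)) P' := hmeas.comp_aemeasurable hX'
  refine ⟨hSX, hSX',
    tendsto_of_forall_isClosed_limsup_le' fun G hG => ?_⟩
  refine ENNReal.le_of_forall_pos_le_add fun ε hε _ => ?_
  obtain ⟨K, hK⟩ := ht ε (by exact_mod_cast hε)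
  have hC := hS K G hG
  have h1 := ProbabilityMeasure.limsup_measure_closed_le_of_tendsto h.tendsto hC
  have h2 : ∀ n, (P n).map (fun ω => S (X n ω)) G ≤
      (P n).map (X n) {x | v x ≤ K ∧ S x ∈ G} + ε := fun n => by
    rw [Measure.map_apply_of_aemeasurable (hSX n) hG.measurableSet,
      Measure.map_apply_of_aemeasurable (hX n) hC.measurableSet]
    refine le_trans (measure_mono (t := X n ⁻¹' {x | v x ≤ K ∧ S x ∈ G} ∪
      {ω | (K : ℝ≥0∞) < v (X n ω)}) fun ω hω => ?_)
      ((measure_union_le _ _).trans (add_le_add le_rfl (hK n)))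
    by_cases hv : v (X n ω) ≤ K
    · exact Or.inl ⟨hv, hω⟩
    · exact Or.inr (not_le.1 hv)
  calc limsup (fun n => (P n).map (fun ω => S (X n ω)) G) atTop
      ≤ limsup (fun n => (P n).map (X n) {x | v x ≤ K ∧ S x ∈ G} + ε) atTop :=
        limsup_le_limsup (Eventually.of_forall h2)
    _ = limsup (fun n => (P n).map (X n) {x | v x ≤ K ∧ S x ∈ G}) atTop + ε :=
        limsup_add_const _ _ _ (by isBoundedDefault) (by isBoundedDefault)
    _ ≤ P'.map X' {x | v x ≤ K ∧ S x ∈ G} + ε := add_le_add h1 le_rfl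
    _ ≤ P'.map (fun ω => S (X' ω)) G + ε := by
        rw [Measure.map_apply_of_aemeasurable hSX' hG.measurableSet,
          Measure.map_apply_of_aemeasurable hX' hC.measurableSet]
        exact add_le_add (measure_mono fun ω hω => hω.2) le_rfl

end Weak

/-! ### Solution and weak continuity -/

theorem theorem2p5 {m d : ℕ} (hm : 1 ≤ m) (hd : 1 ≤ d) {p : ℝ≥0∞} (hp1 : 1 ≤ p) (hp2 : p < 2)
    {β γ : ℝ} (hβ : 1 < β) (hγ : p < ENNReal.ofReal γ)
    {A : EuclideanSpace ℝ (Fin m) → EuclideanSpace ℝ (Fin m)} (hA : IsHolderClass β A)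
    {B : EuclideanSpace ℝ (Fin m) → EuclideanSpace ℝ (Fin d) →L[ℝ] EuclideanSpace ℝ (Fin m)}
    (hB : IsHolderClass γ B) (ξ : EuclideanSpace ℝ (Fin m))
    {Ω : ℕ → Type*} {Ω' : Type*} [∀ n, MeasurableSpace (Ω n)] [MeasurableSpace Ω']
    (P : ∀ n, Measure (Ω n)) (P' : Measure Ω')
    [∀ n, IsProbabilityMeasure (P n)] [IsProbabilityMeasure P']
    (φ : ∀ n, Ω n → VarDecoratedPath p (EuclideanSpace ℝ (Fin d)))
    (φlim : Ω' → DecoratedPath (EuclideanSpace ℝ (Fin d)))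
    (hconv : ConvergesWeakly (alphaInfTopology (EuclideanSpace ℝ (Fin d))) P P'
      (fun n ω => (φ n ω).1) φlim)
    (htight : ∀ ε : ℝ≥0∞, 0 < ε → ∃ K : ℝ≥0, ∀ n,
      P n {ω | (K : ℝ≥0∞) < DecoratedPath.pVar p (φ n ω).1} ≤ ε) :
    (∀ᵐ ω ∂P', DecoratedPath.pVar p (φlim ω) < ∞) ∧
    ∃ S : VarDecoratedPath p (EuclideanSpace ℝ (Fin d)) →
        VarDecoratedPath p (EuclideanSpace ℝ (Fin m)),
      (∀ ψ X, IsDecoratedSolution p A B ξ ψ.1 X.1 ↔ X = S ψ) ∧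
      ∀ X : Ω' → VarDecoratedPath p (EuclideanSpace ℝ (Fin m)),
        (∀ᵐ ω ∂P', ∀ h : DecoratedPath.pVar p (φlim ω) < ∞, X ω = S ⟨φlim ω, h⟩) →
        ∀ q : ℝ≥0∞, p < q →
          ConvergesWeakly (alphaVarTopology q p (EuclideanSpace ℝ (Fin m))) P P'
            (fun n ω => S (φ n ω)) X := by
  have hp : p ≠ ∞ := ne_top_of_lt hp2
  have hp0 : p ≠ 0 := (one_pos.trans_le hp1).ne'
  have hr : 1 ≤ p.toReal := by
    rw [← ENNReal.toReal_one]; exact (ENNReal.toReal_le_toReal ENNReal.one_ne_top hp).2 hp1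
  have hpγ : p.toReal < γ := ENNReal.toReal_lt_of_lt_ofReal hγ
  have hp2' : p.toReal < 2 := by
    have := (ENNReal.toReal_lt_toReal hp ENNReal.ofNat_ne_top).2 hp2
    simpa using this
  obtain ⟨M, L, H, hAB⟩ := IsHolderClass.exists_fieldBounds hβ (hr.trans_lt hpγ) hA hB
  have hpκ : p.toReal < 1 + min (γ - 1) 1 := by
    rw [← sub_lt_iff_lt_add']
    exact lt_min (by linarith) (by linarith)
  let _ : MeasurableSpace (DecoratedPath (EuclideanSpace ℝ (Fin d))) := borel _
  have _ : BorelSpace (DecoratedPath (EuclideanSpace ℝ (Fin d))) := ⟨rfl⟩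
  have _ : HasOuterApproxClosed (DecoratedPath (EuclideanSpace ℝ (Fin d))) :=
    DecoratedPath.hasOuterApproxClosed _
  have hconv' : TendstoInDistribution (fun n ω => (φ n ω).1) atTop φlim P P' := hconv
  have hclosed := fun K : ℝ≥0 =>
    DecoratedPath.isClosed_pVar_le (E := EuclideanSpace ℝ (Fin d)) hp0 hp K
  have hae := ae_lt_top_of_tight hconv' hclosed htight
  obtain ⟨S, hS, hScont⟩ := exists_solutionMap hAB hp1 hp hpκ ξ
  refine ⟨hae, S, hS, fun X hX q hpq => ?_⟩
  obtain ⟨ω₀⟩ := P'.nonempty_of_neZero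
  classical
  -- the solution map, extended by a constant to the paths of infinite variation
  let T : DecoratedPath (EuclideanSpace ℝ (Fin d)) →
      VarDecoratedPath p (EuclideanSpace ℝ (Fin m)) :=
    fun x => if h : DecoratedPath.pVar p x < ∞ then S ⟨x, h⟩ else X ω₀
  have hT : ∀ ψ : VarDecoratedPath p (EuclideanSpace ℝ (Fin d)), T ψ.1 = S ψ := fun ψ => dif_pos ψ.2
  let _ : TopologicalSpace (VarDecoratedPath p (EuclideanSpace ℝ (Fin m))) := alphaVarTopology q p _
  let _ : MeasurableSpace (VarDecoratedPath p (EuclideanSpace ℝ (Fin m))) := borel _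
  have _ : BorelSpace (VarDecoratedPath p (EuclideanSpace ℝ (Fin m))) := ⟨rfl⟩
  change TendstoInDistribution (fun n ω => S (φ n ω)) atTop X P P'
  have key := tendstoInDistribution_comp_of_tight hconv' hclosed htight (S := T) (z := X ω₀)
    (fun K G hG => ?_) (fun x hx => dif_neg (by simp [hx]))
  · refine key.congr (fun n => Eventually.of_forall fun ω => hT (φ n ω)) ?_
    filter_upwards [hae, hX] with ω h1 h2
    rw [h2 h1]
    exact hT ⟨φlim ω, h1⟩
  -- `T` is continuous on the closed set `{pVar ≤ K}`, although not on the whole space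
  · refine isClosed_of_closure_subset fun x hx => ?_
    have hxK : DecoratedPath.pVar p x ≤ K :=
      closure_minimal (fun y hy => hy.1) (hclosed K) hx
    refine ⟨hxK, ?_⟩
    by_contra hxG
    have hxlt : DecoratedPath.pVar p x < ∞ := hxK.trans_lt ENNReal.coe_lt_top
    obtain ⟨η, hη, hball⟩ := hG.isOpen_compl (T x) hxG
    obtain ⟨ε, hε, hcont⟩ := hScont K q hpq η hη
    obtain ⟨y, hy, hxy⟩ := DecoratedPath.exists_edist_lt hx hε
    have hylt : DecoratedPath.pVar p y < ∞ := hy.1.trans_lt ENNReal.coe_lt_top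
    refine hball (T y) ?_ hy.2
    have hTx : T x = S ⟨x, hxlt⟩ := hT ⟨x, hxlt⟩
    have hTy : T y = S ⟨y, hylt⟩ := hT ⟨y, hylt⟩
    simp only [hTx, hTy]
    exact hcont ⟨x, hxlt⟩ ⟨y, hylt⟩ hxK hy.1 hxy
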